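/- Let $A=\mathbb{C}[x,y]/(xy)$, and for $n\ge 1$ let the symmetric group $S_n$ act on the commutative algebra $A^{\otimes n}$ by permuting the tensor factors. Let $x_k$ and $y_k$ be the elements $x$ and $y$ in the $k$-th tensor factor; for $I\subseteq\{1,\dots,n\}$ put $x_I=\prod_{k\in I}x_k$ and $y_I=\prod_{k\in I}y_k$, and let $e_k=\sum_{|I|=k}x_I$ and $f_k=\sum_{|I|=k}y_I$ be the elementary symmetric polynomials. Let $J_n\subset A^{\otimes n}$ be the ideal generated by all $S_n$-invariant elements $P$ with $P(0,\dots,0)=0$ (the value at $x_k=y_k=0$ for all $k$), and let $R_n=A^{\otimes n}_{S_n}=A^{\otimes n}/J_n$ be the symmetric coinvariant algebra. Let $F^pA^{\otimes n}=\sum_{|J|=p}y_JA^{\otimes n}$, let $F^pR_n$ be its image in $R_n$, and let $\operatorname{gr}^pR_n=F^pR_n/F^{p+1}R_n$. For $1\le i,j\le n$ let $$R^n_{i,j}=A^{\otimes n}/I^n_{i,j},\qquad I^n_{i,j}=\bigl\langle e_1,\dots,e_{i-1},\ x_I\ (|I|=i),\ f_1,\dots,f_{j-1},\ y_J\ (|J|=j)\bigr\rangle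 .$$ All these spaces carry the induced actions of $S_n$. Let $1\le i\le n-1$. Then the identity of $A^{\otimes n}$ induces well-defined homomorphisms of $S_n$-modules $\phi$ (sending the class of $P\in F^iA^{\otimes n}$ in $\operatorname{gr}^iR_n$ to the class of $P$) and $\psi$ (sending the class of $P\in A^{\otimes n}$ to the class of $P$) which form an exact sequence of $S_n$-modules $$0\longrightarrow \operatorname{gr}^iR_n\xrightarrow{\ \phi\ }R^n_{n-i,i+1}\xrightarrow{\ \psi\ }R^n_{n-i,i}\longrightarrow 0 .$$ Moreover there is an isomorphism of $S_n$-modules $$\operatorname{gr}^iR_n\simeq\operatorname{Ind}_{S_2}^{S_n}L_{(1,1)},$$ where $S_2\subseteq S_n$ is the subgroup permuting the first two letters and $L_{(1,1)}$ is its sign representation. -/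

import Mathlib

open scoped TensorProduct BigOperators

noncomputable section

namespace DoublePoint

/-- The coordinate ring `A = ℂ[x, y] / (x y)` of the double point. -/
def A : Type :=
  MvPolynomial (Fin 2) ℂ ⧸ (Ideal.span {MvPolynomial.X 0 * MvPolynomial.X 1} :
    Ideal (MvPolynomial (Fin 2) ℂ))

instance : CommRing A :=
  inferInstanceAs (CommRing (MvPolynomial (Fin 2) ℂ ⧸
    (Ideal.span {MvPolynomial.X 0 * MvPolynomial.X 1} : Ideal (MvPolynomial (Fin 2) ℂ))))

instance : Algebra ℂ A :=
  inferInstanceAs (Algebra ℂ (MvPolynomial (Fin 2) ℂ ⧸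
    (Ideal.span {MvPolynomial.X 0 * MvPolynomial.X 1} : Ideal (MvPolynomial (Fin 2) ℂ))))

/-- The quotient map `ℂ[x, y] → A`. -/
def mkA : MvPolynomial (Fin 2) ℂ →ₐ[ℂ] A :=
  Ideal.Quotient.mkₐ ℂ (Ideal.span {MvPolynomial.X 0 * MvPolynomial.X 1} :
    Ideal (MvPolynomial (Fin 2) ℂ))

/-- The class of `x` in `A`. -/
def xA : A := mkA (MvPolynomial.X 0)

/-- The class of `y` in `A`. -/
def yA : A := mkA (MvPolynomial.X 1)

/-- Evaluation `P ↦ P(0)` of an element of `A` at the base point `(0, 0)`. -/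
def evalA : A →ₐ[ℂ] ℂ :=
  Ideal.Quotient.liftₐ (Ideal.span {MvPolynomial.X 0 * MvPolynomial.X 1} :
      Ideal (MvPolynomial (Fin 2) ℂ)) (MvPolynomial.aeval (fun _ : Fin 2 => (0 : ℂ))) (by
    intro a ha
    have hle : (Ideal.span {MvPolynomial.X 0 * MvPolynomial.X 1} :
        Ideal (MvPolynomial (Fin 2) ℂ)) ≤
        RingHom.ker (MvPolynomial.aeval (R := ℂ) (fun _ : Fin 2 => (0 : ℂ))) := by
      rw [Ideal.span_le, Set.singleton_subset_iff]
      simp [RingHom.mem_ker]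
    exact hle ha)

/-- The `n`-th tensor power `A^{⊗ n}` over `ℂ`, with its usual algebra structure. -/
def T (n : ℕ) : Type := ⨂[ℂ] _ : Fin n, A

instance (n : ℕ) : CommRing (T n) := inferInstanceAs (CommRing (⨂[ℂ] _ : Fin n, A))

instance (n : ℕ) : Algebra ℂ (T n) := inferInstanceAs (Algebra ℂ (⨂[ℂ] _ : Fin n, A))

/-- The pure tensor `a_1 ⊗ ⋯ ⊗ a_n`, as a multilinear function of its entries. -/
def pureTensor (n : ℕ) : MultilinearMap ℂ (fun _ : Fin n => A) (T n) :=
  PiTensorProduct.tprod ℂ (s := fun _ : Fin n => A)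

/-- The algebra map `a ↦ 1 ⊗ ⋯ ⊗ a ⊗ ⋯ ⊗ 1` (with `a` in the `k`-th place). -/
def single {n : ℕ} (k : Fin n) : A →ₐ[ℂ] T n :=
  PiTensorProduct.singleAlgHom (R := ℂ) (A := fun _ => A) k

theorem single_eq_pure {n : ℕ} (k : Fin n) (a : A) : single k a = pureTensor n (Pi.mulSingle k a) := rfl

theorem pure_one (n : ℕ) : pureTensor n 1 = 1 := rfl

theorem pure_mul (n : ℕ) (a b : Fin n → A) : pureTensor n (a * b) = pureTensor n a * pureTensor n b :=
  (PiTensorProduct.tprod_mul_tprod (R := ℂ) (A := fun _ : Fin n => A) a b).symm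

theorem hom_ext {n : ℕ} {M : Type*} [AddCommMonoid M] [Module ℂ M] {g h : T n →ₗ[ℂ] M}
    (H : ∀ a, g (pureTensor n a) = h (pureTensor n a)) : g = h :=
  PiTensorProduct.ext (R := ℂ) (s := fun _ : Fin n => A) (MultilinearMap.ext H)

/-- The element `x_k = 1 ⊗ ⋯ ⊗ x ⊗ ⋯ ⊗ 1` (with `x` in the `k`-th place). -/
def x {n : ℕ} (k : Fin n) : T n := single k xA

/-- The element `y_k = 1 ⊗ ⋯ ⊗ y ⊗ ⋯ ⊗ 1` (with `y` in the `k`-th place). -/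
def y {n : ℕ} (k : Fin n) : T n := single k yA

/-- `x_I = ∏_{k ∈ I} x_k`. -/
def xProd {n : ℕ} (I : Finset (Fin n)) : T n := ∏ k ∈ I, x k

/-- `y_J = ∏_{k ∈ J} y_k`. -/
def yProd {n : ℕ} (J : Finset (Fin n)) : T n := ∏ k ∈ J, y k

/-- The elementary symmetric polynomial `e_k` in `x_1, …, x_n`. -/
def e (n k : ℕ) : T n := ∑ I ∈ (Finset.univ : Finset (Fin n)).powersetCard k, xProd I

/-- The elementary symmetric polynomial `f_k` in `y_1, …, y_n`. -/
def f (n k : ℕ) : T n := ∑ J ∈ (Finset.univ : Finset (Fin n)).powersetCard k, yProd J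

/-- Evaluation `P ↦ P(0, …, 0)` on `A^{⊗ n}`; it maps `a_1 ⊗ ⋯ ⊗ a_n` to `∏ a_k(0)`. -/
def evalZero (n : ℕ) : T n →ₗ[ℂ] ℂ :=
  PiTensorProduct.lift (s := fun _ : Fin n => A)
    ((MultilinearMap.mkPiAlgebra ℂ (Fin n) ℂ).compLinearMap fun _ => evalA.toLinearMap)

/-- The action of `σ ∈ S_n` on `A^{⊗ n}` by permuting the tensor factors,
`a_1 ⊗ ⋯ ⊗ a_n ↦ a_{σ⁻¹ 1} ⊗ ⋯ ⊗ a_{σ⁻¹ n}`; thus `x_k ↦ x_{σ k}` and `y_k ↦ y_{σ k}`. -/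
def perm (n : ℕ) (σ : Equiv.Perm (Fin n)) : T n →ₐ[ℂ] T n :=
  PiTensorProduct.liftAlgHom (A := fun _ : Fin n => A) ((pureTensor n).domDomCongr σ.symm)
    (pure_one n) (fun a b => pure_mul n (fun k => a (σ.symm k)) (fun k => b (σ.symm k)))

theorem perm_pure (n : ℕ) (σ : Equiv.Perm (Fin n)) (a : Fin n → A) :
    perm n σ (pureTensor n a) = pureTensor n fun k => a (σ.symm k) :=
  PiTensorProduct.lift.tprod (R := ℂ) (s := fun _ : Fin n => A)
    (φ := (pureTensor n).domDomCongr σ.symm) a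

theorem perm_one (n : ℕ) : perm n 1 = AlgHom.id ℂ (T n) :=
  AlgHom.toLinearMap_injective (hom_ext fun a => perm_pure n 1 a)

theorem perm_mul (n : ℕ) (σ τ : Equiv.Perm (Fin n)) :
    perm n (σ * τ) = (perm n σ).comp (perm n τ) :=
  AlgHom.toLinearMap_injective (hom_ext fun a => by
    show perm n (σ * τ) (pureTensor n a) = perm n σ (perm n τ (pureTensor n a))
    rw [perm_pure, perm_pure, perm_pure]
    rfl)

theorem perm_single {n : ℕ} (σ : Equiv.Perm (Fin n)) (k : Fin n) (a : A) :
    perm n σ (single k a) = single (σ k) a := by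
  rw [single_eq_pure, single_eq_pure, perm_pure]
  congr 1
  funext l
  simp only [Pi.mulSingle_apply, Equiv.symm_apply_eq]

theorem perm_xProd {n : ℕ} (σ : Equiv.Perm (Fin n)) (I : Finset (Fin n)) :
    perm n σ (xProd I) = xProd (I.map σ.toEmbedding) := by
  simp only [xProd, x, perm_single, map_prod, Finset.prod_map, Equiv.coe_toEmbedding]

theorem perm_yProd {n : ℕ} (σ : Equiv.Perm (Fin n)) (J : Finset (Fin n)) :
    perm n σ (yProd J) = yProd (J.map σ.toEmbedding) := by
  simp only [yProd, y, perm_single, map_prod, Finset.prod_map, Equiv.coe_toEmbedding]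

theorem sum_powersetCard_map {n : ℕ} (k : ℕ) (σ : Equiv.Perm (Fin n)) (g : Finset (Fin n) → T n) :
    ∑ I ∈ (Finset.univ : Finset (Fin n)).powersetCard k, g (I.map σ.toEmbedding) =
      ∑ I ∈ (Finset.univ : Finset (Fin n)).powersetCard k, g I :=
  Finset.sum_equiv (Equiv.finsetCongr σ) (by simp [Finset.mem_powersetCard]) (by simp)

theorem perm_e (n k : ℕ) (σ : Equiv.Perm (Fin n)) : perm n σ (e n k) = e n k := by
  simp only [e, map_sum, perm_xProd]
  exact sum_powersetCard_map k σ xProd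

theorem perm_f (n k : ℕ) (σ : Equiv.Perm (Fin n)) : perm n σ (f n k) = f n k := by
  simp only [f, map_sum, perm_yProd]
  exact sum_powersetCard_map k σ yProd

/-- The representation of `S_n` on the quotient of `A^{⊗ n}` by an `S_n`-stable ideal. -/
def quotRep {n : ℕ} (K : Ideal (T n)) (hK : ∀ σ, K ≤ K.comap (perm n σ)) :
    Representation ℂ (Equiv.Perm (Fin n)) (T n ⧸ K) where
  toFun σ := (Ideal.quotientMapₐ K (perm n σ) (hK σ)).toLinearMap
  map_one' := by
    refine LinearMap.ext fun z => ?_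
    obtain ⟨P, rfl⟩ := Ideal.Quotient.mk_surjective z
    show Ideal.Quotient.mk K (perm n 1 P) = Ideal.Quotient.mk K P
    rw [perm_one]
    rfl
  map_mul' σ τ := by
    refine LinearMap.ext fun z => ?_
    obtain ⟨P, rfl⟩ := Ideal.Quotient.mk_surjective z
    show Ideal.Quotient.mk K (perm n (σ * τ) P) = Ideal.Quotient.mk K (perm n σ (perm n τ P))
    rw [perm_mul]
    rfl

theorem quotRep_mk {n : ℕ} (K : Ideal (T n)) (hK : ∀ σ, K ≤ K.comap (perm n σ))
    (σ : Equiv.Perm (Fin n)) (P : T n) :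
    quotRep K hK σ (Ideal.Quotient.mk K P) = Ideal.Quotient.mk K (perm n σ P) := rfl

/-! ### The symmetric coinvariant algebra -/

/-- The ideal `J_n` generated by the `S_n`-invariant elements that vanish at `(0, …, 0)`. -/
def J (n : ℕ) : Ideal (T n) :=
  Ideal.span {P | (∀ σ, perm n σ P = P) ∧ evalZero n P = 0}

theorem J_stable (n : ℕ) (σ : Equiv.Perm (Fin n)) : J n ≤ (J n).comap (perm n σ) := by
  refine Ideal.span_le.2 fun P hP => ?_
  show perm n σ P ∈ J n
  rw [hP.1 σ]
  exact Ideal.subset_span hP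

/-- The symmetric coinvariant algebra `R_n = A^{⊗ n} / J_n`. -/
abbrev R (n : ℕ) : Type := T n ⧸ J n

/-- The representation of `S_n` on `R_n`. -/
def repR (n : ℕ) : Representation ℂ (Equiv.Perm (Fin n)) (R n) := quotRep (J n) (J_stable n)

/-! ### The algebras `R^n_{i,j}` -/

/-- The ideal `I^n_{i,j}` generated by `e_1, …, e_{i-1}`, the `x_I` with `|I| = i`,
`f_1, …, f_{j-1}` and the `y_J` with `|J| = j`. -/
def gI (n i j : ℕ) : Ideal (T n) :=
  Ideal.span
    ({P | ∃ k, 1 ≤ k ∧ k < i ∧ P = e n k} ∪ {P | ∃ S : Finset (Fin n), S.card = i ∧ P = xProd S} ∪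
      {P | ∃ k, 1 ≤ k ∧ k < j ∧ P = f n k} ∪ {P | ∃ S : Finset (Fin n), S.card = j ∧ P = yProd S})

theorem gI_stable (n i j : ℕ) (σ : Equiv.Perm (Fin n)) :
    gI n i j ≤ (gI n i j).comap (perm n σ) := by
  refine Ideal.span_le.2 fun P hP => ?_
  show perm n σ P ∈ gI n i j
  apply Ideal.subset_span
  rcases hP with ((⟨k, h1, h2, rfl⟩ | ⟨S, h, rfl⟩) | ⟨k, h1, h2, rfl⟩) | ⟨S, h, rfl⟩
  · exact Or.inl (Or.inl (Or.inl ⟨k, h1, h2, perm_e n k σ⟩))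
  · exact Or.inl (Or.inl (Or.inr ⟨_, by simpa using h, perm_xProd σ S⟩))
  · exact Or.inl (Or.inr ⟨k, h1, h2, perm_f n k σ⟩)
  · exact Or.inr ⟨_, by simpa using h, perm_yProd σ S⟩

/-- The algebra `R^n_{i,j} = A^{⊗ n} / I^n_{i,j}`. -/
abbrev gR (n i j : ℕ) : Type := T n ⧸ gI n i j

/-- The representation of `S_n` on `R^n_{i,j}`. -/
def repgR (n i j : ℕ) : Representation ℂ (Equiv.Perm (Fin n)) (gR n i j) :=
  quotRep (gI n i j) (gI_stable n i j)

/-! ### The filtration and its graded pieces -/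

/-- `F^p A^{⊗ n} = ∑_{|J| = p} y_J A^{⊗ n}`. -/
def FT (n p : ℕ) : Ideal (T n) :=
  Ideal.span {P | ∃ S : Finset (Fin n), S.card = p ∧ P = yProd S}

theorem FT_stable (n p : ℕ) (σ : Equiv.Perm (Fin n)) : FT n p ≤ (FT n p).comap (perm n σ) := by
  refine Ideal.span_le.2 fun P hP => ?_
  obtain ⟨S, h, rfl⟩ := hP
  exact Ideal.subset_span ⟨_, by simpa using h, perm_yProd σ S⟩

/-- The induced filtration on `R_n`: `F^p R_n` is the image of `F^p A^{⊗ n}`. -/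
def FR (n p : ℕ) : Submodule ℂ (R n) :=
  ((FT n p).map (Ideal.Quotient.mk (J n))).restrictScalars ℂ

theorem mk_mem_FR {n p : ℕ} {P : T n} (hP : P ∈ FT n p) : Ideal.Quotient.mk (J n) P ∈ FR n p :=
  Ideal.mem_map_of_mem _ hP

theorem FR_stable (n p : ℕ) (σ : Equiv.Perm (Fin n)) : FR n p ≤ (FR n p).comap (repR n σ) := by
  intro z hz
  obtain ⟨P, hP, rfl⟩ :=
    (Ideal.mem_map_iff_of_surjective _ Ideal.Quotient.mk_surjective).1
      (show z ∈ (FT n p).map (Ideal.Quotient.mk (J n)) from hz)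
  show repR n σ (Ideal.Quotient.mk (J n) P) ∈ FR n p
  rw [repR, quotRep_mk]
  exact mk_mem_FR (FT_stable n p σ hP)

/-- The representation of `S_n` on `F^p R_n`. -/
def repFR (n p : ℕ) : Representation ℂ (Equiv.Perm (Fin n)) (FR n p) :=
  (repR n).subrepresentation (FR n p) (FR_stable n p)

/-- The graded piece `gr^p R_n = F^p R_n / F^{p+1} R_n`
(one has `F^{p+1} R_n ⊆ F^p R_n`). -/
abbrev gr (n p : ℕ) : Type := FR n p ⧸ (FR n (p + 1)).submoduleOf (FR n p)

/-- The representation of `S_n` on `gr^p R_n`. -/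
def repgr (n p : ℕ) : Representation ℂ (Equiv.Perm (Fin n)) (gr n p) :=
  (repFR n p).quotient _ fun σ _ hz => FR_stable n (p + 1) σ hz

/-- The class in `gr^p R_n` of an element `P` of `F^p A^{⊗ n}`. -/
def grMk {n p : ℕ} (P : T n) (hP : P ∈ FT n p) : gr n p :=
  Submodule.Quotient.mk ⟨Ideal.Quotient.mk (J n) P, mk_mem_FR hP⟩

/-! ### The induced representation -/

/-- The sign representation `L_{(1,1)}` of `S_2`. -/
def signRep : Representation ℂ (Equiv.Perm (Fin 2)) ℂ where
  toFun σ := ((Equiv.Perm.sign σ : ℤ) : ℂ) • LinearMap.id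
  map_one' := by simp; rfl
  map_mul' σ τ := by
    ext
    simp [mul_comm]

/-- The inclusion of `S_2` in `S_n` as the group of permutations of the first two letters. -/
def inclS2 {n : ℕ} (hn : 2 ≤ n) : Equiv.Perm (Fin 2) →* Equiv.Perm (Fin n) :=
  Equiv.Perm.viaEmbeddingHom (Fin.castLEEmb hn)

/-- The induced representation `Ind_{S_2}^{S_n} L_{(1,1)}`. -/
abbrev indSign {n : ℕ} (hn : 2 ≤ n) :
    Representation ℂ (Equiv.Perm (Fin n)) (Representation.IndV (inclS2 hn) signRep) :=
  Representation.ind (inclS2 hn) signRep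

end DoublePoint

end

/-! Write `F^p` for `FT n p`. Averaging shows that `J_n` is generated by the `e_k` and `f_k` with `k
≥ 1`: invariants reduce to power sums, and since `x y = 0` only the pure power sums in `x` or in `y`
survive, so Newton's identities apply (`J_eq_elemIdeal`).

Exactness. The only hard point is injectivity of `φ`, that is, `F^i ∩ I_{n-i,i+1} ⊆ J_n + F^{i+1}`.
For `|S| = i`, multiplication by `y_S` modulo `F^{i+1}` sees only the restriction to the component
of the spectrum where `x_k = 0` on `S` and `y_k = 0` off `S`; its coordinate ring is a polynomial
ring. Take `P = ∑ y_S c_S` in `I_{n-i,i+1}`. On each component the generators other than `f_i`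
restrict into the ideal of the elementary symmetric polynomials of degree at most `n-i` off `S` and
at most `i-1` on `S`, while `f_i` restricts to `∏_S X_k`. So there is one `g`, the same for all `S`,
such that `∏_S X_k` times the restriction of `c_S - g` lies in that ideal. The variables indexed by
`S` are nonzerodivisors modulo it, hence `y_S (c_S - g)` is a relation, and `P` is `f_i g` plus
relations (`FT_inf_gI_le`).

A surjection onto the induced module. Take a point with `i-1` nonzero `y`-coordinates whose first
two coordinates vanish and whose other values are distinct and nonzero; its stabilizer is generated
by the transposition of the first two letters. All of `F^i` vanishes there, and the derivative in
the direction of one more `y`-coordinate, taken along the orbit and projected to `Ind L_{(1,1)}`,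
kills `f_i A^{⊗n}` and `F^{i+1}` and maps `F^i` onto the induced module. Invariants act on the
target by scalars; passing to an associated graded version, split equivariantly as in Maschke's
theorem, turns these scalars into zero (`exists_degeneration`). This gives a surjection `gr^i R_n →
Ind L_{(1,1)}`, so `dim gr^i R_n ≥ n!/2`. A free orbit gives in the same way `dim R_n / F^1 ≥ n!`.

The upper bound. `dim R_n / F^n R_n ≤ (n+1)!/2` by induction on `n`: filter `R_{m+1}` by powers of
the last `x` and the last `y`; each layer is spanned by the image of some `R_m / F^p R_m`, possibly
with `x` and `y` exchanged (`DimBound.succ`). Since `n! + (n-1) n!/2 = (n+1)!/2`, every lower bound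
is an equality, and the surjection is an isomorphism (`nonempty_equiv_indSign`). -/

noncomputable section

/-! ### Elementary symmetric functions of a finite family -/

/-- The `k`-th elementary symmetric function of the family `u` over the finite set `s`. -/
def elemSymm {ι R : Type*} [CommRing R] (s : Finset ι) (u : ι → R) (k : ℕ) : R :=
  ∑ I ∈ s.powersetCard k, ∏ i ∈ I, u i

section ElemSymm

variable {ι κ R S : Type*} [CommRing R] [CommRing S]

@[simp] theorem elemSymm_zero (s : Finset ι) (u : ι → R) : elemSymm s u 0 = 1 := by
  simp [elemSymm]

theorem elemSymm_insert [DecidableEq ι] {s : Finset ι} {a : ι} (ha : a ∉ s) (u : ι → R) (k : ℕ) :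
    elemSymm (insert a s) u (k + 1) = elemSymm s u (k + 1) + u a * elemSymm s u k := by
  have hd : Disjoint (s.powersetCard (k + 1)) ((s.powersetCard k).image (insert a)) := by
    rw [Finset.disjoint_left]
    intro I hI hI'
    obtain ⟨I', -, rfl⟩ := Finset.mem_image.1 hI'
    exact ha ((Finset.mem_powersetCard.1 hI).1 (Finset.mem_insert_self _ _))
  have hn : ∀ I ∈ s.powersetCard k, a ∉ I := fun I hI h => ha ((Finset.mem_powersetCard.1 hI).1 h)
  rw [elemSymm, Finset.powersetCard_succ_insert ha, Finset.sum_union hd, Finset.sum_image,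
    elemSymm, elemSymm, Finset.mul_sum]
  · congr 1
    refine Finset.sum_congr rfl fun I hI => ?_
    rw [Finset.prod_insert (hn I hI)]
  · intro I hI I' hI' h
    rw [← Finset.erase_insert (hn I hI), ← Finset.erase_insert (hn I' hI'), h]

theorem elemSymm_eq_zero {s : Finset ι} (u : ι → R) {k : ℕ} (h : s.card < k) :
    elemSymm s u k = 0 := by
  rw [elemSymm, Finset.powersetCard_eq_empty.2 h, Finset.sum_empty]

theorem elemSymm_card (s : Finset ι) (u : ι → R) : elemSymm s u s.card = ∏ i ∈ s, u i := by
  simp [elemSymm]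

theorem map_elemSymm {F : Type*} [FunLike F R S] [RingHomClass F R S] (g : F) (s : Finset ι)
    (u : ι → R) (k : ℕ) : g (elemSymm s u k) = elemSymm s (fun i => g (u i)) k := by
  simp [elemSymm, map_sum, map_prod]

theorem elemSymm_congr {s : Finset ι} {u v : ι → R} (h : ∀ i ∈ s, u i = v i) (k : ℕ) :
    elemSymm s u k = elemSymm s v k :=
  Finset.sum_congr rfl fun _ hI => Finset.prod_congr rfl fun i hi =>
    h i ((Finset.mem_powersetCard.1 hI).1 hi)

theorem elemSymm_map (s : Finset ι) (g : ι ↪ κ) (u : κ → R) (k : ℕ) :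
    elemSymm (s.map g) u k = elemSymm s (fun i => u (g i)) k := by
  simp [elemSymm, Finset.powersetCard_map]

theorem elemSymm_of_subset [DecidableEq ι] {s t : Finset ι} (hst : s ⊆ t) (u : ι → R)
    (h : ∀ i ∈ t, i ∉ s → u i = 0) (k : ℕ) : elemSymm t u k = elemSymm s u k := by
  symm
  refine Finset.sum_subset (Finset.powersetCard_mono hst) fun I hI hI' => ?_
  rw [Finset.mem_powersetCard] at hI hI'
  have : ¬ I ⊆ s := fun h => hI' ⟨h, hI.2⟩
  obtain ⟨i, hi, his⟩ := Finset.not_subset.1 this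
  exact Finset.prod_eq_zero hi (h i (hI.1 hi) his)

end ElemSymm

namespace DoublePoint

/-! ### Generators of `A^{⊗ n}` and homomorphisms out of it -/

theorem xA_mul_yA : xA * yA = 0 := by
  rw [xA, yA, ← map_mul]
  exact Ideal.Quotient.eq_zero_iff_mem.2 (Ideal.subset_span rfl)

/-- The homomorphism from `A` with prescribed values on `x` and `y`. -/
def liftA {S : Type*} [CommRing S] [Algebra ℂ S] (a b : S) (h : a * b = 0) : A →ₐ[ℂ] S :=
  Ideal.Quotient.liftₐ (Ideal.span {MvPolynomial.X 0 * MvPolynomial.X 1} :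
      Ideal (MvPolynomial (Fin 2) ℂ)) (MvPolynomial.aeval ![a, b]) (by
    intro p hp
    have hle : (Ideal.span {MvPolynomial.X 0 * MvPolynomial.X 1} :
        Ideal (MvPolynomial (Fin 2) ℂ)) ≤
        RingHom.ker (MvPolynomial.aeval (R := ℂ) ![a, b]) := by
      rw [Ideal.span_le, Set.singleton_subset_iff]
      simp [RingHom.mem_ker, h]
    exact hle hp)

theorem liftA_mkA {S : Type*} [CommRing S] [Algebra ℂ S] (a b : S) (h : a * b = 0)
    (p : MvPolynomial (Fin 2) ℂ) : liftA a b h (mkA p) = MvPolynomial.aeval ![a, b] p := rfl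

theorem liftA_x {S : Type*} [CommRing S] [Algebra ℂ S] (a b : S) (h : a * b = 0) :
    liftA a b h xA = a := by
  rw [xA, liftA_mkA]; simp

theorem liftA_y {S : Type*} [CommRing S] [Algebra ℂ S] (a b : S) (h : a * b = 0) :
    liftA a b h yA = b := by
  rw [yA, liftA_mkA]; simp

theorem mkA_surjective : Function.Surjective mkA := Ideal.Quotient.mk_surjective

theorem adjoin_A : Algebra.adjoin ℂ {xA, yA} = ⊤ := by
  have h : Algebra.adjoin ℂ (Set.range (MvPolynomial.X : Fin 2 → MvPolynomial (Fin 2) ℂ)) = ⊤ :=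
    MvPolynomial.adjoin_range_X
  have h2 := congrArg (Subalgebra.map mkA) h
  rw [AlgHom.map_adjoin, Algebra.map_top, (AlgHom.range_eq_top _).2 mkA_surjective,
    ← Set.range_comp] at h2
  rw [← h2]
  congr 1
  ext z
  simp [xA, yA, eq_comm]

theorem algHom_ext {n : ℕ} {S : Type*} [CommRing S] [Algebra ℂ S] {g h : T n →ₐ[ℂ] S}
    (hx : ∀ k, g (x k) = h (x k)) (hy : ∀ k, g (y k) = h (y k)) : g = h := by
  refine PiTensorProduct.algHom_ext (R := ℂ) (A := fun _ : Fin n => A) (f := g) (g := h) fun k => ?_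
  refine AlgHom.ext_of_adjoin_eq_top (s := {xA, yA}) adjoin_A ?_
  rintro z (rfl | rfl)
  · exact hx k
  · exact hy k

theorem x_mul_y {n : ℕ} (k : Fin n) : (x k : T n) * y k = 0 := by
  rw [x, y, ← map_mul, xA_mul_yA, map_zero]

theorem perm_x {n : ℕ} (σ : Equiv.Perm (Fin n)) (k : Fin n) : perm n σ (x k) = x (σ k) :=
  perm_single σ k xA

theorem perm_y {n : ℕ} (σ : Equiv.Perm (Fin n)) (k : Fin n) : perm n σ (y k) = y (σ k) :=
  perm_single σ k yA

theorem pureTensor_eq_prod {n : ℕ} (a : Fin n → A) :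
    pureTensor n a = ∏ k, single k (a k) := by
  have h := map_prod (PiTensorProduct.tprodMonoidHom (A := fun _ : Fin n => A) ℂ)
    (fun k => Pi.mulSingle k (a k)) Finset.univ
  rw [Finset.univ_prod_mulSingle] at h
  exact h

/-- The homomorphism from `A^{⊗ n}` with prescribed restrictions to the tensor factors. -/
def liftSingle {n : ℕ} {S : Type*} [CommRing S] [Algebra ℂ S] (g : Fin n → A →ₐ[ℂ] S) :
    T n →ₐ[ℂ] S :=
  PiTensorProduct.liftAlgHom (A := fun _ : Fin n => A)
    ((MultilinearMap.mkPiAlgebra ℂ (Fin n) S).compLinearMap fun k => (g k).toLinearMap)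
    (by simp) (fun a b => by simp [Finset.prod_mul_distrib])

theorem liftSingle_pure {n : ℕ} {S : Type*} [CommRing S] [Algebra ℂ S] (g : Fin n → A →ₐ[ℂ] S)
    (a : Fin n → A) : liftSingle g (pureTensor n a) = ∏ k, g k (a k) :=
  PiTensorProduct.lift.tprod (R := ℂ) (s := fun _ : Fin n => A)
    (φ := (MultilinearMap.mkPiAlgebra ℂ (Fin n) S).compLinearMap fun k => (g k).toLinearMap) a

theorem liftSingle_single {n : ℕ} {S : Type*} [CommRing S] [Algebra ℂ S] (g : Fin n → A →ₐ[ℂ] S)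
    (k : Fin n) (a : A) : liftSingle g (single k a) = g k a := by
  rw [single_eq_pure, liftSingle_pure, Finset.prod_eq_single k]
  · simp
  · intro l _ hl
    simp [Pi.mulSingle_eq_of_ne hl]
  · simp

/-- The homomorphism from `A^{⊗ n}` with prescribed values on the `x_k` and `y_k`. -/
def liftT {n : ℕ} {S : Type*} [CommRing S] [Algebra ℂ S] (a b : Fin n → S)
    (h : ∀ k, a k * b k = 0) : T n →ₐ[ℂ] S :=
  liftSingle fun k => liftA (a k) (b k) (h k)

section LiftT

variable {n : ℕ} {S : Type*} [CommRing S] [Algebra ℂ S] (a b : Fin n → S)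
    (h : ∀ k, a k * b k = 0)

@[simp] theorem liftT_x (k : Fin n) : liftT a b h (x k) = a k := by
  rw [liftT, x, liftSingle_single, liftA_x]

@[simp] theorem liftT_y (k : Fin n) : liftT a b h (y k) = b k := by
  rw [liftT, y, liftSingle_single, liftA_y]

end LiftT

/-- The universal property yields a homomorphism to the subalgebra generated by the coordinates;
followed by the inclusion it is the identity on coordinates, hence everywhere. -/
theorem adjoin_T (n : ℕ) :
    Algebra.adjoin ℂ (Set.range (x : Fin n → T n) ∪ Set.range y) = ⊤ := by
  set B := Algebra.adjoin ℂ (Set.range (x : Fin n → T n) ∪ Set.range y) with hB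
  have hxB : ∀ k, x k ∈ B := fun k => Algebra.subset_adjoin (Or.inl ⟨k, rfl⟩)
  have hyB : ∀ k, y k ∈ B := fun k => Algebra.subset_adjoin (Or.inr ⟨k, rfl⟩)
  let g : T n →ₐ[ℂ] B := liftT (fun k => ⟨x k, hxB k⟩) (fun k => ⟨y k, hyB k⟩)
    (fun k => Subtype.ext (x_mul_y k))
  have hg : B.val.comp g = AlgHom.id ℂ (T n) := algHom_ext (by simp [g]) (by simp [g])
  refine Algebra.eq_top_iff.2 fun P => ?_
  have := DFunLike.congr_fun hg P
  rw [AlgHom.id_apply] at this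
  rw [← this]
  exact (g P).2

/-- Induction on the elements of `A^{⊗ n}`. -/
theorem T_induction {n : ℕ} {p : T n → Prop} (P : T n) (hC : ∀ c : ℂ, p (algebraMap ℂ (T n) c))
    (hadd : ∀ P Q, p P → p Q → p (P + Q)) (hmul : ∀ P Q, p P → p Q → p (P * Q))
    (hx : ∀ k, p (x k)) (hy : ∀ k, p (y k)) : p P := by
  have hP : P ∈ Algebra.adjoin ℂ (Set.range (x : Fin n → T n) ∪ Set.range y) := by
    rw [adjoin_T]; trivial
  induction hP using Algebra.adjoin_induction with
  | mem z hz =>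
    rcases hz with ⟨k, rfl⟩ | ⟨k, rfl⟩
    · exact hx k
    · exact hy k
  | algebraMap c => exact hC c
  | add P Q _ _ h1 h2 => exact hadd P Q h1 h2
  | mul P Q _ _ h1 h2 => exact hmul P Q h1 h2

theorem e_eq_elemSymm (n k : ℕ) : e n k = elemSymm Finset.univ x k := rfl

theorem f_eq_elemSymm (n k : ℕ) : f n k = elemSymm Finset.univ y k := rfl

theorem e_eq_zero {n k : ℕ} (h : n < k) : e n k = 0 := elemSymm_eq_zero _ (by simpa using h)

theorem f_eq_zero {n k : ℕ} (h : n < k) : f n k = 0 := elemSymm_eq_zero _ (by simpa using h)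

/-- The ideal generated by the elementary symmetric polynomials of positive degree in the `x_k`
and in the `y_k`. -/
def elemIdeal (n : ℕ) : Ideal (T n) :=
  Ideal.span ({P | ∃ k, 1 ≤ k ∧ P = e n k} ∪ {P | ∃ k, 1 ≤ k ∧ P = f n k})

theorem e_mem {n k : ℕ} (hk : 1 ≤ k) : e n k ∈ elemIdeal n :=
  Ideal.subset_span (Or.inl ⟨k, hk, rfl⟩)

theorem f_mem {n k : ℕ} (hk : 1 ≤ k) : f n k ∈ elemIdeal n :=
  Ideal.subset_span (Or.inr ⟨k, hk, rfl⟩)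

theorem yProd_mem_FT {n p : ℕ} {S : Finset (Fin n)} (h : S.card = p) : yProd S ∈ FT n p :=
  Ideal.subset_span ⟨S, h, rfl⟩

theorem yProd_mem_FT_of_le {n p : ℕ} {S : Finset (Fin n)} (h : p ≤ S.card) : yProd S ∈ FT n p := by
  obtain ⟨S', hS', hc⟩ := Finset.exists_subset_card_eq h
  rw [yProd, ← Finset.prod_sdiff hS']
  exact Ideal.mul_mem_left _ _ (yProd_mem_FT hc)

theorem FT_antitone {n p q : ℕ} (h : p ≤ q) : FT n q ≤ FT n p := by
  refine Ideal.span_le.2 ?_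
  rintro _ ⟨S, hS, rfl⟩
  exact yProd_mem_FT_of_le (hS ▸ h)

theorem xProd_mul_yProd {n : ℕ} {I S : Finset (Fin n)} (h : ¬ Disjoint I S) :
    xProd I * yProd S = 0 := by
  obtain ⟨k, hI, hS⟩ := Finset.not_disjoint_iff.1 h
  rw [xProd, yProd, ← Finset.mul_prod_erase _ _ hI, ← Finset.mul_prod_erase _ _ hS]
  linear_combination (∏ l ∈ I.erase k, x l) * (∏ l ∈ S.erase k, y l) * x_mul_y k

end DoublePoint

/-! ### Regularity of the elementary symmetric polynomials -/

section Regular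

open Polynomial

/-- The ideal of the equations prescribing the values of the elementary symmetric polynomials. -/
def symmEqIdeal {S : Type*} [CommRing S] (r : ℕ) (c : ℕ → S) : Ideal (MvPolynomial (Fin r) S) :=
  Ideal.span {P | ∃ k, 1 ≤ k ∧ k ≤ r ∧
    P = elemSymm Finset.univ MvPolynomial.X k - MvPolynomial.C (c k)}

/-- The polynomial satisfied by one coordinate of a point whose elementary symmetric functions
have the prescribed values `c`. -/
def elimPoly {S : Type*} [CommRing S] (c : ℕ → S) : ℕ → S[X]
  | 0 => 1
  | k + 1 => elimPoly c k * X + C ((-1) ^ (k + 1) * c (k + 1))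

theorem elimPoly_monic {S : Type*} [CommRing S] [Nontrivial S] (c : ℕ → S) (k : ℕ) :
    (elimPoly c k).Monic ∧ (elimPoly c k).natDegree = k := by
  induction k with
  | zero => exact ⟨monic_one, natDegree_one⟩
  | succ k ih =>
    have h1 : (elimPoly c k * X).Monic := ih.1.mul monic_X
    have h2 : (elimPoly c k * X).natDegree = k + 1 := by
      rw [ih.1.natDegree_mul monic_X, ih.2, natDegree_X]
    have h3 : (C ((-1) ^ (k + 1) * c (k + 1))).degree < (elimPoly c k * X).degree := by
      refine lt_of_le_of_lt degree_C_le ?_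
      rw [degree_eq_natDegree h1.ne_zero, h2]
      exact_mod_cast Nat.succ_pos k
    exact ⟨h1.add_of_left h3, by
      rw [elimPoly, natDegree_add_eq_left_of_degree_lt h3, h2]⟩

theorem eval₂_elimPoly_succ {S R : Type*} [CommRing S] [CommRing R] (g : S →+* R) (c : ℕ → S)
    (a : R) (k : ℕ) : (elimPoly c (k + 1)).eval₂ g a =
      (elimPoly c k).eval₂ g a * a + (-1) ^ (k + 1) * g (c (k + 1)) := by
  rw [elimPoly, eval₂_add, eval₂_mul, eval₂_X, eval₂_C, map_mul, map_pow, map_neg, map_one]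

theorem elemSymm_fin_succ {R : Type*} [CommRing R] {r : ℕ} (u : Fin (r + 1) → R) (k : ℕ) :
    elemSymm Finset.univ u (k + 1) = elemSymm Finset.univ (fun i => u (Fin.succ i)) (k + 1) +
      u 0 * elemSymm Finset.univ (fun i => u (Fin.succ i)) k := by
  have h : (Finset.univ : Finset (Fin (r + 1))) =
      insert 0 (Finset.univ.map (Fin.succEmb r)) := by
    rw [Fin.univ_succ, Finset.cons_eq_insert]
    rfl
  rw [h, elemSymm_insert (by simp [Fin.succ_ne_zero]), elemSymm_map, elemSymm_map]
  rfl

theorem neg_one_pow_mul_self {R : Type*} [CommRing R] (k : ℕ) : ((-1 : R) ^ k) * (-1) ^ k = 1 := by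
  rw [← mul_pow]; simp

/-- The recursion `e_k(u) = e_k(u') + u_0 e_{k-1}(u')`, with `u'` the family without `u_0`, is
solved for `e_k(u')`. When `k` exceeds the number of entries of `u'` the left side is zero, so `u_0`
is a root of `elimPoly`. -/
theorem symm_elim {S R : Type*} [CommRing S] [CommRing R] (g : S →+* R) (c : ℕ → S) {r m : ℕ}
    (u : Fin (r + 1) → R)
    (h : ∀ k, 1 ≤ k → k ≤ m → elemSymm Finset.univ u k = g (c k)) (k : ℕ) (hk : k ≤ m) :
    elemSymm Finset.univ (fun i => u (Fin.succ i)) k =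
      (-1) ^ k * (elimPoly c k).eval₂ g (u 0) := by
  induction k with
  | zero => simp [elimPoly]
  | succ k ih =>
    have h1 := h (k + 1) (by omega) hk
    rw [elemSymm_fin_succ, ih (by omega)] at h1
    have hs : ((-1 : R) ^ k) * (-1) ^ k = 1 := neg_one_pow_mul_self k
    rw [eval₂_elimPoly_succ, eq_sub_of_add_eq h1, pow_succ]
    linear_combination (-g (c (k+1))) * hs

/-- Prescribing all elementary symmetric functions of `r` variables amounts to adjoining roots of
monic polynomials one after another, so the quotient is free over `S` and nonzerodivisors of `S`
stay nonzerodivisors. The base ring is quantified inside the statement because each induction step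
replaces `S` by `AdjoinRoot d`. -/
theorem C_mul_mem_symmEqIdeal (r : ℕ) : ∀ {S : Type} [CommRing S] (t : S)
    (_ : ∀ a, t * a = 0 → a = 0) (c : ℕ → S) (P : MvPolynomial (Fin r) S),
    MvPolynomial.C t * P ∈ symmEqIdeal r c → P ∈ symmEqIdeal r c := by
  induction r with
  | zero =>
    intro S _ t ht c P hP
    have hI : symmEqIdeal 0 c = ⊥ := by
      rw [symmEqIdeal, Ideal.span_eq_bot]
      rintro _ ⟨k, h1, h2, -⟩
      omega
    rw [hI, Ideal.mem_bot] at hP ⊢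
    ext d
    apply ht
    rw [← MvPolynomial.coeff_C_mul, hP]
    simp
  | succ r ih =>
    intro S _ t ht c P hP
    rcases subsingleton_or_nontrivial S with hS | hS
    · rw [Subsingleton.elim P 0]; exact zero_mem _
    set d := elimPoly c (r + 1) with hd
    have hmon : d.Monic := (elimPoly_monic c (r + 1)).1
    set S2 := AdjoinRoot d
    let root : S2 := AdjoinRoot.root d
    -- `t` is regular in `S2`
    have ht2 : ∀ a : S2, AdjoinRoot.of d t * a = 0 → a = 0 := by
      intro a ha
      induction a using AdjoinRoot.induction_on with
      | ih p =>
        rw [← AdjoinRoot.mk_C, ← map_mul, AdjoinRoot.mk_eq_zero] at ha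
        have h1 : d ∣ C t * (p %ₘ d) := by
          have : C t * (p %ₘ d) = C t * p - d * (C t * (p /ₘ d)) := by
            linear_combination (C t) * modByMonic_add_div p d
          rw [this]
          exact dvd_sub ha (dvd_mul_right _ _)
        have h2 : C t * (p %ₘ d) = 0 := by
          by_contra hne
          have h3 : (C t * (p %ₘ d)).degree < d.degree := by
            refine lt_of_le_of_lt ?_ (degree_modByMonic_lt p hmon)
            rw [C_mul']; exact degree_smul_le t _
          exact hmon.not_dvd_of_degree_lt hne h3 h1
        have h3 : p %ₘ d = 0 := by
          ext k
          apply ht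
          rw [← coeff_C_mul, h2]; simp
        rw [AdjoinRoot.mk_eq_zero]
        exact (modByMonic_eq_zero_iff_dvd hmon).1 h3
    -- Once the first coordinate equals `root`, these are the forced values of the elementary
    -- symmetric functions of the remaining ones (see `symm_elim`).
    obtain ⟨c2, hc2⟩ : ∃ c2 : ℕ → S2, ∀ k,
      c2 k = (-1) ^ k * (elimPoly c k).eval₂ (AdjoinRoot.of d) root := ⟨_, fun _ => rfl⟩
    have hroot : (elimPoly c (r + 1)).eval₂ (AdjoinRoot.of d) root = 0 := AdjoinRoot.eval₂_root d
    let π : MvPolynomial (Fin (r + 1)) S →+* MvPolynomial (Fin r) S2 :=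
      MvPolynomial.eval₂Hom (MvPolynomial.C.comp (AdjoinRoot.of d))
        (Fin.cons (MvPolynomial.C root) MvPolynomial.X)
    have hπC : ∀ a, π (MvPolynomial.C a) = MvPolynomial.C (AdjoinRoot.of d a) := by
      intro a; simp [π]
    have hπ0 : π (MvPolynomial.X 0) = MvPolynomial.C root := by simp [π]
    have hπs : ∀ i : Fin r, π (MvPolynomial.X i.succ) = MvPolynomial.X i := by
      intro i; simp [π]
    have hgen : ∀ k, k ≤ r → elemSymm Finset.univ MvPolynomial.X k - MvPolynomial.C (c2 k) ∈
        symmEqIdeal r c2 := by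
      intro k hk
      rcases Nat.eq_zero_or_pos k with rfl | h0
      · simp [hc2, elimPoly]
      · exact Ideal.subset_span ⟨k, h0, hk, rfl⟩
    have hπI : symmEqIdeal (r + 1) c ≤ (symmEqIdeal r c2).comap π := by
      refine Ideal.span_le.2 ?_
      rintro _ ⟨k, h1, h2, rfl⟩
      show π _ ∈ symmEqIdeal r c2
      obtain ⟨k, rfl⟩ : ∃ l, k = l + 1 := ⟨k - 1, by omega⟩
      rw [elemSymm_fin_succ]
      simp only [map_sub, map_add, map_mul, map_elemSymm, hπC, hπ0, hπs]
      have key : c2 (k + 1) + root * c2 k = AdjoinRoot.of d (c (k + 1)) := by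
        have hs : ((-1 : S2) ^ k) * (-1) ^ k = 1 := neg_one_pow_mul_self k
        rw [hc2, hc2, eval₂_elimPoly_succ, pow_succ]
        linear_combination (AdjoinRoot.of d (c (k+1))) * hs
      rw [← key, map_add, map_mul]
      -- For `k = r` no equation of degree `r + 1` is available, but both terms vanish: there are
      -- only `r` variables, and `c2 (r + 1)` is `d` evaluated at its root up to sign.
      have hk1 : elemSymm Finset.univ MvPolynomial.X (k + 1) - MvPolynomial.C (c2 (k + 1)) ∈
          symmEqIdeal r c2 := by
        rcases Nat.lt_or_ge k r with h | h
        · exact hgen _ h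
        · have hkr : k = r := by omega
          subst hkr
          have hcd : (Finset.univ : Finset (Fin k)).card < k + 1 := by rw [Finset.card_fin]; omega
          rw [elemSymm_eq_zero _ hcd, hc2, hroot]
          simp
      have := add_mem hk1 (Ideal.mul_mem_left _ (MvPolynomial.C root) (hgen k (by omega)))
      convert this using 1
      ring
    have hP2 : π P ∈ symmEqIdeal r c2 := by
      apply ih _ ht2 c2
      rw [← hπC, ← map_mul]
      exact hπI hP
    -- the inverse map
    let Q := MvPolynomial (Fin (r + 1)) S ⧸ symmEqIdeal (r + 1) c
    let mk : MvPolynomial (Fin (r + 1)) S →+* Q := Ideal.Quotient.mk _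
    have hval : ∀ k, k ≤ r + 1 → elemSymm Finset.univ (fun i : Fin r => mk (MvPolynomial.X i.succ)) k
        = (-1) ^ k * (elimPoly c k).eval₂ (mk.comp MvPolynomial.C) (mk (MvPolynomial.X 0)) := by
      refine symm_elim (mk.comp MvPolynomial.C) c (fun i => mk (MvPolynomial.X i)) ?_
      intro k h1 h2
      rw [← map_elemSymm mk, RingHom.comp_apply]
      exact Ideal.Quotient.eq.2 (Ideal.subset_span ⟨k, h1, h2, rfl⟩)
    have hd0 : d.eval₂ (mk.comp MvPolynomial.C) (mk (MvPolynomial.X 0)) = 0 := by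
      have := hval (r + 1) le_rfl
      have hcd : (Finset.univ : Finset (Fin r)).card < r + 1 := by rw [Finset.card_fin]; omega
      rw [elemSymm_eq_zero _ hcd] at this
      have h2 : ((-1 : Q) ^ (r + 1)) * (-1) ^ (r + 1) = 1 := neg_one_pow_mul_self _
      rw [← one_mul (d.eval₂ _ _), ← h2, mul_assoc, ← this, mul_zero]
    let β0 : S2 →+* Q := AdjoinRoot.lift (mk.comp MvPolynomial.C) (mk (MvPolynomial.X 0)) hd0
    have hβ0 : ∀ a, β0 (AdjoinRoot.of d a) = mk (MvPolynomial.C a) := fun a =>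
      AdjoinRoot.lift_of hd0
    have hβr : β0 root = mk (MvPolynomial.X 0) := AdjoinRoot.lift_root hd0
    let β : MvPolynomial (Fin r) S2 →+* Q :=
      MvPolynomial.eval₂Hom β0 (fun i => mk (MvPolynomial.X i.succ))
    have hβπ : β.comp π = mk := by
      refine MvPolynomial.ringHom_ext ?_ ?_
      · intro a; rw [RingHom.comp_apply, hπC]; simp [β, hβ0]
      · intro i
        rw [RingHom.comp_apply]
        refine Fin.cases ?_ (fun i => ?_) i
        · rw [hπ0]; simp [β, hβr]
        · rw [hπs]; simp [β]
    have hβI : symmEqIdeal r c2 ≤ RingHom.ker β := by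
      refine Ideal.span_le.2 ?_
      rintro _ ⟨k, h1, h2, rfl⟩
      show β _ = 0
      have hβc : β0.comp (AdjoinRoot.of d) = mk.comp MvPolynomial.C := RingHom.ext hβ0
      have h3 : β (MvPolynomial.C (c2 k)) = β0 (c2 k) := by simp [β]
      have h4 : ∀ i, β (MvPolynomial.X i) = mk (MvPolynomial.X i.succ) := by simp [β]
      rw [map_sub, map_elemSymm, h3, elemSymm_congr (fun i _ => h4 i), hval k (by omega), hc2,
        map_mul, map_pow, map_neg, map_one, hom_eval₂, hβc, hβr, sub_self]
    have : mk P = 0 := by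
      rw [← hβπ, RingHom.comp_apply]
      exact hβI hP2
    exact Ideal.Quotient.eq_zero_iff_mem.1 this

/-- The ideal generated by the first `a` elementary symmetric polynomials in the variables outside
`J` and the first `b` elementary symmetric polynomials in the variables in `J`. -/
def splitSymmIdeal {n : ℕ} (J : Finset (Fin n)) (a b : ℕ) : Ideal (MvPolynomial (Fin n) ℂ) :=
  Ideal.span ({P | ∃ k, 1 ≤ k ∧ k ≤ a ∧ P = elemSymm Jᶜ MvPolynomial.X k} ∪
    {P | ∃ k, 1 ≤ k ∧ k ≤ b ∧ P = elemSymm J MvPolynomial.X k})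

/-- Treat `X_j` as a parameter. The equations `e_k(J) = 0` for `k ≤ b` then say that the other `b`
variables of `J` have elementary symmetric functions `(-X_j)^k`, so `C_mul_mem_symmEqIdeal` applies
over a polynomial ring in `X_j`, where `X_j` is a nonzerodivisor. This works because the top
equation `e_{b+1}(J)` is absent. -/
theorem X_mul_mem_splitSymmIdeal {n : ℕ} {J : Finset (Fin n)} {j : Fin n} (hj : j ∈ J) {a b : ℕ}
    (hb : J.card = b + 1) {P : MvPolynomial (Fin n) ℂ}
    (hP : MvPolynomial.X j * P ∈ splitSymmIdeal J a b) : P ∈ splitSymmIdeal J a b := by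
  classical
  let IE : Ideal (MvPolynomial (Fin n) ℂ) :=
    Ideal.span {P | ∃ k, 1 ≤ k ∧ k ≤ a ∧ P = elemSymm Jᶜ MvPolynomial.X k}
  let Q := MvPolynomial (Fin n) ℂ ⧸ splitSymmIdeal J a b
  let mk : MvPolynomial (Fin n) ℂ →+* Q := Ideal.Quotient.mk _
  have hIE : IE ≤ splitSymmIdeal J a b := Ideal.span_mono Set.subset_union_left
  -- The equations off `J` are absorbed in the coefficient ring `S`. It still contains superfluous
  -- copies of the variables in `J`; `π` below sends those variables elsewhere, so the copies do no
  -- harm.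
  obtain ⟨S, _, mkS, β0, hmkS, hβ0⟩ : ∃ (S : Type) (_ : CommRing S)
      (mkS : MvPolynomial (Fin n) ℂ →+* S) (β0 : S →+* Q),
      (∀ p ∈ IE, mkS p = 0) ∧ ∀ p, β0 (mkS p) = mk p :=
    ⟨_, inferInstance, Ideal.Quotient.mk IE, Ideal.Quotient.factor hIE,
      fun p hp => Ideal.Quotient.eq_zero_iff_mem.2 hp, fun p => rfl⟩
  have hcard : (J.erase j).card = b := by rw [Finset.card_erase_of_mem hj, hb]; rfl
  let θ : Fin b ≃ J.erase j := ((J.erase j).equivFinOfCardEq hcard).symm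
  let θe : Fin b ↪ Fin n := θ.toEmbedding.trans (Function.Embedding.subtype _)
  have hθ : Finset.univ.map θe = J.erase j := by
    ext l
    simp only [θe, Finset.mem_map, Finset.mem_univ, true_and]
    constructor
    · rintro ⟨i, rfl⟩; exact (θ i).2
    · intro hl; exact ⟨θ.symm ⟨l, hl⟩, by simp⟩
  have hins : J = insert j (Finset.univ.map θe) := by rw [hθ, Finset.insert_erase hj]
  have hjθ : j ∉ Finset.univ.map θe := by rw [hθ]; simp
  have hsplit : ∀ {R : Type} [CommRing R] (u : Fin n → R) (k : ℕ), elemSymm J u (k + 1) =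
      elemSymm Finset.univ (fun i => u (θe i)) (k + 1) +
        u j * elemSymm Finset.univ (fun i => u (θe i)) k := by
    intro R _ u k
    conv_lhs => rw [hins]
    rw [elemSymm_insert hjθ, elemSymm_map, elemSymm_map]
  let c : ℕ → S[X] := fun k => (-X) ^ k
  let u : Fin n → MvPolynomial (Fin b) S[X] := fun l =>
    if hl : l ∈ J.erase j then MvPolynomial.X (θ.symm ⟨l, hl⟩)
    else if l = j then MvPolynomial.C X else MvPolynomial.C (C (mkS (MvPolynomial.X l)))
  have huj : u j = MvPolynomial.C X := by simp [u]
  have huθ : ∀ i, u (θe i) = MvPolynomial.X i := by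
    intro i
    have h1 : θe i ∈ J.erase j := (θ i).2
    have h2 : θ.symm ⟨θe i, h1⟩ = i := by
      rw [Equiv.symm_apply_eq]; rfl
    simp only [u, h1, dif_pos, h2]
  have huc : ∀ l, l ∉ J → u l = MvPolynomial.C (C (mkS (MvPolynomial.X l))) := by
    intro l hl
    have h1 : l ∉ J.erase j := fun h => hl (Finset.mem_of_mem_erase h)
    have h2 : l ≠ j := fun h => hl (h ▸ hj)
    simp only [u, h1, h2, dif_neg, if_false, not_false_eq_true]
  let π : MvPolynomial (Fin n) ℂ →+* MvPolynomial (Fin b) S[X] :=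
    MvPolynomial.eval₂Hom (((MvPolynomial.C.comp C).comp mkS).comp MvPolynomial.C) u
  have hπX : ∀ l, π (MvPolynomial.X l) = u l := by simp [π]
  have hπC : ∀ z, π (MvPolynomial.C z) = MvPolynomial.C (C (mkS (MvPolynomial.C z))) := by simp [π]
  have hgen : ∀ k, k ≤ b → elemSymm Finset.univ MvPolynomial.X k - MvPolynomial.C (c k) ∈
      symmEqIdeal b c := by
    intro k hk
    rcases Nat.eq_zero_or_pos k with rfl | h0
    · simp [c]
    · exact Ideal.subset_span ⟨k, h0, hk, rfl⟩
  have hπI : splitSymmIdeal J a b ≤ (symmEqIdeal b c).comap π := by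
    refine Ideal.span_le.2 ?_
    rintro _ (⟨k, h1, h2, rfl⟩ | ⟨k, h1, h2, rfl⟩)
    · show π _ ∈ symmEqIdeal b c
      rw [map_elemSymm, elemSymm_congr (fun l hl => (hπX l).trans (huc l (Finset.mem_compl.1 hl))),
        ← map_elemSymm MvPolynomial.C, ← map_elemSymm C, ← map_elemSymm mkS]
      have : mkS (elemSymm Jᶜ MvPolynomial.X k) = 0 :=
        hmkS _ (Ideal.subset_span ⟨k, h1, h2, rfl⟩)
      rw [this, map_zero, map_zero]
      exact zero_mem _
    · show π _ ∈ symmEqIdeal b c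
      obtain ⟨k, rfl⟩ : ∃ l, k = l + 1 := ⟨k - 1, by omega⟩
      rw [map_elemSymm, elemSymm_congr (fun l _ => hπX l), hsplit, huj]
      simp only [huθ]
      have := add_mem (hgen (k + 1) h2)
        (Ideal.mul_mem_left _ (MvPolynomial.C X) (hgen k (by omega)))
      convert this using 1
      simp only [c, map_pow, map_neg]
      ring
  have hP2 : π P ∈ symmEqIdeal b c := by
    apply C_mul_mem_symmEqIdeal b (X : S[X]) _ c
    · rw [← huj, ← hπX, ← map_mul]
      exact hπI hP
    · intro p hp
      rw [mul_comm] at hp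
      ext k
      simpa [coeff_mul_X] using congrArg (fun q => coeff q (k + 1)) hp
  let β : MvPolynomial (Fin b) S[X] →+* Q :=
    MvPolynomial.eval₂Hom (Polynomial.eval₂RingHom β0 (mk (MvPolynomial.X j)))
      (fun i => mk (MvPolynomial.X (θe i)))
  have hβX : ∀ i, β (MvPolynomial.X i) = mk (MvPolynomial.X (θe i)) := by simp [β]
  have hβY : β (MvPolynomial.C X) = mk (MvPolynomial.X j) := by simp [β]
  have hβC : ∀ p, β (MvPolynomial.C (C (mkS p))) = mk p := by intro p; simp [β, hβ0]
  have hβπ : β.comp π = mk := by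
    refine MvPolynomial.ringHom_ext ?_ ?_
    · intro z; rw [RingHom.comp_apply, hπC, hβC]
    · intro l
      rw [RingHom.comp_apply, hπX]
      by_cases hl : l ∈ J
      · rw [hins, Finset.mem_insert, Finset.mem_map] at hl
        rcases hl with rfl | ⟨i, -, rfl⟩
        · rw [huj, hβY]
        · rw [huθ, hβX]
      · rw [huc l hl, hβC]
  have hval : ∀ k, k ≤ b →
      elemSymm Finset.univ (fun i => mk (MvPolynomial.X (θe i))) k = (-mk (MvPolynomial.X j)) ^ k := by
    intro k
    induction k with
    | zero => intro _; simp
    | succ k ih =>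
      intro hk
      have h1 : mk (elemSymm J MvPolynomial.X (k + 1)) = 0 :=
        Ideal.Quotient.eq_zero_iff_mem.2
          (Ideal.subset_span (Or.inr ⟨k + 1, by omega, hk, rfl⟩))
      rw [map_elemSymm, hsplit, ih (by omega)] at h1
      rw [eq_neg_of_add_eq_zero_left h1, pow_succ]
      ring
  have hβI : symmEqIdeal b c ≤ RingHom.ker β := by
    refine Ideal.span_le.2 ?_
    rintro _ ⟨k, h1, h2, rfl⟩
    show β _ = 0
    rw [map_sub, map_elemSymm, elemSymm_congr (fun i _ => hβX i), hval k h2]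
    simp only [c, map_pow, map_neg, hβY, sub_self]
  have : mk P = 0 := by
    rw [← hβπ, RingHom.comp_apply]
    exact hβI hP2
  exact Ideal.Quotient.eq_zero_iff_mem.1 this

theorem prod_X_mul_mem_splitSymmIdeal {n : ℕ} {J : Finset (Fin n)} {a b : ℕ}
    (hb : J.card = b + 1) {P : MvPolynomial (Fin n) ℂ}
    (hP : (∏ j ∈ J, MvPolynomial.X j) * P ∈ splitSymmIdeal J a b) : P ∈ splitSymmIdeal J a b := by
  classical
  have key : ∀ s : Finset (Fin n), s ⊆ J →
      (∏ j ∈ s, MvPolynomial.X j) * P ∈ splitSymmIdeal J a b → P ∈ splitSymmIdeal J a b := by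
    intro s
    induction s using Finset.induction_on with
    | empty => intro _ h; simpa using h
    | insert j s hjs ih =>
      intro hs h
      rw [Finset.prod_insert hjs, mul_assoc] at h
      exact ih (fun l hl => hs (Finset.mem_insert_of_mem hl))
        (X_mul_mem_splitSymmIdeal (hs (Finset.mem_insert_self _ _)) hb h)
  exact key J subset_rfl hP

end Regular

namespace DoublePoint

/-! ### Restriction to a component -/

/-- Restriction to the component of the spectrum of `A^{⊗ n}` where `x_k = 0` for `k ∈ S` and
`y_k = 0` for `k ∉ S`. -/
def restr {n : ℕ} (S : Finset (Fin n)) : T n →ₐ[ℂ] MvPolynomial (Fin n) ℂ :=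
  liftT (fun k => if k ∈ S then 0 else MvPolynomial.X k)
    (fun k => if k ∈ S then MvPolynomial.X k else 0) (fun k => by split_ifs <;> simp)

/-- The section of `restr S` sending each coordinate to the corresponding `x_k` or `y_k`. -/
def restrSection {n : ℕ} (S : Finset (Fin n)) : MvPolynomial (Fin n) ℂ →ₐ[ℂ] T n :=
  MvPolynomial.aeval fun k => if k ∈ S then y k else x k

section Restr

variable {n : ℕ} (S : Finset (Fin n))

theorem restr_x (k : Fin n) : restr S (x k) = if k ∈ S then 0 else MvPolynomial.X k :=
  liftT_x _ _ _ k

theorem restr_y (k : Fin n) : restr S (y k) = if k ∈ S then MvPolynomial.X k else 0 :=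
  liftT_y _ _ _ k

theorem restr_e (k : ℕ) : restr S (e n k) = elemSymm Sᶜ MvPolynomial.X k := by
  rw [e_eq_elemSymm, map_elemSymm, elemSymm_of_subset (Finset.subset_univ Sᶜ)]
  · exact elemSymm_congr (fun l hl => by rw [restr_x, if_neg (Finset.mem_compl.1 hl)]) k
  · intro l _ hl
    rw [Finset.mem_compl, not_not] at hl
    rw [restr_x, if_pos hl]

theorem restr_f (k : ℕ) : restr S (f n k) = elemSymm S MvPolynomial.X k := by
  rw [f_eq_elemSymm, map_elemSymm, elemSymm_of_subset (Finset.subset_univ S)]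
  · exact elemSymm_congr (fun l hl => by rw [restr_y, if_pos hl]) k
  · intro l _ hl
    rw [restr_y, if_neg hl]

theorem restr_xProd (I : Finset (Fin n)) :
    restr S (xProd I) = if Disjoint I S then ∏ k ∈ I, MvPolynomial.X k else 0 := by
  rw [xProd, map_prod]
  split_ifs with h
  · exact Finset.prod_congr rfl fun k hk => by rw [restr_x, if_neg (Finset.disjoint_left.1 h hk)]
  · obtain ⟨k, hI, hS⟩ := Finset.not_disjoint_iff.1 h
    exact Finset.prod_eq_zero hI (by rw [restr_x, if_pos hS])

theorem restr_yProd (I : Finset (Fin n)) :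
    restr S (yProd I) = if I ⊆ S then ∏ k ∈ I, MvPolynomial.X k else 0 := by
  rw [yProd, map_prod]
  split_ifs with h
  · exact Finset.prod_congr rfl fun k hk => by rw [restr_y, if_pos (h hk)]
  · obtain ⟨k, hI, hS⟩ := Finset.not_subset.1 h
    exact Finset.prod_eq_zero hI (by rw [restr_y, if_neg hS])

/-- `y_S` annihilates `x_k` for `k ∈ S`, and `y_S y_k` lies one step deeper in the filtration for `k
∉ S`. Hence modulo `F^{|S|+1}` a multiple of `y_S` depends only on the restriction of its cofactor
to the component of `S`. -/
theorem yProd_mul_sub_restr (P : T n) :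
    yProd S * (P - restrSection S (restr S P)) ∈ FT n (S.card + 1) := by
  induction P using T_induction with
  | hC c =>
    rw [AlgHom.commutes, AlgHom.commutes, sub_self, mul_zero]
    exact zero_mem _
  | hadd P Q hP hQ =>
    rw [map_add, map_add]
    convert add_mem hP hQ using 1
    ring
  | hmul P Q hP hQ =>
    rw [map_mul, map_mul]
    convert add_mem (Ideal.mul_mem_left _ P hQ)
      (Ideal.mul_mem_left _ (restrSection S (restr S Q)) hP) using 1
    ring
  | hx k =>
    rw [restr_x]
    split_ifs with h
    · rw [map_zero, sub_zero, yProd, ← Finset.mul_prod_erase _ _ h]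
      have : y k * (∏ l ∈ S.erase k, y l) * x k = 0 := by
        linear_combination (∏ l ∈ S.erase k, y l) * x_mul_y k
      rw [this]
      exact zero_mem _
    · simp [restrSection, h]
  | hy k =>
    rw [restr_y]
    split_ifs with h
    · simp [restrSection, h]
    · rw [map_zero, sub_zero, mul_comm]
      have : y k * yProd S = yProd (insert k S) := by rw [yProd, yProd, Finset.prod_insert h]
      rw [this]
      exact yProd_mem_FT (Finset.card_insert_of_notMem h)

end Restr

/-! ### The relations in the graded pieces -/

/-- The ideal of those elements of `F^i A^{⊗ n}` whose class in `gr^i R_n` is zero. -/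
def relIdeal (n i : ℕ) : Ideal (T n) :=
  Ideal.span {f n i} ⊔ FT n (i + 1) ⊔ elemIdeal n * FT n i

theorem f_mem_FT (n i : ℕ) : f n i ∈ FT n i :=
  Ideal.sum_mem _ fun _ hS => yProd_mem_FT (Finset.mem_powersetCard.1 hS).2

theorem relIdeal_le_sup {n i : ℕ} (hi : 1 ≤ i) : relIdeal n i ≤ elemIdeal n ⊔ FT n (i + 1) := by
  refine sup_le (sup_le ?_ le_sup_right) (Ideal.mul_le_left.trans le_sup_left)
  rw [Ideal.span_le, Set.singleton_subset_iff]
  exact Ideal.mem_sup_left (f_mem hi)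

theorem f_mem_relIdeal (n i : ℕ) : f n i ∈ relIdeal n i :=
  Ideal.mem_sup_left (Ideal.mem_sup_left (Ideal.mem_span_singleton_self _))

theorem FT_succ_le_relIdeal (n i : ℕ) : FT n (i + 1) ≤ relIdeal n i :=
  le_sup_right.trans le_sup_left

theorem elemIdeal_mul_le_relIdeal (n i : ℕ) : elemIdeal n * FT n i ≤ relIdeal n i :=
  le_sup_right

theorem xProd_mem_gI {n i j : ℕ} {I : Finset (Fin n)} (h : i ≤ I.card) : xProd I ∈ gI n i j := by
  obtain ⟨I', hI', hc⟩ := Finset.exists_subset_card_eq h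
  rw [xProd, ← Finset.prod_sdiff hI']
  exact Ideal.mul_mem_left _ _ (Ideal.subset_span (Or.inl (Or.inl (Or.inr ⟨I', hc, rfl⟩))))

theorem FT_le_gI (n i j : ℕ) : FT n j ≤ gI n i j := by
  refine Ideal.span_le.2 ?_
  rintro _ ⟨S, hS, rfl⟩
  exact Ideal.subset_span (Or.inr ⟨S, hS, rfl⟩)

/-- Elementary symmetric polynomials of degrees beyond the listed generators are sums of monomials
divisible by some `x_I` with `|I| = i` or some `y_J` with `|J| = j`. -/
theorem elemIdeal_le_gI (n i j : ℕ) : elemIdeal n ≤ gI n i j := by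
  refine Ideal.span_le.2 ?_
  rintro _ (⟨k, hk, rfl⟩ | ⟨k, hk, rfl⟩)
  · rcases Nat.lt_or_ge k i with h | h
    · exact Ideal.subset_span (Or.inl (Or.inl (Or.inl ⟨k, hk, h, rfl⟩)))
    · exact Ideal.sum_mem _ fun I hI => xProd_mem_gI (by rwa [(Finset.mem_powersetCard.1 hI).2])
  · rcases Nat.lt_or_ge k j with h | h
    · exact Ideal.subset_span (Or.inl (Or.inr ⟨k, hk, h, rfl⟩))
    · exact FT_le_gI n i j (FT_antitone h (f_mem_FT n k))

theorem exists_of_mem_FT {n i : ℕ} {P : T n} (hP : P ∈ FT n i) :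
    ∃ c : Finset (Fin n) → T n,
      P = ∑ S ∈ (Finset.univ : Finset (Fin n)).powersetCard i, yProd S * c S := by
  induction hP using Submodule.span_induction with
  | mem P hP =>
    obtain ⟨S, hS, rfl⟩ := hP
    refine ⟨fun S' => if S' = S then 1 else 0, ?_⟩
    rw [Finset.sum_eq_single S]
    · simp
    · intro S' _ h; simp [h]
    · intro h; simp [Finset.mem_powersetCard, hS] at h
  | zero => exact ⟨0, by simp⟩
  | add P Q _ _ hP hQ =>
    obtain ⟨c, rfl⟩ := hP
    obtain ⟨d, rfl⟩ := hQ
    exact ⟨c + d, by simp [mul_add, Finset.sum_add_distrib]⟩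
  | smul a P _ hP =>
    obtain ⟨c, rfl⟩ := hP
    exact ⟨fun S => a * c S, by
      rw [smul_eq_mul, Finset.mul_sum]; exact Finset.sum_congr rfl fun _ _ => by ring⟩

/-- Among the generators only `f_i` does not restrict into the split ideal, and it restricts to `∏_S
X_k` on every component with `|S| = i`. So `g` can be taken as the coefficient of `f_i`; its
independence of `S` is what matters later. -/
theorem exists_restr_of_mem_gI {n i : ℕ} (hin : i < n) {P : T n}
    (hP : P ∈ gI n (n - i) (i + 1)) :
    ∃ g : T n, ∀ S : Finset (Fin n), S.card = i →
      restr S P - (∏ k ∈ S, MvPolynomial.X k) * restr S g ∈ splitSymmIdeal S (n - i) (i - 1) := by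
  induction hP using Submodule.span_induction with
  | mem P hP =>
    rcases hP with ((⟨k, h1, h2, rfl⟩ | ⟨I, h, rfl⟩) | ⟨k, h1, h2, rfl⟩) | ⟨I, h, rfl⟩
    · refine ⟨0, fun S hS => ?_⟩
      rw [map_zero, mul_zero, sub_zero, restr_e]
      exact Ideal.subset_span (Or.inl ⟨k, h1, h2.le, rfl⟩)
    · refine ⟨0, fun S hS => ?_⟩
      rw [map_zero, mul_zero, sub_zero, restr_xProd]
      split_ifs with hd
      -- A set of size `n - i` disjoint from `S` is its complement, so `x_I` restricts to the top
      -- elementary symmetric polynomial off `S`.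
      · have hI : I = Sᶜ := by
          refine Finset.eq_of_subset_of_card_le
            (fun k hk => Finset.mem_compl.2 (Finset.disjoint_left.1 hd hk)) ?_
          rw [Finset.card_compl, Fintype.card_fin, hS, h]
        rw [hI, ← elemSymm_card]
        refine Ideal.subset_span (Or.inl ⟨_, ?_, ?_, rfl⟩)
        · rw [← hI, h]; omega
        · rw [← hI, h]
      · exact zero_mem _
    · rcases Nat.lt_or_ge k i with hk | hk
      · refine ⟨0, fun S hS => ?_⟩
        rw [map_zero, mul_zero, sub_zero, restr_f]
        exact Ideal.subset_span (Or.inr ⟨k, h1, by omega, rfl⟩)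
      · refine ⟨1, fun S hS => ?_⟩
        have : k = S.card := by omega
        rw [map_one, mul_one, restr_f, this, elemSymm_card, sub_self]
        exact zero_mem _
    · refine ⟨0, fun S hS => ?_⟩
      rw [map_zero, mul_zero, sub_zero, restr_yProd, if_neg]
      · exact zero_mem _
      · intro hIS
        have := Finset.card_le_card hIS
        omega
  | zero => exact ⟨0, fun S _ => by simp⟩
  | add P Q _ _ hP hQ =>
    obtain ⟨g, hg⟩ := hP
    obtain ⟨h, hh⟩ := hQ
    refine ⟨g + h, fun S hS => ?_⟩
    convert add_mem (hg S hS) (hh S hS) using 1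
    rw [map_add, map_add]
    ring
  | smul a P _ hP =>
    obtain ⟨g, hg⟩ := hP
    refine ⟨a * g, fun S hS => ?_⟩
    convert Ideal.mul_mem_left _ (restr S a) (hg S hS) using 1
    rw [smul_eq_mul, map_mul, map_mul]
    ring

/-- The generators of the split ideal are restrictions of `e_k` and `f_k`; by `yProd_mul_sub_restr`,
multiplying their lifts by `y_S` agrees modulo `F^{i+1}` with an element of `elemIdeal n * FT n i`.
-/
theorem yProd_mul_restrSection_mem {n i a b : ℕ} {S : Finset (Fin n)} (hS : S.card = i)
    {q : MvPolynomial (Fin n) ℂ} (hq : q ∈ splitSymmIdeal S a b) :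
    yProd S * restrSection S q ∈ relIdeal n i := by
  have key : ∀ P ∈ elemIdeal n, yProd S * restrSection S (restr S P) ∈ relIdeal n i := by
    intro P hP
    have h1 : P * yProd S ∈ relIdeal n i :=
      elemIdeal_mul_le_relIdeal n i (Ideal.mul_mem_mul hP (yProd_mem_FT hS))
    have h2 : yProd S * (P - restrSection S (restr S P)) ∈ relIdeal n i :=
      FT_succ_le_relIdeal n i (hS ▸ yProd_mul_sub_restr S P)
    convert sub_mem h1 h2 using 1
    ring
  induction hq using Submodule.span_induction with
  | mem q hq =>
    rcases hq with ⟨k, h1, -, rfl⟩ | ⟨k, h1, -, rfl⟩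
    · rw [← restr_e]; exact key _ (e_mem h1)
    · rw [← restr_f]; exact key _ (f_mem h1)
  | zero => simp
  | add p q _ _ hp hq => rw [map_add, mul_add]; exact add_mem hp hq
  | smul c p _ hp =>
    rw [smul_eq_mul, map_mul, mul_left_comm]
    exact Ideal.mul_mem_left _ _ hp

/-- This gives both the injectivity of `φ` and a presentation of `gr^i R_n`. After subtracting `f_i
g` from `P`, cancelling `∏_S X_k` on the component of `S` shows that each remaining summand is a
relation. -/
theorem FT_inf_gI_le {n i : ℕ} (hi : 1 ≤ i) (hin : i < n) :
    FT n i ⊓ gI n (n - i) (i + 1) ≤ relIdeal n i := by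
  rintro P ⟨hF, hI⟩
  obtain ⟨c, hc⟩ := exists_of_mem_FT hF
  obtain ⟨g, hg⟩ := exists_restr_of_mem_gI hin hI
  have hP : P = f n i * g +
      ∑ S ∈ (Finset.univ : Finset (Fin n)).powersetCard i, yProd S * (c S - g) := by
    rw [hc, f, Finset.sum_mul, ← Finset.sum_add_distrib]
    exact Finset.sum_congr rfl fun _ _ => by ring
  rw [hP]
  refine add_mem (Ideal.mul_mem_right _ _ (f_mem_relIdeal n i)) (Ideal.sum_mem _ fun S hS => ?_)
  have hSc : S.card = i := (Finset.mem_powersetCard.1 hS).2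
  -- The other `y_{S'}` with `|S'| = |S|` vanish on the component of `S`, so the summands can be
  -- examined one at a time.
  have hrP : restr S P = (∏ k ∈ S, MvPolynomial.X k) * restr S (c S) := by
    rw [hc, map_sum, Finset.sum_eq_single S]
    · rw [map_mul, restr_yProd, if_pos subset_rfl]
    · intro S' hS' hne
      rw [map_mul, restr_yProd, if_neg, zero_mul]
      intro hsub
      exact hne (Finset.eq_of_subset_of_card_le hsub
        (by rw [hSc, (Finset.mem_powersetCard.1 hS').2]))
    · exact fun h => absurd hS h
  have h1 : restr S (c S - g) ∈ splitSymmIdeal S (n - i) (i - 1) := by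
    apply prod_X_mul_mem_splitSymmIdeal (by omega)
    rw [map_sub, mul_sub, ← hrP]
    exact hg S hSc
  have h2 := add_mem (yProd_mul_restrSection_mem hSc h1)
    (FT_succ_le_relIdeal n i (hSc ▸ yProd_mul_sub_restr S (c S - g)))
  convert h2 using 1
  ring

/-! ### Generators of the ideal of the symmetric coinvariants -/

/-- Newton's identities express power sums of positive degree through elementary symmetric
polynomials of positive degree. -/
theorem aeval_esymm_mem {n : ℕ} {I : Ideal (T n)} {u : Fin n → T n}
    (h : ∀ k, 1 ≤ k → elemSymm Finset.univ u k ∈ I) (k : ℕ) (hk : 0 < k) :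
    ∑ l, u l ^ k ∈ I := by
  have hes : ∀ k, 1 ≤ k → MvPolynomial.aeval (R := ℂ) u (MvPolynomial.esymm (Fin n) ℂ k) ∈ I := by
    intro k hk
    rw [MvPolynomial.aeval_esymm_eq_multiset_esymm, Finset.esymm_map_val]
    exact h k hk
  have h2 := congrArg (MvPolynomial.aeval (R := ℂ) u)
    (MvPolynomial.psum_eq_mul_esymm_sub_sum (Fin n) ℂ k hk)
  have h3 : MvPolynomial.aeval (R := ℂ) u (MvPolynomial.psum (Fin n) ℂ k) = ∑ l, u l ^ k := by
    simp [MvPolynomial.psum]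
  rw [← h3, h2, map_sub, map_mul, map_sum]
  refine sub_mem (Ideal.mul_mem_left _ _ (hes k hk)) (Ideal.sum_mem _ fun p hp => ?_)
  rw [Finset.mem_filter] at hp
  rw [map_mul, map_mul]
  exact Ideal.mul_mem_right _ _ (Ideal.mul_mem_left _ _ (hes _ hp.2.1))

theorem evalA_x : evalA xA = 0 := by
  have : evalA xA = MvPolynomial.aeval (fun _ : Fin 2 => (0 : ℂ)) (MvPolynomial.X 0) := rfl
  rw [this]; simp

theorem evalA_y : evalA yA = 0 := by
  have : evalA yA = MvPolynomial.aeval (fun _ : Fin 2 => (0 : ℂ)) (MvPolynomial.X 1) := rfl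
  rw [this]; simp

/-- On monomials of `A` the sum is a power sum in the `x_k` alone, one in the `y_k` alone, or zero
because `x y = 0`: no mixed polarized power sums occur. -/
theorem sum_single_sub_mem {n : ℕ} (a : A) :
    ∑ k : Fin n, (single k a - algebraMap ℂ (T n) (evalA a)) ∈ elemIdeal n := by
  obtain ⟨p, rfl⟩ := mkA_surjective a
  induction p using MvPolynomial.induction_on' with
  | add p q hp hq =>
    convert add_mem hp hq using 1
    rw [← Finset.sum_add_distrib]
    refine Finset.sum_congr rfl fun k _ => ?_
    simp only [map_add]
    ring
  | monomial u c =>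
    have hmon : mkA (MvPolynomial.monomial u c) = algebraMap ℂ A c * (xA ^ u 0 * yA ^ u 1) := by
      rw [MvPolynomial.monomial_eq, map_mul, Finsupp.prod_fintype _ _ (by simp), Fin.prod_univ_two,
        map_mul, map_pow, map_pow]
      rfl
    rw [hmon]
    simp only [map_mul, AlgHom.commutes, map_pow, evalA_x, evalA_y]
    have hfac : ∀ k : Fin n, algebraMap ℂ (T n) c * (single k xA ^ u 0 * single k yA ^ u 1) -
        algebraMap ℂ (T n) (algebraMap ℂ ℂ c) *
          (algebraMap ℂ (T n) 0 ^ u 0 * algebraMap ℂ (T n) 0 ^ u 1) =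
        algebraMap ℂ (T n) c * (x k ^ u 0 * y k ^ u 1 - 0 ^ u 0 * 0 ^ u 1) := by
      intro k
      rw [map_zero (algebraMap ℂ (T n)), x, y, Algebra.algebraMap_self_apply]
      ring
    rw [Finset.sum_congr rfl fun k _ => hfac k, ← Finset.mul_sum]
    apply Ideal.mul_mem_left
    rcases Nat.eq_zero_or_pos (u 0) with h0 | h0 <;> rcases Nat.eq_zero_or_pos (u 1) with h1 | h1
    · simp [h0, h1]
    · simp only [h0, pow_zero, one_mul, zero_pow h1.ne', sub_zero]
      exact aeval_esymm_mem (fun k hk => f_mem hk) _ h1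
    · simp only [h1, pow_zero, mul_one, zero_pow h0.ne', sub_zero]
      exact aeval_esymm_mem (fun k hk => e_mem hk) _ h0
    · convert zero_mem (elemIdeal n)
      refine Finset.sum_eq_zero fun k _ => ?_
      obtain ⟨a, ha⟩ := Nat.exists_eq_add_of_lt h0
      obtain ⟨b, hb⟩ := Nat.exists_eq_add_of_lt h1
      rw [ha, hb, zero_add, zero_add, pow_succ, pow_succ, zero_pow (Nat.succ_ne_zero a)]
      linear_combination x k ^ a * y k ^ b * x_mul_y k

/-- The symmetrization of a product of elements of distinct tensor factors. -/
def symmProd {n : ℕ} (S : Finset (Fin n)) (a : Fin n → A) : T n :=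
  ∑ σ : Equiv.Perm (Fin n), ∏ k ∈ S, single (σ k) (a k)

/-- Multiply the symmetrization over `S` by the power sum of `a l`. Terms in which `a l` lands in an
occupied factor merge two entries and are covered by induction; the others all equal the
symmetrization over `insert l S`, and there are `|Sᶜ| ≠ 0` of them. -/
theorem symmProd_mem {n : ℕ} (S : Finset (Fin n)) (hS : S.Nonempty) (a : Fin n → A)
    (ha : ∀ k ∈ S, evalA (a k) = 0) : symmProd S a ∈ elemIdeal n := by
  induction S using Finset.induction_on generalizing a with
  | empty => exact absurd hS Finset.not_nonempty_empty
  | insert l S hl ih =>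
    have hps : ∑ j, single j (a l) ∈ elemIdeal n := by
      have := sum_single_sub_mem (n := n) (a l)
      simpa [ha l (Finset.mem_insert_self _ _)] using this
    have hexp : (∑ j, single j (a l)) * symmProd S a =
        ∑ j, ∑ σ : Equiv.Perm (Fin n), single (σ j) (a l) * ∏ k ∈ S, single (σ k) (a k) := by
      rw [symmProd, Finset.mul_sum, Finset.sum_comm]
      refine Finset.sum_congr rfl fun σ _ => ?_
      rw [← Finset.sum_mul, Equiv.sum_comp σ fun j => single j (a l)]
    have hin : ∀ j ∈ S, ∑ σ : Equiv.Perm (Fin n),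
        single (σ j) (a l) * ∏ k ∈ S, single (σ k) (a k) ∈ elemIdeal n := by
      intro j hj
      convert ih ⟨j, hj⟩ (Function.update a j (a l * a j)) ?_ using 1
      · refine Finset.sum_congr rfl fun σ _ => ?_
        rw [← Finset.mul_prod_erase _ _ hj, ← Finset.mul_prod_erase _ _ hj,
          Function.update_self, map_mul, mul_assoc]
        congr 2
        refine Finset.prod_congr rfl fun k hk => ?_
        rw [Function.update_of_ne (Finset.ne_of_mem_erase hk)]
      · intro k hk
        by_cases hkj : k = j
        · subst hkj
          rw [Function.update_self, map_mul, ha k (Finset.mem_insert_of_mem hj), mul_zero]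
        · rw [Function.update_of_ne hkj, ha k (Finset.mem_insert_of_mem hk)]
    -- Right multiplication by the transposition of `j` and `l` moves the free slot `j` to `l`
    -- without disturbing `S`.
    have hout : ∀ j ∈ Sᶜ, ∑ σ : Equiv.Perm (Fin n),
        single (σ j) (a l) * ∏ k ∈ S, single (σ k) (a k) = symmProd (insert l S) a := by
      intro j hj
      rw [symmProd, ← Equiv.sum_comp (Equiv.mulRight (Equiv.swap j l))]
      refine Finset.sum_congr rfl fun σ _ => ?_
      rw [Finset.prod_insert hl]
      simp only [Equiv.coe_mulRight, Equiv.Perm.mul_apply, Equiv.swap_apply_left]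
      congr 1
      refine Finset.prod_congr rfl fun k hk => ?_
      rw [Equiv.swap_apply_of_ne_of_ne]
      · rintro rfl; exact Finset.mem_compl.1 hj hk
      · rintro rfl; exact hl hk
    rw [← Finset.sum_add_sum_compl S (fun j => ∑ σ : Equiv.Perm (Fin n), _ * _),
      Finset.sum_congr rfl hout, Finset.sum_const] at hexp
    have hmem : Sᶜ.card • symmProd (insert l S) a ∈ elemIdeal n := by
      rw [← sub_eq_of_eq_add' hexp]
      exact sub_mem (Ideal.mul_mem_right _ _ hps) (Ideal.sum_mem _ hin)
    have hc : (Sᶜ.card : ℂ) ≠ 0 := by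
      rw [Nat.cast_ne_zero]
      exact Finset.card_ne_zero_of_mem (Finset.mem_compl.2 hl)
    have := ((elemIdeal n).restrictScalars ℂ).smul_mem (Sᶜ.card : ℂ)⁻¹ hmem
    rwa [← Nat.cast_smul_eq_nsmul ℂ, smul_smul, inv_mul_cancel₀ hc, one_smul] at this

theorem evalZero_eq (n : ℕ) : evalZero n =
    (liftSingle (fun _ : Fin n => evalA) : T n →ₐ[ℂ] ℂ).toLinearMap :=
  hom_ext fun a => by
    refine (PiTensorProduct.lift.tprod (R := ℂ) (s := fun _ : Fin n => A)
      (φ := (MultilinearMap.mkPiAlgebra ℂ (Fin n) ℂ).compLinearMap fun _ => evalA.toLinearMap)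
      a).trans ?_
    exact (liftSingle_pure (fun _ => evalA) a).symm

/-- On a pure tensor, write each entry as its value at the origin plus a remainder and expand. The
constant term is subtracted; after summing over the group every other term is a scalar times a
`symmProd` of entries vanishing at the origin. -/
theorem sum_perm_sub_mem {n : ℕ} (P : T n) :
    ∑ σ, (perm n σ P - algebraMap ℂ (T n) (evalZero n P)) ∈ elemIdeal n := by
  let g : T n →ₗ[ℂ] T n ⧸ elemIdeal n := (Ideal.Quotient.mkₐ ℂ (elemIdeal n)).toLinearMap ∘ₗ
    ∑ σ, ((perm n σ).toLinearMap - (Algebra.linearMap ℂ (T n)) ∘ₗ evalZero n)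
  have hg : g = 0 := by
    refine hom_ext fun a => ?_
    have h1 : g (pureTensor n a) = Ideal.Quotient.mk (elemIdeal n) (∑ σ,
        (perm n σ (pureTensor n a) - algebraMap ℂ (T n) (evalZero n (pureTensor n a)))) := by
      simp [g, LinearMap.sum_apply]
    rw [h1, LinearMap.zero_apply, Ideal.Quotient.eq_zero_iff_mem]
    have h2 : ∀ σ, perm n σ (pureTensor n a) - algebraMap ℂ (T n) (evalZero n (pureTensor n a)) =
        ∑ S ∈ (Finset.univ : Finset (Fin n)).powerset.erase ∅,
          algebraMap ℂ (T n) (∏ k ∈ Sᶜ, evalA (a k)) *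
            ∏ k ∈ S, single (σ k) (a k - algebraMap ℂ A (evalA (a k))) := by
      intro σ
      have h3 : perm n σ (pureTensor n a) = ∏ k, (single (σ k)
          (a k - algebraMap ℂ A (evalA (a k))) + algebraMap ℂ (T n) (evalA (a k))) := by
        rw [pureTensor_eq_prod, map_prod]
        refine Finset.prod_congr rfl fun k _ => ?_
        rw [perm_single, map_sub, AlgHom.commutes, sub_add_cancel]
      have h4 : evalZero n (pureTensor n a) = ∏ k, evalA (a k) := by
        rw [evalZero_eq]; exact liftSingle_pure _ a
      rw [h3, h4, Finset.prod_add, sub_eq_iff_eq_add, ← Finset.sum_erase_add _ _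
        (Finset.empty_mem_powerset _)]
      congr 1
      · refine Finset.sum_congr rfl fun S _ => ?_
        rw [← Finset.compl_eq_univ_sdiff, map_prod, mul_comm]
      · simp
    rw [Finset.sum_congr rfl fun σ _ => h2 σ, Finset.sum_comm]
    refine Ideal.sum_mem _ fun S hS => ?_
    rw [← Finset.mul_sum]
    refine Ideal.mul_mem_left _ _ (symmProd_mem S ?_ _ fun k _ => ?_)
    · exact Finset.nonempty_iff_ne_empty.2 (Finset.mem_erase.1 hS).1
    · rw [map_sub, AlgHom.commutes]; simp
  have h := LinearMap.congr_fun hg P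
  rw [LinearMap.zero_apply] at h
  rw [← Ideal.Quotient.eq_zero_iff_mem, ← h]
  simp [g, LinearMap.sum_apply]

theorem evalZero_elemSymm {n k : ℕ} (hk : 1 ≤ k) {u : Fin n → T n}
    (hu : ∀ l, evalZero n (u l) = 0) : evalZero n (elemSymm Finset.univ u k) = 0 := by
  rw [evalZero_eq] at hu ⊢
  rw [AlgHom.toLinearMap_apply, map_elemSymm]
  refine Finset.sum_eq_zero fun I hI => ?_
  rw [Finset.mem_powersetCard] at hI
  obtain ⟨l, hl⟩ := Finset.card_pos.1 (hI.2 ▸ hk)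
  exact Finset.prod_eq_zero hl (hu l)

/-- The ideal `J_n` is generated by elementary symmetric polynomials. -/
theorem J_eq_elemIdeal (n : ℕ) : J n = elemIdeal n := by
  apply le_antisymm
  · refine Ideal.span_le.2 ?_
    rintro P ⟨hP, h0⟩
    have h := sum_perm_sub_mem P
    simp only [hP, h0, map_zero, sub_zero, Finset.sum_const, Finset.card_univ] at h
    have hc : (Fintype.card (Equiv.Perm (Fin n)) : ℂ) ≠ 0 :=
      Nat.cast_ne_zero.2 Fintype.card_ne_zero
    have := ((elemIdeal n).restrictScalars ℂ).smul_mem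
      (Fintype.card (Equiv.Perm (Fin n)) : ℂ)⁻¹ h
    rwa [← Nat.cast_smul_eq_nsmul ℂ, smul_smul, inv_mul_cancel₀ hc, one_smul] at this
  · refine Ideal.span_le.2 ?_
    rintro _ (⟨k, hk, rfl⟩ | ⟨k, hk, rfl⟩)
    · refine Ideal.subset_span ⟨perm_e n k, evalZero_elemSymm hk fun l => ?_⟩
      rw [evalZero_eq, AlgHom.toLinearMap_apply, x, liftSingle_single, evalA_x]
    · refine Ideal.subset_span ⟨perm_f n k, evalZero_elemSymm hk fun l => ?_⟩
      rw [evalZero_eq, AlgHom.toLinearMap_apply, y, liftSingle_single, evalA_y]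

/-! ### The grading of `A^{⊗ n}` -/

section Grading

open Polynomial

/-- The coaction on `A^{⊗ n}` corresponding to the scaling of all coordinates. -/
def coaction (n : ℕ) : T n →ₐ[ℂ] (T n)[X] :=
  liftT (fun k => C (x k) * X) (fun k => C (y k) * X) fun k => by
    rw [mul_mul_mul_comm, ← C_mul, x_mul_y, C_0, zero_mul]

/-- The homogeneous component of degree `d`. -/
def component (n d : ℕ) : T n →ₗ[ℂ] T n :=
  (lcoeff (T n) d).restrictScalars ℂ ∘ₗ (coaction n).toLinearMap

/-- The homogeneous elements of degree `d`. -/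
def IsHom {n : ℕ} (d : ℕ) (P : T n) : Prop := coaction n P = C P * X ^ d

variable {n : ℕ}

theorem component_apply (d : ℕ) (P : T n) : component n d P = (coaction n P).coeff d := rfl

theorem IsHom.mul {d e : ℕ} {P Q : T n} (hP : IsHom d P) (hQ : IsHom e Q) :
    IsHom (d + e) (P * Q) := by
  rw [IsHom, map_mul, hP, hQ, C_mul, pow_add]
  ring

theorem IsHom.add {d : ℕ} {P Q : T n} (hP : IsHom d P) (hQ : IsHom d Q) : IsHom d (P + Q) := by
  rw [IsHom, map_add, hP, hQ, C_add, add_mul]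

theorem IsHom.zero (d : ℕ) : IsHom d (0 : T n) := by simp [IsHom]

theorem isHom_algebraMap (c : ℂ) : IsHom 0 (algebraMap ℂ (T n) c) := by
  rw [IsHom, AlgHom.commutes, pow_zero, mul_one]
  rfl

theorem isHom_one : IsHom 0 (1 : T n) := by
  rw [← map_one (algebraMap ℂ (T n))]; exact isHom_algebraMap 1

theorem isHom_x (k : Fin n) : IsHom 1 (x k) := by
  rw [IsHom, coaction, liftT_x, pow_one]

theorem isHom_y (k : Fin n) : IsHom 1 (y k) := by
  rw [IsHom, coaction, liftT_y, pow_one]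

theorem isHom_sum {ι : Type*} {d : ℕ} (s : Finset ι) (g : ι → T n) (h : ∀ i ∈ s, IsHom d (g i)) :
    IsHom d (∑ i ∈ s, g i) :=
  Finset.sum_induction _ _ (fun _ _ => IsHom.add) (IsHom.zero d) h

theorem isHom_prod {ι : Type*} (s : Finset ι) (g : ι → T n) (h : ∀ i ∈ s, IsHom 1 (g i)) :
    IsHom s.card (∏ i ∈ s, g i) := by
  classical
  induction s using Finset.induction_on with
  | empty => exact isHom_one
  | insert a s ha ih =>
    rw [Finset.prod_insert ha, Finset.card_insert_of_notMem ha, add_comm]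
    exact (h a (Finset.mem_insert_self _ _)).mul
      (ih fun i hi => h i (Finset.mem_insert_of_mem hi))

theorem isHom_yProd (S : Finset (Fin n)) : IsHom S.card (yProd S) :=
  isHom_prod S y fun k _ => isHom_y k

theorem isHom_e (k : ℕ) : IsHom k (e n k) := isHom_sum _ _ fun I hI => by
  rw [← (Finset.mem_powersetCard.1 hI).2]; exact isHom_prod I x fun k _ => isHom_x k

theorem isHom_f (k : ℕ) : IsHom k (f n k) := isHom_sum _ _ fun I hI => by
  rw [← (Finset.mem_powersetCard.1 hI).2]; exact isHom_yProd I

theorem IsHom.component_eq {d : ℕ} {P : T n} (hP : IsHom d P) (e : ℕ) :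
    component n e P = if e = d then P else 0 := by
  rw [component_apply, hP, coeff_C_mul_X_pow]

theorem IsHom.component_self {d : ℕ} {P : T n} (hP : IsHom d P) : component n d P = P := by
  rw [hP.component_eq, if_pos rfl]

theorem IsHom.perm {d : ℕ} {P : T n} (hP : IsHom d P) (σ : Equiv.Perm (Fin n)) :
    IsHom d (perm n σ P) := by
  have h : (coaction n).comp (DoublePoint.perm n σ) =
      (mapAlgHom (DoublePoint.perm n σ)).comp (coaction n) :=
    algHom_ext (fun k => by simp [perm_x, coaction]) (fun k => by simp [perm_y, coaction])
  have h2 := DFunLike.congr_fun h P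
  rw [AlgHom.comp_apply, AlgHom.comp_apply, hP] at h2
  rw [IsHom, h2]
  simp

theorem mem_span_isHom (P : T n) : P ∈ Submodule.span ℂ {P : T n | ∃ d, IsHom d P} := by
  induction P using T_induction with
  | hC c => exact Submodule.subset_span ⟨0, isHom_algebraMap c⟩
  | hadd P Q hP hQ => exact add_mem hP hQ
  | hmul P Q hP hQ =>
    have h := Submodule.mul_mem_mul hP hQ
    rw [Submodule.span_mul_span] at h
    refine Submodule.span_mono ?_ h
    rintro _ ⟨P, ⟨d, hd⟩, Q, ⟨e, he⟩, rfl⟩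
    exact ⟨d + e, hd.mul he⟩
  | hx k => exact Submodule.subset_span ⟨1, isHom_x k⟩
  | hy k => exact Submodule.subset_span ⟨1, isHom_y k⟩

/-- Every element is a sum of homogeneous elements. -/
theorem isHom_induction {p : T n → Prop} (P : T n) (h : ∀ d P, IsHom d P → p P)
    (hadd : ∀ P Q, p P → p Q → p (P + Q)) : p P := by
  induction mem_span_isHom P using Submodule.closure_induction with
  | zero => exact h 0 0 (IsHom.zero 0)
  | add P Q _ _ hP hQ => exact hadd P Q hP hQ
  | smul_mem c P hP =>
    obtain ⟨d, hd⟩ := hP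
    refine h d _ ?_
    rw [Algebra.smul_def, ← zero_add d]
    exact (isHom_algebraMap c).mul hd

theorem isHom_component (d : ℕ) (P : T n) : IsHom d (component n d P) := by
  induction P using isHom_induction with
  | h e P hP =>
    rw [hP.component_eq]
    split_ifs with h
    · exact h ▸ hP
    · exact IsHom.zero d
  | hadd P Q hP hQ => rw [map_add]; exact hP.add hQ

theorem component_perm (d : ℕ) (σ : Equiv.Perm (Fin n)) (P : T n) :
    component n d (perm n σ P) = perm n σ (component n d P) := by
  induction P using isHom_induction with
  | h e P hP => rw [hP.component_eq, (hP.perm σ).component_eq]; split_ifs <;> simp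
  | hadd P Q hP hQ => simp only [map_add, hP, hQ]

theorem sum_component (P : T n) : ∑ d ∈ (coaction n P).support, component n d P = P := by
  have h : ((aeval (1 : T n)).restrictScalars ℂ).comp (coaction n) = AlgHom.id ℂ (T n) :=
    algHom_ext (fun k => by simp [coaction]) (fun k => by simp [coaction])
  have h2 := DFunLike.congr_fun h P
  rw [AlgHom.comp_apply, AlgHom.id_apply] at h2
  conv_rhs => rw [← h2]
  rw [AlgHom.restrictScalars_apply, coe_aeval_eq_eval, eval_eq_sum, sum_def]
  exact Finset.sum_congr rfl fun d _ => by rw [component_apply, one_pow, mul_one]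

/-- The ideal `I` contains the homogeneous components of its elements. -/
def IsHomogIdeal (I : Ideal (T n)) : Prop := ∀ P ∈ I, ∀ d, component n d P ∈ I

theorem isHomogIdeal_span {s : Set (T n)} (hs : ∀ P ∈ s, ∃ d, IsHom d P) :
    IsHomogIdeal (Ideal.span s) := by
  intro P hP d
  induction hP using Submodule.closure_induction with
  | zero => rw [map_zero]; exact zero_mem _
  | add P Q _ _ hP hQ => rw [map_add]; exact add_mem hP hQ
  | smul_mem a P hP =>
    obtain ⟨e, he⟩ := hs P hP
    induction a using isHom_induction with
    | h e' a ha =>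
      rw [smul_eq_mul, (ha.mul he).component_eq]
      split_ifs
      · exact Ideal.mul_mem_left _ _ (Ideal.subset_span hP)
      · exact zero_mem _
    | hadd a b ha hb => rw [add_smul, map_add]; exact add_mem ha hb

theorem isHomogIdeal_FT (i : ℕ) : IsHomogIdeal (FT n i) :=
  isHomogIdeal_span fun _ ⟨S, _, hP⟩ => ⟨S.card, hP ▸ isHom_yProd S⟩

theorem isHomogIdeal_elemIdeal : IsHomogIdeal (elemIdeal n) :=
  isHomogIdeal_span (by
    rintro _ (⟨k, -, rfl⟩ | ⟨k, -, rfl⟩)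
    · exact ⟨k, isHom_e k⟩
    · exact ⟨k, isHom_f k⟩)

theorem IsHomogIdeal.sup {I I' : Ideal (T n)} (h : IsHomogIdeal I) (h' : IsHomogIdeal I') :
    IsHomogIdeal (I ⊔ I') := by
  intro P hP d
  obtain ⟨Q, hQ, Q', hQ', rfl⟩ := Submodule.mem_sup.1 hP
  rw [map_add]
  exact add_mem (Ideal.mem_sup_left (h Q hQ d)) (Ideal.mem_sup_right (h' Q' hQ' d))

theorem IsHomogIdeal.mul {I I' : Ideal (T n)} (h : IsHomogIdeal I) (h' : IsHomogIdeal I') :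
    IsHomogIdeal (I * I') := by
  intro P hP d
  induction hP using Submodule.mul_induction_on' with
  | mem_mul_mem Q hQ Q' hQ' =>
    rw [← sum_component Q, ← sum_component Q', Finset.sum_mul_sum, map_sum]
    refine Ideal.sum_mem _ fun i _ => ?_
    rw [map_sum]
    refine Ideal.sum_mem _ fun j _ => ?_
    rw [((isHom_component i Q).mul (isHom_component j Q')).component_eq]
    split_ifs
    · exact Ideal.mul_mem_mul (h Q hQ i) (h' Q' hQ' j)
    · exact zero_mem _
  | add P Q _ _ hP hQ => rw [map_add]; exact add_mem hP hQ

theorem IsHom.component_mul {k : ℕ} {a : T n} (ha : IsHom k a) (d : ℕ) (P : T n) :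
    component n d (a * P) = if k ≤ d then a * component n (d - k) P else 0 := by
  induction P using isHom_induction with
  | h e P hP =>
    rw [(ha.mul hP).component_eq, hP.component_eq]
    by_cases h1 : k ≤ d
    · by_cases h2 : d = k + e
      · rw [if_pos h2, if_pos h1, if_pos (by omega)]
      · rw [if_neg h2, if_pos h1, if_neg (by omega), mul_zero]
    · rw [if_neg (by omega), if_neg h1]
  | hadd P Q hP hQ => rw [mul_add, map_add, hP, hQ, map_add]; split_ifs <;> ring

end Grading

/-! ### Averaging and degeneration -/

/-- Maschke's averaging of an arbitrary linear projection; no finite-dimensionality is needed. -/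
theorem exists_equivariant_projection {n : ℕ} (K : Ideal (T n))
    (hK : ∀ σ, K ≤ K.comap (perm n σ)) :
    ∃ q : T n →ₗ[ℂ] T n, (∀ P, q P ∈ K) ∧ (∀ P ∈ K, q P = P) ∧
      ∀ σ P, q (perm n σ P) = perm n σ (q P) := by
  obtain ⟨g, hg⟩ := LinearMap.exists_leftInverse_of_injective (K.restrictScalars ℂ).subtype
    (Submodule.ker_subtype _)
  have hgK : ∀ P ∈ K, ((g P : K.restrictScalars ℂ) : T n) = P := fun P hP =>
    congrArg Subtype.val (LinearMap.congr_fun hg ⟨P, hP⟩)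
  have hc : (Fintype.card (Equiv.Perm (Fin n)) : ℂ) ≠ 0 := Nat.cast_ne_zero.2 Fintype.card_ne_zero
  let q : T n →ₗ[ℂ] T n := (Fintype.card (Equiv.Perm (Fin n)) : ℂ)⁻¹ • ∑ σ,
    (perm n σ).toLinearMap ∘ₗ (K.restrictScalars ℂ).subtype ∘ₗ g ∘ₗ (perm n σ⁻¹).toLinearMap
  have hq : ∀ P, q P = (Fintype.card (Equiv.Perm (Fin n)) : ℂ)⁻¹ •
      ∑ σ, perm n σ (g (perm n σ⁻¹ P) : K.restrictScalars ℂ) := by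
    intro P; simp [q, LinearMap.sum_apply]
  refine ⟨q, fun P => ?_, fun P hP => ?_, fun σ P => ?_⟩
  · rw [hq]
    exact (K.restrictScalars ℂ).smul_mem _ (Ideal.sum_mem K fun σ _ =>
      hK σ (g (perm n σ⁻¹ P) : K.restrictScalars ℂ).2)
  · rw [hq, Finset.sum_congr rfl (g := fun _ => P), Finset.sum_const, Finset.card_univ,
      ← Nat.cast_smul_eq_nsmul ℂ, smul_smul, inv_mul_cancel₀ hc, one_smul]
    intro σ _
    rw [hgK _ (hK σ⁻¹ hP), ← AlgHom.comp_apply, ← perm_mul, mul_inv_cancel, perm_one,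
      AlgHom.id_apply]
  · rw [hq, hq, map_smul, map_sum, ← Equiv.sum_comp (Equiv.mulLeft σ)]
    congr 1
    refine Finset.sum_congr rfl fun τ _ => ?_
    rw [Equiv.coe_mulLeft, perm_mul, AlgHom.comp_apply, ← AlgHom.comp_apply (perm n (σ * τ)⁻¹),
      ← perm_mul, mul_inv_rev, inv_mul_cancel_right]

/-- If `Θ` identifies elements of `K` with elements of lower degree, then the quotient by `K` of
the ideal `N` is at least as large as the image of `N` under `Θ`. -/
theorem exists_degeneration {n : ℕ} {V : Type*} [AddCommGroup V] [Module ℂ V] (N K : Ideal (T n))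
    (hN : IsHomogIdeal N) (hKh : IsHomogIdeal K)
    (hKs : ∀ σ, K ≤ K.comap (perm n σ)) (Θ : T n →ₗ[ℂ] V)
    (hΘ : ∀ v, ∃ P ∈ N, Θ P = v)
    (hK : ∀ P ∈ K, ∀ d, ∃ P' ∈ N, (∀ e, d ≤ e → component n e P' = 0) ∧
      Θ (component n d P) = Θ P') :
    ∃ Ψ : T n →ₗ[ℂ] V, (∀ P ∈ K, Ψ P = 0) ∧ (∀ v, ∃ P ∈ N, Ψ P = v) ∧
      ∀ τ : Equiv.Perm (Fin n) → V →ₗ[ℂ] V, (∀ σ P, Θ (perm n σ P) = τ σ (Θ P)) →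
        ∀ σ P, Ψ (perm n σ P) = τ σ (Ψ P) := by
  obtain ⟨q, hqK, hqid, hqs⟩ := exists_equivariant_projection K hKs
  -- On degree `d`, `Γ` subtracts the degree `d` part of the projection to `K`. It is equivariant
  -- and kills the homogeneous ideal `K`, so `Θ ∘ Γ` is the required map.
  let Γ : T n →ₗ[ℂ] T n := Polynomial.lsum (fun d => LinearMap.id - component n d ∘ₗ q) ∘ₗ
    (coaction n).toLinearMap
  have hΓ : ∀ d P, IsHom d P → Γ P = P - component n d (q P) := by
    intro d P hP
    have h1 : Γ P = Polynomial.lsum (fun d => LinearMap.id - component n d ∘ₗ q)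
      (coaction n P) := rfl
    rw [h1, hP, Polynomial.lsum_apply, Polynomial.C_mul_X_pow_eq_monomial,
      Polynomial.sum_monomial_index _ _ (by simp)]
    simp
  have hΓs : ∀ σ P, Γ (perm n σ P) = perm n σ (Γ P) := by
    intro σ P
    induction P using isHom_induction with
    | h d P hP => rw [hΓ d P hP, hΓ d _ (hP.perm σ), hqs, component_perm, map_sub]
    | hadd P Q hP hQ => simp only [map_add, hP, hQ]
  -- Passing to `Γ` loses nothing in the image: on a component of degree `e` the correction has the
  -- same image under `Θ` as an element of `N` of degree below `e`, to which the induction applies.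
  have main : ∀ d, ∀ P ∈ N, (∀ e, d ≤ e → component n e P = 0) → ∃ Q ∈ N, Θ (Γ Q) = Θ P := by
    intro d
    induction d using Nat.strong_induction_on with
    | _ d ih =>
      intro P hP hd
      have hs : ∀ s : Finset ℕ, (∀ e ∈ s, e < d) →
          ∃ Q ∈ N, Θ (Γ Q) = Θ (∑ e ∈ s, component n e P) := by
        intro s
        induction s using Finset.induction_on with
        | empty => intro _; exact ⟨0, zero_mem _, by simp⟩
        | insert e s hes ihs =>
          intro hse
          obtain ⟨Q, hQ, hQs⟩ := ihs fun e he => hse e (Finset.mem_insert_of_mem he)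
          have hPe : component n e P ∈ N := hN P hP e
          obtain ⟨P', hP', hlow, heq⟩ := hK (q (component n e P)) (hqK _) e
          obtain ⟨Q', hQ', hQ's⟩ := ih e (hse e (Finset.mem_insert_self _ _)) P' hP' hlow
          refine ⟨component n e P + Q' + Q, add_mem (add_mem hPe hQ') hQ, ?_⟩
          rw [Finset.sum_insert hes]
          simp only [map_add]
          rw [hQs, hQ's, ← heq, hΓ e _ (isHom_component e P), map_sub, sub_add_cancel]
      obtain ⟨Q, hQ, hQs⟩ := hs (coaction n P).support fun e he => by
        by_contra hle
        exact Polynomial.mem_support_iff.1 he (hd e (not_lt.1 hle))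
      exact ⟨Q, hQ, by rw [hQs, sum_component]⟩
  refine ⟨Θ ∘ₗ Γ, fun P hP => ?_, fun v => ?_, fun τ hτ σ P => ?_⟩
  · have : Γ P = 0 := by
      rw [← sum_component P, map_sum]
      refine Finset.sum_eq_zero fun d _ => ?_
      rw [hΓ d _ (isHom_component d P), hqid _ (hKh P hP d), (isHom_component d P).component_self,
        sub_self]
    rw [LinearMap.comp_apply, this, map_zero]
  · obtain ⟨P, hP, rfl⟩ := hΘ v
    refine main ((coaction n P).natDegree + 1) P hP fun e he => ?_
    rw [component_apply]
    exact Polynomial.coeff_eq_zero_of_natDegree_lt (by omega)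
  · show Θ (Γ (perm n σ P)) = τ σ (Θ (Γ P))
    rw [hΓs, hτ]

/-- A version of `exists_degeneration` in which `Θ` is linear over the symmetric polynomials. -/
theorem exists_degeneration_of_smul {n : ℕ} {V : Type*} [AddCommGroup V] [Module ℂ V]
    (N K : Ideal (T n)) (hN : IsHomogIdeal N) (hKh : IsHomogIdeal K)
    (hNs : ∀ σ, N ≤ N.comap (perm n σ)) (hKs : ∀ σ, K ≤ K.comap (perm n σ)) (Θ : T n →ₗ[ℂ] V)
    (hΘ : ∀ v, ∃ P ∈ N, Θ P = v) (hK : ∀ P ∈ K, Θ P = 0)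
    (he : ∀ k, ∃ c : ℂ, ∀ P ∈ N, Θ (e n k * P) = c • Θ P)
    (hf : ∀ k, ∃ c : ℂ, ∀ P ∈ N, Θ (f n k * P) = c • Θ P) :
    ∃ Ψ : T n →ₗ[ℂ] V, (∀ P ∈ K ⊔ elemIdeal n * N, Ψ P = 0) ∧ (∀ v, ∃ P ∈ N, Ψ P = v) ∧
      ∀ τ : Equiv.Perm (Fin n) → V →ₗ[ℂ] V, (∀ σ P, Θ (perm n σ P) = τ σ (Θ P)) →
        ∀ σ P, Ψ (perm n σ P) = τ σ (Ψ P) := by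
  have hes : ∀ σ, elemIdeal n ≤ (elemIdeal n).comap (perm n σ) := by
    rw [← J_eq_elemIdeal]; exact J_stable n
  refine exists_degeneration N _ hN (hKh.sup (isHomogIdeal_elemIdeal.mul hN)) (fun σ => ?_) Θ hΘ ?_
  · refine sup_le ((hKs σ).trans (Ideal.comap_mono le_sup_left)) (Ideal.mul_le.2 fun P hP Q hQ => ?_)
    rw [Ideal.mem_comap, map_mul]
    exact Ideal.mem_sup_right (Ideal.mul_mem_mul (hes σ hP) (hNs σ hQ))
  · have hgen : ∀ k a, 1 ≤ k → IsHom k a → (∃ c : ℂ, ∀ P ∈ N, Θ (a * P) = c • Θ P) →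
        ∀ P ∈ N, ∀ d, ∃ P' ∈ N, (∀ e, d ≤ e → component n e P' = 0) ∧
          Θ (component n d (a * P)) = Θ P' := by
      rintro k a hk ha ⟨c, hc⟩ P hP d
      rw [ha.component_mul]
      split_ifs with hkd
      · refine ⟨c • component n (d - k) P, (N.restrictScalars ℂ).smul_mem c (hN P hP _),
          fun e hde => ?_, ?_⟩
        · rw [map_smul, (isHom_component _ P).component_eq, if_neg (by omega), smul_zero]
        · rw [hc _ (hN P hP _), map_smul]
      · exact ⟨0, zero_mem _, fun _ _ => map_zero _, rfl⟩
    have hadd : ∀ P Q d, (∃ P' ∈ N, (∀ e, d ≤ e → component n e P' = 0) ∧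
          Θ (component n d P) = Θ P') → (∃ P' ∈ N, (∀ e, d ≤ e → component n e P' = 0) ∧
          Θ (component n d Q) = Θ P') → ∃ P' ∈ N, (∀ e, d ≤ e → component n e P' = 0) ∧
          Θ (component n d (P + Q)) = Θ P' := by
      rintro P Q d ⟨P', hP', h1, h2⟩ ⟨Q', hQ', h3, h4⟩
      exact ⟨P' + Q', add_mem hP' hQ', fun e hde => by rw [map_add, h1 e hde, h3 e hde, add_zero],
        by rw [map_add, map_add, map_add, h2, h4]⟩
    intro P' hP' d
    obtain ⟨P, hP, Q, hQ, rfl⟩ := Submodule.mem_sup.1 hP'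
    clear hP'
    refine hadd P Q d ⟨0, zero_mem _, fun _ _ => map_zero _, ?_⟩ ?_
    · rw [hK _ (hKh P hP d), map_zero]
    · induction hQ using Submodule.mul_induction_on' with
      | mem_mul_mem a ha b hb =>
        induction ha using Submodule.span_induction generalizing b with
        | mem a ha =>
          rcases ha with ⟨k, hk, rfl⟩ | ⟨k, hk, rfl⟩
          · exact hgen k _ hk (isHom_e k) (he k) b hb d
          · exact hgen k _ hk (isHom_f k) (hf k) b hb d
        | zero => exact ⟨0, zero_mem _, fun _ _ => map_zero _, by simp⟩
        | add a a' _ _ h h' => rw [add_mul]; exact hadd _ _ d (h b hb) (h' b hb)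
        | smul c a _ h =>
          rw [smul_eq_mul, mul_comm c, mul_assoc]
          exact h _ (Ideal.mul_mem_left _ _ hb)
      | add a _ b _ ha hb => exact hadd a b d ha hb

/-! ### Evaluation at the points of a generic orbit -/

theorem perm_perm {n : ℕ} (σ τ : Equiv.Perm (Fin n)) (P : T n) :
    perm n σ (perm n τ P) = perm n (σ * τ) P := by
  rw [perm_mul, AlgHom.comp_apply]

/-- Lagrange interpolation in the functions `x_k + y_k`, which recover the `k`-th value whichever
axis the coordinate lies on. It separates value vectors only, so repeated values leave a stabilizer
undetected. -/
theorem exists_interpolation {n : ℕ} (v : Fin n → ℂ) (ε : T n →ₐ[ℂ] ℂ)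
    (hε : ∀ k, ε (x k) + ε (y k) = v k) (τ : Equiv.Perm (Fin n)) :
    ∃ g : T n, (∀ σ, (∀ k, v (τ⁻¹ k) = v (σ⁻¹ k)) → ε (perm n σ⁻¹ g) = 1) ∧
      ∀ σ, (∃ k, v (τ⁻¹ k) ≠ v (σ⁻¹ k)) → ε (perm n σ⁻¹ g) = 0 := by
  classical
  let s : Fin n → Finset ℂ := fun k => (Finset.univ.image v).erase (v (τ⁻¹ k))
  let g : T n := ∏ k, ∏ c ∈ s k,
    algebraMap ℂ (T n) (v (τ⁻¹ k) - c)⁻¹ * (x k + y k - algebraMap ℂ (T n) c)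
  have hg : ∀ σ, ε (perm n σ⁻¹ g) =
      ∏ k, ∏ c ∈ s k, (v (τ⁻¹ k) - c)⁻¹ * (v (σ⁻¹ k) - c) := by
    intro σ
    simp only [g, map_prod, map_mul, AlgHom.commutes, map_sub, map_add, perm_x, perm_y, hε]
    rfl
  refine ⟨g, fun σ h => ?_, fun σ ⟨k, hk⟩ => ?_⟩
  · rw [hg]
    refine Finset.prod_eq_one fun k _ => Finset.prod_eq_one fun c hc => ?_
    rw [← h k]
    exact inv_mul_cancel₀ (sub_ne_zero.2 (Finset.ne_of_mem_erase hc).symm)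
  · rw [hg]
    refine Finset.prod_eq_zero (Finset.mem_univ k)
      (Finset.prod_eq_zero (i := v (σ⁻¹ k)) ?_ (by rw [sub_self, mul_zero]))
    exact Finset.mem_erase.2 ⟨hk.symm, Finset.mem_image_of_mem v (Finset.mem_univ _)⟩

theorem isHomogIdeal_top (n : ℕ) : IsHomogIdeal (⊤ : Ideal (T n)) := fun _ _ _ => trivial

/-- Modulo `y_1, …, y_n`, the coinvariant algebra maps onto the functions on a free orbit. -/
theorem exists_surjection_degree_zero (n : ℕ) :
    ∃ Ψ : T n →ₗ[ℂ] (Equiv.Perm (Fin n) → ℂ), (∀ P ∈ FT n 1 ⊔ elemIdeal n, Ψ P = 0) ∧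
      Function.Surjective Ψ := by
  classical
  -- Distinct values make the orbit free, so interpolation reaches every function on the group.
  let v : Fin n → ℂ := fun k => ((k : ℕ) : ℂ)
  have hv : Function.Injective v := fun k l h => Fin.ext (Nat.cast_injective h)
  let ε : T n →ₐ[ℂ] ℂ := liftT v 0 (by simp)
  have hεx : ∀ k, ε (x k) = v k := liftT_x _ _ _
  have hεy : ∀ k, ε (y k) = 0 := liftT_y _ _ _
  let Θ : T n →ₗ[ℂ] (Equiv.Perm (Fin n) → ℂ) :=
    LinearMap.pi fun σ => ε.toLinearMap ∘ₗ (perm n σ⁻¹).toLinearMap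
  have hΘ : ∀ P σ, Θ P σ = ε (perm n σ⁻¹ P) := fun P σ => rfl
  have hinv : ∀ a : T n, (∀ σ, perm n σ a = a) → ∃ c : ℂ, ∀ P ∈ (⊤ : Ideal (T n)),
      Θ (a * P) = c • Θ P := by
    intro a ha
    refine ⟨ε a, fun P _ => funext fun σ => ?_⟩
    rw [hΘ, map_mul, ha, map_mul, Pi.smul_apply, hΘ, smul_eq_mul]
  have hsurj : ∀ u, ∃ P ∈ (⊤ : Ideal (T n)), Θ P = u := by
    intro u
    have hε : ∀ k, ε (x k) + ε (y k) = v k := fun k => by rw [hεx, hεy, add_zero]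
    choose g hg1 hg0 using exists_interpolation v ε hε
    refine ⟨∑ τ, u τ • g τ, trivial, funext fun σ => ?_⟩
    rw [map_sum, Finset.sum_apply, Finset.sum_eq_single σ]
    · rw [map_smul, Pi.smul_apply, hΘ, hg1 σ σ fun _ => rfl, smul_eq_mul, mul_one]
    · intro τ _ hτ
      rw [map_smul, Pi.smul_apply, hΘ, hg0 τ σ, smul_zero]
      by_contra hne
      push Not at hne
      exact hτ (inv_injective (Equiv.ext fun k => hv (hne k)))
    · exact fun h => absurd (Finset.mem_univ σ) h
  have hzero : ∀ P ∈ FT n 1, Θ P = 0 := by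
    intro P hP
    induction hP using Submodule.span_induction with
    | mem P hP =>
      obtain ⟨S, hS, rfl⟩ := hP
      obtain ⟨k, hk⟩ := Finset.card_pos.1 (hS ▸ one_pos)
      funext σ
      rw [hΘ, yProd, map_prod, map_prod]
      exact Finset.prod_eq_zero hk (by rw [perm_y, hεy])
    | zero => exact map_zero _
    | add P Q _ _ hP hQ => rw [map_add, hP, hQ, add_zero]
    | smul a P _ hP =>
      funext σ
      have := congrFun hP σ
      rw [hΘ, Pi.zero_apply] at this
      rw [hΘ, smul_eq_mul, map_mul, map_mul, this, mul_zero, Pi.zero_apply]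
  obtain ⟨Ψ, h1, h2, -⟩ := exists_degeneration_of_smul ⊤ (FT n 1) (isHomogIdeal_top n)
    (isHomogIdeal_FT 1) (fun _ _ _ => trivial) (FT_stable n 1) Θ hsurj hzero
    (fun k => hinv _ (perm_e n k)) (fun k => hinv _ (perm_f n k))
  refine ⟨Ψ, fun P hP => h1 P ?_, fun u => ?_⟩
  · rwa [Ideal.mul_top]
  · obtain ⟨P, -, hP⟩ := h2 u
    exact ⟨P, hP⟩

/-! ### Values in the induced representation -/

section Induced

variable {n : ℕ} (hn : 2 ≤ n)

/-- The transposition of the first two letters. -/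
def firstSwap : Equiv.Perm (Fin n) := Equiv.swap (Fin.castLE hn 0) (Fin.castLE hn 1)

theorem inclS2_swap : inclS2 hn (Equiv.swap 0 1) = firstSwap hn := by
  rw [inclS2, Equiv.Perm.viaEmbeddingHom_apply]
  ext k : 1
  by_cases hk : k ∈ Set.range (Fin.castLEEmb hn)
  · obtain ⟨l, rfl⟩ := hk
    rw [Equiv.Perm.viaEmbedding_apply]
    have : ∀ l : Fin 2, l = 0 ∨ l = 1 := by decide
    rcases this l with rfl | rfl
    · rw [Equiv.swap_apply_left]; exact (Equiv.swap_apply_left _ _).symm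
    · rw [Equiv.swap_apply_right]; exact (Equiv.swap_apply_right _ _).symm
  · rw [Equiv.Perm.viaEmbedding_apply_of_notMem _ _ _ hk, firstSwap, Equiv.swap_apply_of_ne_of_ne]
    · rintro rfl; exact hk ⟨0, rfl⟩
    · rintro rfl; exact hk ⟨1, rfl⟩

theorem signRep_swap (c : ℂ) : signRep (Equiv.swap 0 1) c = -c := by
  show ((Equiv.Perm.sign (Equiv.swap (0 : Fin 2) 1) : ℤ) : ℂ) • c = -c
  rw [Equiv.Perm.sign_swap (by decide)]
  simp

theorem indSign_mk_firstSwap (σ : Equiv.Perm (Fin n)) (c : ℂ) :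
    Representation.IndV.mk (inclS2 hn) signRep (firstSwap hn * σ) c =
      - Representation.IndV.mk (inclS2 hn) signRep σ c := by
  have h := Representation.Coinvariants.mk_self_apply
    (Representation.tprod ((Representation.leftRegular ℂ (Equiv.Perm (Fin n))).comp (inclS2 hn))
      signRep) (Equiv.swap 0 1) (TensorProduct.mk ℂ _ _ (MonoidAlgebra.single σ 1) (-c))
  rw [TensorProduct.mk_apply, Representation.tprod_apply, TensorProduct.map_tmul, signRep_swap,
    neg_neg, MonoidHom.comp_apply, inclS2_swap] at h
  rw [← map_neg, LinearMap.comp_apply, LinearMap.comp_apply, TensorProduct.mk_apply,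
    TensorProduct.mk_apply, ← h]
  simp

/-- The element `∑ u(σ) [σ]` of the induced representation. -/
def indSum : (Equiv.Perm (Fin n) → ℂ) →ₗ[ℂ] Representation.IndV (inclS2 hn) signRep :=
  ∑ σ, Representation.IndV.mk (inclS2 hn) signRep σ ∘ₗ LinearMap.proj σ

theorem indSum_apply (u : Equiv.Perm (Fin n) → ℂ) :
    indSum hn u = ∑ σ, Representation.IndV.mk (inclS2 hn) signRep σ (u σ) := by
  rw [indSum, LinearMap.sum_apply]; rfl

theorem indSum_surjective : Function.Surjective (indSum hn) := by
  classical
  rw [← LinearMap.range_eq_top, ← Submodule.ker_mkQ (LinearMap.range (indSum hn)),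
    LinearMap.ker_eq_top]
  refine Representation.IndV.hom_ext _ _ fun σ => LinearMap.ext fun c => ?_
  rw [LinearMap.comp_apply, Submodule.mkQ_apply, LinearMap.zero_comp, LinearMap.zero_apply,
    Submodule.Quotient.mk_eq_zero]
  refine ⟨Pi.single σ c, ?_⟩
  rw [indSum_apply, Finset.sum_eq_single σ]
  · rw [Pi.single_eq_same]
  · intro τ _ h; rw [Pi.single_eq_of_ne h, map_zero]
  · simp

theorem indSum_eq_zero {u : Equiv.Perm (Fin n) → ℂ} (hu : ∀ σ, u (firstSwap hn * σ) = u σ) :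
    indSum hn u = 0 := by
  have h : indSum hn u = - indSum hn u := by
    conv_lhs => rw [indSum_apply, ← Equiv.sum_comp (Equiv.mulLeft (firstSwap hn))]
    rw [indSum_apply, ← Finset.sum_neg_distrib]
    refine Finset.sum_congr rfl fun σ _ => ?_
    rw [Equiv.coe_mulLeft, indSign_mk_firstSwap, hu]
  have h2 : (2 : ℂ) • indSum hn u = 0 := by rw [two_smul, ← eq_neg_iff_add_eq_zero]; exact h
  exact (smul_eq_zero.1 h2).resolve_left two_ne_zero

theorem indSign_indSum (π : Equiv.Perm (Fin n)) (u : Equiv.Perm (Fin n) → ℂ) :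
    indSign hn π (indSum hn u) = indSum hn fun σ => u (σ * π) := by
  rw [indSum_apply, indSum_apply, map_sum, ← Equiv.sum_comp (Equiv.mulRight π)]
  refine Finset.sum_congr rfl fun σ _ => ?_
  rw [Representation.ind_mk, Equiv.coe_mulRight, mul_inv_cancel_right]

/-- Antisymmetrization, as a map out of the induced representation. -/
theorem exists_antisymm : ∃ L : Representation.IndV (inclS2 hn) signRep →ₗ[ℂ]
    (Equiv.Perm (Fin n) → ℂ), ∀ u σ, L (indSum hn u) σ = u σ - u (firstSwap hn * σ) := by
  classical
  have hss : ∀ σ, firstSwap hn * (firstSwap hn * σ) = σ := fun σ => by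
    rw [← mul_assoc, firstSwap, Equiv.swap_mul_self, one_mul]
  let g : MonoidAlgebra ℂ (Equiv.Perm (Fin n)) →ₗ[ℂ] (Equiv.Perm (Fin n) → ℂ) :=
    LinearMap.pi fun σ => (Finsupp.lapply σ - Finsupp.lapply (firstSwap hn * σ)) ∘ₗ
      (MonoidAlgebra.coeffLinearEquiv ℂ).toLinearMap
  have hg : ∀ τ c σ, g (MonoidAlgebra.single τ c) σ =
      (if τ = σ then c else 0) - (if τ = firstSwap hn * σ then c else 0) := by
    intro τ c σ
    show (MonoidAlgebra.single τ c).coeff σ - (MonoidAlgebra.single τ c).coeff _ = _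
    rw [MonoidAlgebra.coeff_single, Finsupp.single_apply, Finsupp.single_apply]
  have hgs : ∀ τ c, g (MonoidAlgebra.single (firstSwap hn * τ) c) =
      - g (MonoidAlgebra.single τ c) := by
    intro τ c
    funext σ
    have h1 : firstSwap hn * τ = σ ↔ τ = firstSwap hn * σ :=
      ⟨fun h => by rw [← h, hss], fun h => by rw [h, hss]⟩
    rw [Pi.neg_apply, hg, hg]
    simp only [mul_right_inj, neg_sub, h1]
  let F : TensorProduct ℂ (MonoidAlgebra ℂ (Equiv.Perm (Fin n))) ℂ →ₗ[ℂ]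
      (Equiv.Perm (Fin n) → ℂ) :=
    TensorProduct.lift ((LinearMap.lsmul ℂ (Equiv.Perm (Fin n) → ℂ)).flip ∘ₗ g)
  have hF : ∀ z c, F (z ⊗ₜ c) = c • g z := fun z c => rfl
  let L := Representation.Coinvariants.lift (Representation.tprod
    ((Representation.leftRegular ℂ (Equiv.Perm (Fin n))).comp (inclS2 hn)) signRep) F (by
      intro h
      have h2 : ∀ h : Equiv.Perm (Fin 2), h = 1 ∨ h = Equiv.swap 0 1 := by decide
      rcases h2 h with rfl | rfl
      · rw [map_one]; rfl
      · refine TensorProduct.ext (MonoidAlgebra.lhom_ext' fun τ => LinearMap.ext_ring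
          (LinearMap.ext fun c => ?_))
        show F ((Representation.leftRegular ℂ (Equiv.Perm (Fin n)) (inclS2 hn (Equiv.swap 0 1))
          (MonoidAlgebra.single τ 1)) ⊗ₜ (signRep (Equiv.swap 0 1) c)) =
          F (MonoidAlgebra.single τ 1 ⊗ₜ c)
        rw [signRep_swap, inclS2_swap, hF, hF]
        have h3 : Representation.leftRegular ℂ (Equiv.Perm (Fin n)) (firstSwap hn)
          (MonoidAlgebra.single τ 1) = MonoidAlgebra.single (firstSwap hn * τ) (1 : ℂ) := by simp
        rw [h3, hgs, neg_smul, smul_neg, neg_neg])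
  have hL : ∀ τ c, L (Representation.IndV.mk (inclS2 hn) signRep τ c) =
      c • g (MonoidAlgebra.single τ 1) := fun τ c => rfl
  refine ⟨L, fun u σ => ?_⟩
  rw [indSum_apply, map_sum, Finset.sum_apply]
  simp only [hL, Pi.smul_apply, hg, smul_eq_mul, mul_sub, Finset.sum_sub_distrib]
  simp

/-- Elements of the kernel of `indSum` are invariant under left multiplication by `firstSwap`. If
the twist of `u` by the sign is also in the kernel, then `u` is anti-invariant as well, hence zero.
Thus the functions on the group embed in two copies of the induced module. -/
theorem factorial_le_two_mul_finrank :
    n.factorial ≤ 2 * Module.finrank ℂ (Representation.IndV (inclS2 hn) signRep) := by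
  obtain ⟨L, hL⟩ := exists_antisymm hn
  have : FiniteDimensional ℂ (Representation.IndV (inclS2 hn) signRep) :=
    Module.Finite.of_surjective _ (indSum_surjective hn)
  let sgn : (Equiv.Perm (Fin n) → ℂ) →ₗ[ℂ] (Equiv.Perm (Fin n) → ℂ) :=
    LinearMap.pi fun σ => ((Equiv.Perm.sign σ : ℤ) : ℂ) • LinearMap.proj σ
  have hsgn : ∀ u σ, sgn u σ = ((Equiv.Perm.sign σ : ℤ) : ℂ) * u σ := fun u σ => rfl
  have hne : Fin.castLE hn 0 ≠ Fin.castLE hn 1 := by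
    intro h; simpa using congrArg Fin.val h
  have hinj : Function.Injective ((indSum hn).prod (indSum hn ∘ₗ sgn)) := by
    rw [← LinearMap.ker_eq_bot, LinearMap.ker_eq_bot']
    intro u hu
    have h1 : indSum hn u = 0 := congrArg Prod.fst hu
    have h2 : indSum hn (sgn u) = 0 := congrArg Prod.snd hu
    funext σ
    have h3 := hL u σ
    have h4 := hL (sgn u) σ
    rw [h1, map_zero, Pi.zero_apply] at h3
    rw [h2, map_zero, Pi.zero_apply, hsgn, hsgn, Equiv.Perm.sign_mul, firstSwap,
      Equiv.Perm.sign_swap hne] at h4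
    have h5 : ((Equiv.Perm.sign σ : ℤ) : ℂ) ≠ 0 := by
      rcases Int.units_eq_one_or (Equiv.Perm.sign σ) with h | h <;> simp [h]
    have h6 : ((Equiv.Perm.sign σ : ℤ) : ℂ) * (2 * u σ) = 0 := by
      rw [firstSwap] at h3
      push_cast at h4
      linear_combination ((Equiv.Perm.sign σ : ℤ) : ℂ) * -h3 - h4
    have h7 := (mul_eq_zero.1 h6).resolve_left h5
    exact (mul_eq_zero.1 h7).resolve_left two_ne_zero
  have := LinearMap.finrank_le_finrank_of_injective hinj
  rw [Module.finrank_prod, Module.finrank_pi, Fintype.card_perm, Fintype.card_fin] at this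
  omega

end Induced

/-! ### The map to the induced representation -/

/-- `ρ` is restriction to a line through a point fixed by `firstSwap`, along which the
`y`-coordinate of the first letter moves. Only the `y`-coordinates in `S` are nonzero on the line,
and at the point itself only `|S| - 1 = i - 1` of them. So `F^{i+1}` vanishes on the line, `F^i`
vanishes at the point, and among the `y_L` with `|L| = i` only `y_S` has a nonzero derivative. -/
theorem exists_tangent_evaluation {n i : ℕ} (hi : 1 ≤ i) (hin : i < n) (hn : 2 ≤ n) :
    ∃ (ρ : T n →ₐ[ℂ] Polynomial ℂ) (κ : ℂ), ρ (f n i) = Polynomial.X * Polynomial.C κ ∧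
      (∀ P, (ρ (perm n (firstSwap hn) P)).coeff 0 = (ρ P).coeff 0) ∧
      (∀ P ∈ FT n i, (ρ P).coeff 0 = 0) ∧ (∀ P ∈ FT n (i + 1), ρ P = 0) ∧
      ∀ u : Equiv.Perm (Fin n) → ℂ, ∃ P ∈ FT n i, ∀ σ, (ρ (perm n σ P)).coeff 1 = u σ := by
  classical
  set a₀ : Fin n := Fin.castLE hn 0 with ha₀
  set a₁ : Fin n := Fin.castLE hn 1 with ha₁
  have hv₀ : (a₀ : ℕ) = 0 := rfl
  have hv₁ : (a₁ : ℕ) = 1 := rfl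
  have hne : a₀ ≠ a₁ := fun h => by simpa [hv₀, hv₁] using congrArg Fin.val h
  -- With letters counted from zero, `S = {0, 2, …, i}`: it has `i` elements and contains exactly
  -- one of the two exchanged letters.
  let S : Finset (Fin n) := (Finset.Iic ⟨i, hin⟩).erase a₁
  have ha₁S : a₁ ∉ S := Finset.notMem_erase _ _
  have ha₀S : a₀ ∈ S := Finset.mem_erase.2 ⟨hne, Finset.mem_Iic.2 (Nat.zero_le _)⟩
  have hScard : S.card = i := by
    have h : a₁ ∈ Finset.Iic (⟨i, hin⟩ : Fin n) := Finset.mem_Iic.2 hi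
    rw [Finset.card_erase_of_mem h, Fin.card_Iic]; rfl
  -- The only coincidence of values is between the first two letters, where both are zero; this
  -- makes the point fixed by their transposition although only one of them lies in `S`.
  let v : Fin n → ℂ := fun k => if (k : ℕ) ≤ 1 then 0 else ((k : ℕ) : ℂ)
  have hvs : ∀ k l, v k = v l → k ≠ l → (k = a₀ ∧ l = a₁) ∨ (k = a₁ ∧ l = a₀) := by
    intro k l h hkl
    have hkl' : (k : ℕ) ≠ l := fun h => hkl (Fin.ext h)
    simp only [v] at h
    simp only [Fin.ext_iff, hv₀, hv₁]
    split_ifs at h with h1 h2 h2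
    · omega
    · exact absurd (Nat.cast_eq_zero.1 h.symm) (by omega)
    · exact absurd (Nat.cast_eq_zero.1 h) (by omega)
    · exact absurd (Nat.cast_injective h) hkl'
  have hva₀ : v a₀ = 0 := if_pos (by omega)
  have hva₁ : v a₁ = 0 := if_pos (by omega)
  have hv0 : ∀ k ∈ S, k ≠ a₀ → v k ≠ 0 := by
    intro k hk hk0 h
    rcases hvs k a₀ (h.trans hva₀.symm) hk0 with h | h
    · exact hk0 h.1
    · exact ha₁S (h.1 ▸ hk)
  let b : Fin n → Polynomial ℂ := fun k =>
    if k ∈ S then (if k = a₀ then Polynomial.X else Polynomial.C (v k)) else 0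
  let ρ : T n →ₐ[ℂ] Polynomial ℂ := liftT (fun k => if k ∈ S then 0 else Polynomial.C (v k)) b
    (fun k => by simp only [b]; split_ifs <;> simp)
  have hρx : ∀ k, ρ (x k) = if k ∈ S then 0 else Polynomial.C (v k) := liftT_x _ _ _
  have hρy : ∀ k, ρ (y k) = b k := liftT_y _ _ _
  let ε : T n →ₐ[ℂ] ℂ := (Polynomial.aeval 0).comp ρ
  have hε : ∀ P, ε P = (ρ P).coeff 0 := fun P => (Polynomial.coeff_zero_eq_aeval_zero _).symm
  have hεx : ∀ k, ε (x k) = if k ∈ S then 0 else v k := by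
    intro k; rw [hε, hρx]; split_ifs <;> simp
  have hεy : ∀ k, ε (y k) = if k ∈ S then v k else 0 := by
    intro k
    rw [hε, hρy]
    simp only [b]
    split_ifs with h1 h2
    · rw [h2, hva₀]; simp
    · simp
    · simp
  have hεs : ∀ P, ε (perm n (firstSwap hn) P) = ε P := by
    have h : ε.comp (perm n (firstSwap hn)) = ε := by
      have h0 : firstSwap hn a₀ = a₁ := Equiv.swap_apply_left _ _
      have h1 : firstSwap hn a₁ = a₀ := Equiv.swap_apply_right _ _
      have h2 : ∀ k, k ≠ a₀ → k ≠ a₁ → firstSwap hn k = k := fun k =>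
        Equiv.swap_apply_of_ne_of_ne
      refine algHom_ext (fun k => ?_) (fun k => ?_)
      · rw [AlgHom.comp_apply, perm_x, hεx, hεx]
        by_cases hk0 : k = a₀
        · rw [hk0, h0, if_neg ha₁S, if_pos ha₀S, hva₁]
        · by_cases hk1 : k = a₁
          · rw [hk1, h1, if_pos ha₀S, if_neg ha₁S, hva₁]
          · rw [h2 k hk0 hk1]
      · rw [AlgHom.comp_apply, perm_y, hεy, hεy]
        by_cases hk0 : k = a₀
        · rw [hk0, h0, if_neg ha₁S, if_pos ha₀S, hva₀]
        · by_cases hk1 : k = a₁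
          · rw [hk1, h1, if_pos ha₀S, if_neg ha₁S, hva₀]
          · rw [h2 k hk0 hk1]
    exact fun P => DFunLike.congr_fun h P
  let κ : ℂ := ∏ k ∈ S.erase a₀, v k
  have hκ : κ ≠ 0 := Finset.prod_ne_zero_iff.2 fun k hk =>
    hv0 k (Finset.mem_of_mem_erase hk) (Finset.ne_of_mem_erase hk)
  have hρS : ρ (yProd S) = Polynomial.X * Polynomial.C κ := by
    rw [yProd, map_prod, ← Finset.mul_prod_erase _ _ ha₀S, hρy, map_prod]
    congr 1
    · simp [b, ha₀S]
    · refine Finset.prod_congr rfl fun k hk => ?_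
      rw [hρy]
      simp only [b, if_pos (Finset.mem_of_mem_erase hk), if_neg (Finset.ne_of_mem_erase hk)]
  have hρL : ∀ L : Finset (Fin n), i ≤ L.card → L ≠ S → ρ (yProd L) = 0 := by
    intro L hL hLS
    have : ¬ L ⊆ S := fun h => hLS (Finset.eq_of_subset_of_card_le h (by rw [hScard]; exact hL))
    obtain ⟨k, hkL, hkS⟩ := Finset.not_subset.1 this
    rw [yProd, map_prod]
    exact Finset.prod_eq_zero hkL (by rw [hρy]; simp only [b, if_neg hkS])
  have hρf : ρ (f n i) = Polynomial.X * Polynomial.C κ := by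
    rw [f, map_sum, Finset.sum_eq_single S, hρS]
    · exact fun L hL hLS => hρL L (Finset.mem_powersetCard.1 hL).2.ge hLS
    · exact fun h => absurd (Finset.mem_powersetCard.2 ⟨Finset.subset_univ S, hScard⟩) h
  have hεF : ∀ P ∈ FT n i, ε P = 0 := by
    intro P hP
    induction hP using Submodule.span_induction with
    | mem P hP =>
      obtain ⟨L, hL, rfl⟩ := hP
      by_cases hLS : L = S
      · rw [hLS, hε, hρS]; simp
      · rw [hε, hρL L hL.ge hLS, Polynomial.coeff_zero]
    | zero => exact map_zero _
    | add P Q _ _ hP hQ => rw [map_add, hP, hQ, add_zero]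
    | smul a P _ hP => rw [smul_eq_mul, map_mul, hP, mul_zero]
  have hρF : ∀ P ∈ FT n (i + 1), ρ P = 0 := by
    intro P hP
    induction hP using Submodule.span_induction with
    | mem P hP =>
      obtain ⟨L, hL, rfl⟩ := hP
      exact hρL L (by omega) (by rintro rfl; omega)
    | zero => exact map_zero _
    | add P Q _ _ hP hQ => rw [map_add, hP, hQ, add_zero]
    | smul a P _ hP => rw [smul_eq_mul, map_mul, hP, mul_zero]
  have hDX : ∀ p : Polynomial ℂ, (Polynomial.X * Polynomial.C κ * p).coeff 1 = κ * p.coeff 0 := by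
    intro p
    rw [mul_assoc, Polynomial.coeff_X_mul, Polynomial.coeff_C_mul]
  refine ⟨ρ, κ, hρf, fun P => by rw [← hε, ← hε, hεs], fun P hP => by rw [← hε, hεF P hP], hρF,
    fun u => ?_⟩
  choose g hg1 hg0 using fun τ : Equiv.Perm (Fin n) => exists_interpolation v ε
    (fun k => by rw [hεx, hεy]; split_ifs <;> simp) τ⁻¹
  -- The factor `g τ` selects the orbit point of `τ`, and the translate of `y_S` separates the two
  -- permutations leading to that point; `κ⁻¹` normalizes the derivative of `y_S`.
  refine ⟨∑ τ, (u τ * κ⁻¹) • (yProd (S.map τ⁻¹.toEmbedding) * g τ), Ideal.sum_mem _ fun τ _ =>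
    ((FT n i).restrictScalars ℂ).smul_mem _ (Ideal.mul_mem_right _ _
      (yProd_mem_FT (by rw [Finset.card_map, hScard]))), ?_⟩
  intro σ
  have hperm : ∀ τ, perm n σ (yProd (S.map τ⁻¹.toEmbedding)) =
      yProd (S.map (σ * τ⁻¹).toEmbedding) := by
    intro τ
    rw [perm_yProd, Finset.map_map]
    rfl
  rw [map_sum, map_sum, Polynomial.finsetSum_coeff, Finset.sum_eq_single σ]
  · rw [map_smul, map_smul, Polynomial.coeff_smul, map_mul, hperm, mul_inv_cancel, map_mul]
    have hS1 : S.map (1 : Equiv.Perm (Fin n)).toEmbedding = S := Finset.map_refl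
    have hg := hg1 σ σ⁻¹ fun _ => rfl
    rw [inv_inv, hε] at hg
    rw [hS1, hρS, hDX, hg, smul_eq_mul]
    field_simp
  · intro τ _ hτ
    rw [map_smul, map_smul, Polynomial.coeff_smul, map_mul, hperm, map_mul]
    convert smul_zero _
    -- If `σ` and `τ` give the same point, `σ τ⁻¹` exchanges the first two letters, so the translate
    -- of `S` contains the second letter and its `y`-monomial is zero on the line. Otherwise both
    -- factors vanish at the point and their product has no linear term.
    by_cases hall : ∀ k, v (τ k) = v (σ k)
    · rw [hρL, zero_mul, Polynomial.coeff_zero]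
      · rw [Finset.card_map, hScard]
      · intro hS
        apply ha₁S
        rw [← hS]
        refine Finset.mem_map.2 ⟨a₀, ha₀S, ?_⟩
        have hm : ∀ m, v m = v ((σ * τ⁻¹) m) := by
          intro m
          have := hall (τ⁻¹ m)
          rwa [show τ (τ⁻¹ m) = m from τ.apply_symm_apply m] at this
        obtain ⟨m, hm2⟩ : ∃ m, m ≠ (σ * τ⁻¹) m := by
          by_contra hcon
          push Not at hcon
          have : σ * τ⁻¹ = 1 := Equiv.ext fun m => (hcon m).symm
          exact hτ (mul_inv_eq_one.1 this).symm
        rcases hvs _ _ (hm m) hm2 with ⟨h, h'⟩ | ⟨h, h'⟩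
        · rw [h] at h'; exact h'
        · by_contra hcon
          have h0 : a₀ ≠ (σ * τ⁻¹) a₀ := by
            intro h0
            rw [h] at h'
            exact hne ((σ * τ⁻¹).injective (h0.symm.trans h'.symm))
          rcases hvs a₀ _ (hm a₀) h0 with h4 | h4
          · exact hcon h4.2
          · exact hne h4.1
    · push Not at hall
      have hg := hg0 τ σ⁻¹ (by simpa using hall)
      rw [inv_inv, hε] at hg
      have h0 := hεF _ (yProd_mem_FT (S := S.map (σ * τ⁻¹).toEmbedding)
        (by rw [Finset.card_map, hScard]))
      rw [hε] at h0
      rw [Polynomial.mul_coeff_one, hg, h0, zero_mul, mul_zero, add_zero]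
  · exact fun h => absurd (Finset.mem_univ σ) h

/-- `D` records the derivatives along the orbit. Since `F^i` vanishes at the orbit points, Leibniz'
rule makes invariants act on `D` of `F^i` by their value at the point. The derivative of `f_i a` is
a multiple of the value of `a`, hence `firstSwap`-invariant, and it dies in the module induced from
the sign. -/
theorem exists_surjection_indSign {n i : ℕ} (hi : 1 ≤ i) (hin : i < n) (hn : 2 ≤ n) :
    ∃ Ψ : T n →ₗ[ℂ] Representation.IndV (inclS2 hn) signRep, (∀ P ∈ relIdeal n i, Ψ P = 0) ∧
      (∀ v, ∃ P ∈ FT n i, Ψ P = v) ∧ ∀ σ P, Ψ (perm n σ P) = indSign hn σ (Ψ P) := by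
  obtain ⟨ρ, κ, hρf, hεs, hεF, hρF, hu⟩ := exists_tangent_evaluation hi hin hn
  obtain ⟨D, hD⟩ : ∃ D : T n →ₗ[ℂ] (Equiv.Perm (Fin n) → ℂ),
      ∀ P σ, D P σ = (ρ (perm n σ P)).coeff 1 :=
    ⟨LinearMap.pi fun σ =>
      Polynomial.lcoeff ℂ 1 ∘ₗ ρ.toLinearMap ∘ₗ (perm n σ).toLinearMap, fun P σ => rfl⟩
  have hDX : ∀ p : Polynomial ℂ, (Polynomial.X * Polynomial.C κ * p).coeff 1 = κ * p.coeff 0 := by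
    intro p
    rw [mul_assoc, Polynomial.coeff_X_mul, Polynomial.coeff_C_mul]
  obtain ⟨Θ, hΘ⟩ : ∃ Θ : T n →ₗ[ℂ] Representation.IndV (inclS2 hn) signRep,
      ∀ P, Θ P = indSum hn (D P) := ⟨indSum hn ∘ₗ D, fun P => rfl⟩
  have hDf : ∀ a σ, D (f n i * a) σ = κ * (ρ (perm n σ a)).coeff 0 := by
    intro a σ
    rw [hD, map_mul, perm_f, map_mul, hρf, hDX]
  have hinv : ∀ a : T n, (∀ σ, perm n σ a = a) → ∃ c : ℂ, ∀ P ∈ FT n i, Θ (a * P) = c • Θ P := by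
    intro a ha
    refine ⟨(ρ a).coeff 0, fun P hP => ?_⟩
    rw [hΘ, hΘ, ← map_smul]
    congr 1
    funext σ
    have h0 := hεF _ (FT_stable n i σ hP)
    rw [hD, map_mul, ha, map_mul, Polynomial.mul_coeff_one, h0, mul_zero, add_zero,
      Pi.smul_apply, hD, smul_eq_mul]
  have hstab : ∀ σ, Ideal.span {f n i} ⊔ FT n (i + 1) ≤
      (Ideal.span {f n i} ⊔ FT n (i + 1)).comap (perm n σ) := by
    refine fun σ => sup_le ?_ ((FT_stable n (i + 1) σ).trans (Ideal.comap_mono le_sup_right))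
    rw [Ideal.span_le, Set.singleton_subset_iff, SetLike.mem_coe, Ideal.mem_comap, perm_f]
    exact Ideal.mem_sup_left (Ideal.mem_span_singleton_self _)
  have hsurj : ∀ w, ∃ P ∈ FT n i, Θ P = w := by
    intro w
    obtain ⟨u, rfl⟩ := indSum_surjective hn w
    obtain ⟨P, hP, hPu⟩ := hu u
    exact ⟨P, hP, by rw [hΘ]; exact congrArg _ (funext fun σ => (hD P σ).trans (hPu σ))⟩
  have hF0 : ∀ Q ∈ FT n (i + 1), Θ Q = 0 := by
    intro Q hQ
    have : D Q = 0 := funext fun σ => by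
      rw [hD, hρF _ (FT_stable n (i + 1) σ hQ), Polynomial.coeff_zero, Pi.zero_apply]
    rw [hΘ, this, map_zero]
  have hf0 : ∀ a, Θ (f n i * a) = 0 := by
    intro a
    rw [hΘ]
    exact indSum_eq_zero hn fun σ => by rw [hDf, hDf, ← perm_perm, hεs]
  have hzero : ∀ P ∈ Ideal.span {f n i} ⊔ FT n (i + 1), Θ P = 0 := by
    intro P hP
    obtain ⟨a, Q, hQ, rfl⟩ := Ideal.mem_span_singleton_sup.1 hP
    rw [map_add, hF0 Q hQ, add_zero, mul_comm, hf0]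
  obtain ⟨Ψ, h1, h2, h3⟩ := exists_degeneration_of_smul (FT n i)
    (Ideal.span {f n i} ⊔ FT n (i + 1)) (isHomogIdeal_FT i)
    (IsHomogIdeal.sup (isHomogIdeal_span (by rintro _ rfl; exact ⟨i, isHom_f i⟩))
      (isHomogIdeal_FT _)) (FT_stable n i)
    hstab Θ hsurj hzero (fun k => hinv _ (perm_e n k)) (fun k => hinv _ (perm_f n k))
  refine ⟨Ψ, h1, h2, h3 (fun σ => indSign hn σ) fun σ P => ?_⟩
  rw [hΘ, hΘ, indSign_indSum]
  congr 1
  funext τ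
  rw [hD, hD, perm_perm]

end DoublePoint

/-! ### Dimension counts for quotients of vector spaces -/

section LinearAlgebra

variable {K M N V : Type*} [Field K] [AddCommGroup M] [Module K M] [AddCommGroup N] [Module K N]
  [AddCommGroup V] [Module K V]

theorem exists_linearMap_of_ker_le {g : M →ₗ[K] N} (hg : Function.Surjective g) {h : M →ₗ[K] V}
    (hk : LinearMap.ker g ≤ LinearMap.ker h) : ∃ l : N →ₗ[K] V, ∀ m, l (g m) = h m := by
  refine ⟨(LinearMap.ker g).liftQ h hk ∘ₗ (g.quotKerEquivOfSurjective hg).symm.toLinearMap,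
    fun m => ?_⟩
  have : (g.quotKerEquivOfSurjective hg).symm (g m) = (LinearMap.ker g).mkQ m := by
    rw [LinearEquiv.symm_apply_eq]; rfl
  simp only [LinearMap.comp_apply, LinearEquiv.coe_coe, this]
  exact Submodule.liftQ_apply _ _ _

theorem finrank_le_of_surjective [FiniteDimensional K M] {g : M →ₗ[K] N}
    (hg : Function.Surjective g) : Module.finrank K N ≤ Module.finrank K M := by
  rw [← finrank_top, ← LinearMap.range_eq_top.2 hg]
  exact g.finrank_range_le

theorem finrank_quotient_add_finrank_map {A B : Submodule K M} (h : A ≤ B)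
    [FiniteDimensional K (M ⧸ A)] :
    Module.finrank K (M ⧸ B) + Module.finrank K (B.map A.mkQ) = Module.finrank K (M ⧸ A) := by
  rw [← (Submodule.quotientQuotientEquivQuotient A B h).finrank_eq]
  exact Submodule.finrank_quotient_add_finrank _

/-- `B / A` is the image of `C`, so a map on `C` that kills `C ∩ A` factors through it; surjectivity
then bounds `dim V` by `dim B / A`. -/
theorem finrank_quotient_add_le {A B C : Submodule K M} [FiniteDimensional K (M ⧸ A)]
    (h : B = A ⊔ C) {Ψ : C →ₗ[K] V} (hs : Function.Surjective Ψ)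
    (h0 : ∀ m : C, (m : M) ∈ A → Ψ m = 0) :
    FiniteDimensional K V ∧ Module.finrank K (M ⧸ B) + Module.finrank K V ≤ Module.finrank K (M ⧸ A) := by
  have hAB : A ≤ B := h ▸ le_sup_left
  have hCB : C ≤ B := h ▸ le_sup_right
  have hmap : B.map A.mkQ = C.map A.mkQ := by
    rw [h, Submodule.map_sup, Submodule.mkQ_map_self, bot_sup_eq]
  rw [← finrank_quotient_add_finrank_map hAB, hmap]
  have hg : Function.Surjective (A.mkQ.submoduleMap C) := A.mkQ.submoduleMap_surjective C
  obtain ⟨l, hl⟩ := exists_linearMap_of_ker_le hg (h := Ψ) (by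
    intro m hm
    have h1 : A.mkQ m = 0 := congrArg Subtype.val hm
    exact h0 m ((Submodule.Quotient.mk_eq_zero A).1 h1))
  have hl' : Function.Surjective l := fun v => by
    obtain ⟨m, rfl⟩ := hs v
    exact ⟨_, hl m⟩
  exact ⟨Module.Finite.of_surjective l hl',
    Nat.add_le_add_left (finrank_le_of_surjective hl') _⟩

theorem exists_finrank_eq_sup_eq_top (A : Submodule K M) [FiniteDimensional K (M ⧸ A)] :
    ∃ W : Submodule K M, FiniteDimensional K W ∧
      Module.finrank K W = Module.finrank K (M ⧸ A) ∧ W ⊔ A = ⊤ := by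
  obtain ⟨W, hW⟩ := Submodule.exists_isCompl A
  have e := Submodule.quotientEquivOfIsCompl A W hW
  exact ⟨W, Module.Finite.equiv e, e.finrank_eq.symm, hW.symm.sup_eq_top⟩

end LinearAlgebra

/-! ### Dimensions of the quotients of the coinvariant algebra by its filtration -/

namespace DoublePoint

/-- The subspace of `A^{⊗ n}` whose quotient is `R_n / F^p R_n`. -/
def filtSubmodule (n p : ℕ) : Submodule ℂ (T n) := (elemIdeal n ⊔ FT n p).restrictScalars ℂ

theorem mem_filtSubmodule {n p : ℕ} {P : T n} :
    P ∈ filtSubmodule n p ↔ P ∈ elemIdeal n ⊔ FT n p := Iff.rfl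

theorem filtSubmodule_antitone {n p q : ℕ} (h : p ≤ q) : filtSubmodule n q ≤ filtSubmodule n p :=
  fun _ hP => (sup_le_sup_left (FT_antitone h) _ : elemIdeal n ⊔ FT n q ≤ elemIdeal n ⊔ FT n p) hP

theorem filtSubmodule_eq_sup (n p : ℕ) :
    filtSubmodule n p = filtSubmodule n (p + 1) ⊔ (FT n p).restrictScalars ℂ := by
  apply le_antisymm
  · intro P hP
    obtain ⟨Q, hQ, Q', hQ', rfl⟩ := Submodule.mem_sup.1 (mem_filtSubmodule.1 hP)
    exact Submodule.add_mem_sup (mem_filtSubmodule.2 (Ideal.mem_sup_left hQ)) hQ'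
  · exact sup_le (filtSubmodule_antitone (Nat.le_succ p)) fun P hP =>
      mem_filtSubmodule.2 (Ideal.mem_sup_right hP)

/-- `J_n + F^{i+1}` is contained in `I_{n-i,i+1}`, so the intersection bound for the latter
identifies the relations of `gr^i R_n`. Maps killing `relIdeal` therefore descend to `gr^i R_n`. -/
theorem FT_inf_sup_le {n i : ℕ} (hi : 1 ≤ i) (hin : i < n) :
    FT n i ⊓ (elemIdeal n ⊔ FT n (i + 1)) ≤ relIdeal n i :=
  (inf_le_inf_left _ (sup_le (elemIdeal_le_gI _ _ _) (FT_le_gI _ _ _))).trans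
    (FT_inf_gI_le hi hin)

theorem finiteDimensional_quotient_filtSubmodule {n p q : ℕ} (h : p ≤ q)
    [FiniteDimensional ℂ (T n ⧸ filtSubmodule n q)] :
    FiniteDimensional ℂ (T n ⧸ filtSubmodule n p) :=
  Module.Finite.of_surjective (Submodule.factor (filtSubmodule_antitone h))
    (Submodule.factor_surjective _)

theorem factorial_add_two_mul_finrank_le {n i : ℕ} (hi : 1 ≤ i) (hin : i < n)
    [FiniteDimensional ℂ (T n ⧸ filtSubmodule n (i + 1))] :
    n.factorial + 2 * Module.finrank ℂ (T n ⧸ filtSubmodule n i) ≤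
      2 * Module.finrank ℂ (T n ⧸ filtSubmodule n (i + 1)) := by
  have hn : 2 ≤ n := by omega
  obtain ⟨Ψ, h0, hs, -⟩ := exists_surjection_indSign hi hin hn
  have h := finrank_quotient_add_le (A := filtSubmodule n (i + 1)) (B := filtSubmodule n i)
    (C := (FT n i).restrictScalars ℂ) (filtSubmodule_eq_sup n i)
    (Ψ := Ψ.domRestrict ((FT n i).restrictScalars ℂ))
    (fun v => by obtain ⟨P, hP, rfl⟩ := hs v; exact ⟨⟨P, hP⟩, rfl⟩)
    (fun P hP => h0 P (FT_inf_sup_le hi hin ⟨P.2, hP⟩))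
  have h1 := h.2
  have h2 := factorial_le_two_mul_finrank hn
  omega

theorem factorial_le_finrank (n : ℕ) [FiniteDimensional ℂ (T n ⧸ filtSubmodule n 1)] :
    n.factorial ≤ Module.finrank ℂ (T n ⧸ filtSubmodule n 1) := by
  obtain ⟨Ψ, h0, hs⟩ := exists_surjection_degree_zero n
  have h := finrank_quotient_add_le (A := filtSubmodule n 1) (B := ⊤) (C := ⊤)
    (sup_top_eq _).symm (Ψ := Ψ.domRestrict ⊤)
    (fun v => by obtain ⟨P, rfl⟩ := hs v; exact ⟨⟨P, trivial⟩, rfl⟩)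
    (fun P hP => h0 P (by rw [sup_comm]; exact hP))
  replace h := h.2
  rw [Module.finrank_fintype_fun_eq_card, Fintype.card_perm, Fintype.card_fin] at h
  omega

theorem succ_mul_factorial_le {n p : ℕ} (hp : 1 ≤ p) (hpn : p ≤ n)
    (hfd : FiniteDimensional ℂ (T n ⧸ filtSubmodule n p)) :
    (p + 1) * n.factorial ≤ 2 * Module.finrank ℂ (T n ⧸ filtSubmodule n p) := by
  revert hpn hfd
  induction p, hp using Nat.le_induction with
  | base =>
    intro _ _
    have := factorial_le_finrank n
    omega
  | succ p hp ih =>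
    intro hpn hfd
    have hfd' := finiteDimensional_quotient_filtSubmodule (n := n) (Nat.le_succ p)
    have h1 := factorial_add_two_mul_finrank_le (n := n) hp hpn
    have h2 := ih (by omega) hfd'
    linarith [add_mul (p + 1) 1 n.factorial]

/-- Starting from the total and descending, each layer removes at least `n!/2`, so lower bounds on
the layers become upper bounds on the smaller quotients. -/
theorem two_mul_finrank_le_of_total {n p : ℕ} (hp : 1 ≤ p) (hpn : p ≤ n)
    [FiniteDimensional ℂ (T n ⧸ filtSubmodule n n)]
    (h : 2 * Module.finrank ℂ (T n ⧸ filtSubmodule n n) ≤ (n + 1).factorial) :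
    2 * Module.finrank ℂ (T n ⧸ filtSubmodule n p) ≤ (p + 1) * n.factorial := by
  induction hpn using Nat.decreasingInduction with
  | self => rwa [Nat.factorial_succ] at h
  | of_succ p hpn ih =>
    have hfd' := finiteDimensional_quotient_filtSubmodule (n := n) (Nat.succ_le_of_lt hpn)
    have h1 := factorial_add_two_mul_finrank_le (n := n) hp hpn
    have h2 := ih (by omega)
    linarith [add_mul (p + 1) 1 n.factorial]

/-! ### Exchanging `x` and `y` -/

/-- The automorphism of `A^{⊗ n}` that exchanges the `x_k` with the `y_k`. -/
def swapXY (n : ℕ) : T n →ₐ[ℂ] T n := liftT y x fun k => by rw [mul_comm, x_mul_y]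

theorem swapXY_x {n : ℕ} (k : Fin n) : swapXY n (x k) = y k := liftT_x _ _ _ k

theorem swapXY_y {n : ℕ} (k : Fin n) : swapXY n (y k) = x k := liftT_y _ _ _ k

theorem swapXY_swapXY {n : ℕ} (P : T n) : swapXY n (swapXY n P) = P := by
  rw [← AlgHom.comp_apply, show (swapXY n).comp (swapXY n) = AlgHom.id ℂ (T n) from
    algHom_ext (fun k => by simp [swapXY_x, swapXY_y]) fun k => by simp [swapXY_x, swapXY_y],
    AlgHom.id_apply]

theorem swapXY_yProd {n : ℕ} (S : Finset (Fin n)) : swapXY n (yProd S) = xProd S := by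
  simp only [yProd, xProd, map_prod, swapXY_y]

theorem swapXY_e (n k : ℕ) : swapXY n (e n k) = f n k := by
  simp only [e_eq_elemSymm, f_eq_elemSymm, map_elemSymm, swapXY_x]

theorem swapXY_f (n k : ℕ) : swapXY n (f n k) = e n k := by
  simp only [e_eq_elemSymm, f_eq_elemSymm, map_elemSymm, swapXY_y]

theorem swapXY_mem_elemIdeal {n : ℕ} {P : T n} (hP : P ∈ elemIdeal n) :
    swapXY n P ∈ elemIdeal n := by
  have h : elemIdeal n ≤ (elemIdeal n).comap (swapXY n) := by
    refine Ideal.span_le.2 ?_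
    rintro _ (⟨k, hk, rfl⟩ | ⟨k, hk, rfl⟩)
    · rw [SetLike.mem_coe, Ideal.mem_comap, swapXY_e]; exact f_mem hk
    · rw [SetLike.mem_coe, Ideal.mem_comap, swapXY_f]; exact e_mem hk
  exact h hP

/-! ### Small complements -/

/-- The bound `2 dim (R_n / F^n R_n) ≤ (n + 1)!`; in fact `F^n R_n = 0`. -/
def DimBound (n : ℕ) : Prop :=
  FiniteDimensional ℂ (T n ⧸ filtSubmodule n n) ∧
    2 * Module.finrank ℂ (T n ⧸ filtSubmodule n n) ≤ (n + 1).factorial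

theorem DimBound.exists_complement {n p : ℕ} (h : DimBound n) (hp : 1 ≤ p) (hpn : p ≤ n) :
    ∃ W : Submodule ℂ (T n), FiniteDimensional ℂ W ∧
      2 * Module.finrank ℂ W ≤ (p + 1) * n.factorial ∧
      ∀ Q, ∃ w ∈ W, ∃ j ∈ elemIdeal n, ∃ r ∈ FT n p, Q = w + j + r := by
  have hfd := h.1
  have hfd' := finiteDimensional_quotient_filtSubmodule (n := n) hpn
  obtain ⟨W, hW, hWd, hWs⟩ := exists_finrank_eq_sup_eq_top (filtSubmodule n p)
  refine ⟨W, hW, hWd ▸ two_mul_finrank_le_of_total hp hpn h.2, fun Q => ?_⟩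
  obtain ⟨w, hw, P, hP, rfl⟩ := Submodule.mem_sup.1 (hWs ▸ Submodule.mem_top : Q ∈ W ⊔ _)
  obtain ⟨j, hj, r, hr, rfl⟩ := Submodule.mem_sup.1 (mem_filtSubmodule.1 hP)
  exact ⟨w, hw, j, hj, r, hr, (add_assoc _ _ _).symm⟩

theorem DimBound.exists_complement_swapXY {n p : ℕ} (h : DimBound n) (hp : 1 ≤ p) (hpn : p ≤ n) :
    ∃ W : Submodule ℂ (T n), FiniteDimensional ℂ W ∧
      2 * Module.finrank ℂ W ≤ (p + 1) * n.factorial ∧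
      ∀ Q, ∃ w ∈ W, ∃ j ∈ elemIdeal n, ∃ r ∈ FT n p, Q = w + j + swapXY n r := by
  obtain ⟨W, hW, hWd, hWs⟩ := h.exists_complement hp hpn
  refine ⟨W.map (swapXY n).toLinearMap, inferInstance,
    (Nat.mul_le_mul_left 2 (Submodule.finrank_map_le _ _)).trans hWd, fun Q => ?_⟩
  obtain ⟨w, hw, j, hj, r, hr, hQ⟩ := hWs (swapXY n Q)
  refine ⟨swapXY n w, ⟨w, hw, rfl⟩, swapXY n j, swapXY_mem_elemIdeal hj, r, hr, ?_⟩
  rw [← swapXY_swapXY Q, hQ, map_add, map_add]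

theorem mul_map_mem_of_mem_FT {n p : ℕ} {S : Type*} [CommRing S] (g : T n →+* S) {c : S}
    {K : Ideal S} (h : ∀ s : Finset (Fin n), s.card = p → c * g (yProd s) ∈ K) {r : T n}
    (hr : r ∈ FT n p) : c * g r ∈ K := by
  induction hr using Submodule.span_induction with
  | mem P hP => obtain ⟨s, hs, rfl⟩ := hP; exact h s hs
  | zero => rw [map_zero, mul_zero]; exact K.zero_mem
  | add P Q _ _ hP hQ => rw [map_add, mul_add]; exact K.add_mem hP hQ
  | smul a P _ hP =>
    rw [smul_eq_mul, map_mul, mul_left_comm]; exact K.mul_mem_left _ hP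

theorem mul_map_mem_of_mem_elemIdeal {n : ℕ} {S : Type*} [CommRing S] (g : T n →+* S) {c : S}
    {K : Ideal S} (he : ∀ l, 1 ≤ l → c * g (e n l) ∈ K) (hf : ∀ l, 1 ≤ l → c * g (f n l) ∈ K)
    {r : T n} (hr : r ∈ elemIdeal n) : c * g r ∈ K := by
  induction hr using Submodule.span_induction with
  | mem P hP =>
    obtain ⟨k, hk, rfl⟩ | ⟨k, hk, rfl⟩ := hP
    exacts [he k hk, hf k hk]
  | zero => rw [map_zero, mul_zero]; exact K.zero_mem
  | add P Q _ _ hP hQ => rw [map_add, mul_add]; exact K.add_mem hP hQ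
  | smul a P _ hP =>
    rw [smul_eq_mul, map_mul, mul_left_comm]; exact K.mul_mem_left _ hP

/-! ### Adding a letter -/

/-- The inclusion of `A^{⊗ m}` in `A^{⊗ (m + 1)}` as the first `m` factors. -/
def inclT (m : ℕ) : T m →ₐ[ℂ] T (m + 1) :=
  liftT (fun k => x k.castSucc) (fun k => y k.castSucc) fun _ => x_mul_y _

theorem inclT_x {m : ℕ} (k : Fin m) : inclT m (x k) = x k.castSucc := liftT_x _ _ _ k

theorem inclT_y {m : ℕ} (k : Fin m) : inclT m (y k) = y k.castSucc := liftT_y _ _ _ k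

theorem elemSymm_univ_castSucc {m : ℕ} {S : Type*} [CommRing S] (u : Fin (m + 1) → S) (k : ℕ) :
    elemSymm Finset.univ u (k + 1) = elemSymm Finset.univ (fun l : Fin m => u l.castSucc) (k + 1) +
      u (Fin.last m) * elemSymm Finset.univ (fun l : Fin m => u l.castSucc) k := by
  rw [Fin.univ_castSuccEmb, Finset.cons_eq_insert, elemSymm_insert (by simp), elemSymm_map,
    elemSymm_map]
  rfl

theorem e_succ (m k : ℕ) :
    e (m + 1) (k + 1) = inclT m (e m (k + 1)) + x (Fin.last m) * inclT m (e m k) := by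
  simp only [e_eq_elemSymm, map_elemSymm, inclT_x]
  exact elemSymm_univ_castSucc x k

theorem f_succ (m k : ℕ) :
    f (m + 1) (k + 1) = inclT m (f m (k + 1)) + y (Fin.last m) * inclT m (f m k) := by
  simp only [f_eq_elemSymm, map_elemSymm, inclT_y]
  exact elemSymm_univ_castSucc y k

theorem e_zero (m : ℕ) : e m 0 = 1 := elemSymm_zero _ _

theorem f_zero (m : ℕ) : f m 0 = 1 := elemSymm_zero _ _

/-- Modulo the ideal, the generating polynomial of the first `m` letters is inverse to `1 + x_last
t`, so its coefficients are the powers of `-x_last`. -/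
theorem neg_x_last_pow_sub_mem (m k : ℕ) :
    (-x (Fin.last m)) ^ k - inclT m (e m k) ∈ elemIdeal (m + 1) := by
  induction k with
  | zero => rw [e_zero, map_one, pow_zero, sub_self]; exact Ideal.zero_mem _
  | succ k ih =>
    have h := Ideal.add_mem _ (Ideal.mul_mem_left _ (-x (Fin.last m)) ih)
      (Ideal.neg_mem_iff _ |>.2 (e_mem (n := m + 1) (Nat.succ_pos k)))
    rw [e_succ] at h
    convert h using 1
    ring

theorem neg_y_last_pow_sub_mem (m k : ℕ) :
    (-y (Fin.last m)) ^ k - inclT m (f m k) ∈ elemIdeal (m + 1) := by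
  induction k with
  | zero => rw [f_zero, map_one, pow_zero, sub_self]; exact Ideal.zero_mem _
  | succ k ih =>
    have h := Ideal.add_mem _ (Ideal.mul_mem_left _ (-y (Fin.last m)) ih)
      (Ideal.neg_mem_iff _ |>.2 (f_mem (n := m + 1) (Nat.succ_pos k)))
    rw [f_succ] at h
    convert h using 1
    ring

theorem exists_eq_inclT_add {m : ℕ} (P : T (m + 1)) :
    ∃ Q B C, P = inclT m Q + x (Fin.last m) * B + y (Fin.last m) * C := by
  induction P using T_induction with
  | hC c => exact ⟨algebraMap ℂ _ c, 0, 0, by simp⟩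
  | hadd P P' hP hP' =>
    obtain ⟨Q, B, C, rfl⟩ := hP
    obtain ⟨Q', B', C', rfl⟩ := hP'
    exact ⟨Q + Q', B + B', C + C', by rw [map_add]; ring⟩
  | hmul P P' hP hP' =>
    obtain ⟨Q, B, C, rfl⟩ := hP
    obtain ⟨Q', B', C', rfl⟩ := hP'
    refine ⟨Q * Q', inclT m Q * B' + B * (inclT m Q' + x (Fin.last m) * B' + y (Fin.last m) * C'),
      inclT m Q * C' + C * (inclT m Q' + x (Fin.last m) * B' + y (Fin.last m) * C'), ?_⟩
    rw [map_mul]; ring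
  | hx k =>
    induction k using Fin.lastCases with
    | last => exact ⟨0, 1, 0, by simp⟩
    | cast k => exact ⟨x k, 0, 0, by simp [inclT_x]⟩
  | hy k =>
    induction k using Fin.lastCases with
    | last => exact ⟨0, 0, 1, by simp⟩
    | cast k => exact ⟨y k, 0, 0, by simp [inclT_y]⟩

theorem x_last_pow_mul_mem {m k : ℕ} {P : T (m + 1)} {K : Ideal (T (m + 1))}
    (hK : elemIdeal (m + 1) ≤ K) (h : inclT m (e m k) * P ∈ K) :
    x (Fin.last m) ^ k * P ∈ K := by
  have h1 := K.mul_mem_left ((-1) ^ k) (K.add_mem (K.mul_mem_right P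
    (hK (neg_x_last_pow_sub_mem m k))) h)
  rwa [sub_mul, sub_add_cancel, ← mul_assoc, ← mul_pow, neg_one_mul, neg_neg] at h1

theorem y_last_pow_mul_mem {m k : ℕ} {P : T (m + 1)} {K : Ideal (T (m + 1))}
    (hK : elemIdeal (m + 1) ≤ K) (h : inclT m (f m k) * P ∈ K) :
    y (Fin.last m) ^ k * P ∈ K := by
  have h1 := K.mul_mem_left ((-1) ^ k) (K.add_mem (K.mul_mem_right P
    (hK (neg_y_last_pow_sub_mem m k))) h)
  rwa [sub_mul, sub_add_cancel, ← mul_assoc, ← mul_pow, neg_one_mul, neg_neg] at h1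

theorem x_last_pow_mem (m : ℕ) : x (Fin.last m) ^ (m + 1) ∈ elemIdeal (m + 1) := by
  rw [← mul_one (x (Fin.last m) ^ (m + 1))]
  exact x_last_pow_mul_mem le_rfl (by simp [e_eq_zero (Nat.lt_succ_self m)])

theorem y_last_pow_mem (m : ℕ) : y (Fin.last m) ^ (m + 1) ∈ elemIdeal (m + 1) := by
  rw [← mul_one (y (Fin.last m) ^ (m + 1))]
  exact y_last_pow_mul_mem le_rfl (by simp [f_eq_zero (Nat.lt_succ_self m)])

theorem not_disjoint_of_card_lt {n : ℕ} {I S : Finset (Fin n)} (h : n < I.card + S.card) :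
    ¬ Disjoint I S := by
  intro hd
  have := Finset.card_le_univ (I ∪ S)
  rw [Finset.card_union_of_disjoint hd, Fintype.card_fin] at this
  omega

theorem e_mul_yProd_eq_zero {n k : ℕ} {S : Finset (Fin n)} (h : n < k + S.card) :
    e n k * yProd S = 0 := by
  rw [e, Finset.sum_mul]
  refine Finset.sum_eq_zero fun I hI => xProd_mul_yProd (not_disjoint_of_card_lt ?_)
  rwa [(Finset.mem_powersetCard.1 hI).2]

theorem f_mul_xProd_eq_zero {n k : ℕ} {S : Finset (Fin n)} (h : n < k + S.card) :
    f n k * xProd S = 0 := by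
  rw [f, Finset.sum_mul]
  refine Finset.sum_eq_zero fun I hI => ?_
  rw [mul_comm]
  refine xProd_mul_yProd (not_disjoint_of_card_lt ?_)
  rwa [(Finset.mem_powersetCard.1 hI).2, add_comm]

/-- Disjointness leaves a single term. With `e_mul_yProd` this gives `e_k y_S = x_{Sᶜ} f_{|S|}` when
`k + |S| = n`, which trades a multiple of `y_S` for a multiple of a symmetric polynomial in `y`. -/
theorem xProd_compl_mul_f {n : ℕ} (S : Finset (Fin n)) :
    xProd Sᶜ * f n S.card = xProd Sᶜ * yProd S := by
  rw [f, Finset.mul_sum, Finset.sum_eq_single S]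
  · intro I hI hne
    refine xProd_mul_yProd fun hd => hne ?_
    refine Finset.eq_of_subset_of_card_le (fun k hk => ?_) (Finset.mem_powersetCard.1 hI).2.ge
    by_contra hkS
    exact Finset.disjoint_left.1 hd (Finset.mem_compl.2 hkS) hk
  · exact fun h => absurd (Finset.mem_powersetCard.2 ⟨Finset.subset_univ _, rfl⟩) h

theorem e_mul_yProd {n k : ℕ} {S : Finset (Fin n)} (h : k + S.card = n) :
    e n k * yProd S = xProd Sᶜ * yProd S := by
  have hc : Sᶜ.card = k := by rw [Finset.card_compl, Fintype.card_fin]; omega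
  rw [e, Finset.sum_mul, Finset.sum_eq_single Sᶜ]
  · intro I hI hne
    refine xProd_mul_yProd fun hd => hne ?_
    refine Finset.eq_of_subset_of_card_le (fun k hk => ?_)
      ((Finset.mem_powersetCard.1 hI).2.trans hc.symm).ge
    exact Finset.mem_compl.2 fun hkS => Finset.disjoint_left.1 hd hk hkS
  · exact fun h => absurd (Finset.mem_powersetCard.2 ⟨Finset.subset_univ _, hc⟩) h

theorem inclT_e_mem (m : ℕ) {k : ℕ} (hk : 1 ≤ k) :
    inclT m (e m k) ∈ elemIdeal (m + 1) ⊔ Ideal.span {x (Fin.last m)} := by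
  obtain ⟨k, rfl⟩ := Nat.exists_eq_succ_of_ne_zero (by omega : k ≠ 0)
  rw [Nat.succ_eq_add_one, ← sub_eq_iff_eq_add.2 (e_succ m k), sub_eq_add_neg]
  exact Submodule.add_mem_sup (e_mem hk) (Ideal.neg_mem_iff _ |>.2
    (Ideal.mul_mem_right _ _ (Ideal.mem_span_singleton_self _)))

theorem inclT_f_mem (m : ℕ) {k : ℕ} (hk : 1 ≤ k) :
    inclT m (f m k) ∈ elemIdeal (m + 1) ⊔ Ideal.span {y (Fin.last m)} := by
  obtain ⟨k, rfl⟩ := Nat.exists_eq_succ_of_ne_zero (by omega : k ≠ 0)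
  rw [Nat.succ_eq_add_one, ← sub_eq_iff_eq_add.2 (f_succ m k), sub_eq_add_neg]
  exact Submodule.add_mem_sup (f_mem hk) (Ideal.neg_mem_iff _ |>.2
    (Ideal.mul_mem_right _ _ (Ideal.mem_span_singleton_self _)))

/-- An elementary symmetric polynomial of the first `m` letters is a multiple of `x_last` or
`y_last` modulo the larger ideal. The first kind is killed by `y_last ^ b`, for which `b ≥ 1` is
needed; the second raises the power. -/
theorem y_last_pow_mul_inclT_mem {m b : ℕ} (hb : 1 ≤ b) {j : T m} (hj : j ∈ elemIdeal m) :
    y (Fin.last m) ^ b * inclT m j ∈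
      elemIdeal (m + 1) ⊔ Ideal.span {y (Fin.last m) ^ (b + 1)} := by
  refine mul_map_mem_of_mem_elemIdeal (inclT m).toRingHom (fun k hk => ?_) (fun k hk => ?_) hj
  · obtain ⟨P, hP, Q, hQ, h⟩ := Submodule.mem_sup.1 (inclT_e_mem m hk)
    obtain ⟨a, rfl⟩ := Ideal.mem_span_singleton'.1 hQ
    obtain ⟨b, rfl⟩ := Nat.exists_eq_add_of_le' hb
    show _ * inclT m (e m k) ∈ _
    rw [← h, mul_add, show y (Fin.last m) ^ (b + 1) * (a * x (Fin.last m)) = 0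
      by linear_combination y (Fin.last m) ^ b * a * x_mul_y (Fin.last m), add_zero]
    exact Ideal.mem_sup_left (Ideal.mul_mem_left _ _ hP)
  · obtain ⟨P, hP, Q, hQ, h⟩ := Submodule.mem_sup.1 (inclT_f_mem m hk)
    obtain ⟨a, rfl⟩ := Ideal.mem_span_singleton'.1 hQ
    show _ * inclT m (f m k) ∈ _
    rw [← h, mul_add]
    refine Submodule.add_mem_sup (Ideal.mul_mem_left _ _ hP) ?_
    exact Ideal.mem_span_singleton'.2 ⟨a, by ring⟩

theorem x_last_pow_mul_inclT_mem {m a : ℕ} {j : T m} (hj : j ∈ elemIdeal m) :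
    x (Fin.last m) ^ a * inclT m j ∈ elemIdeal (m + 1) ⊔ Ideal.span {y (Fin.last m)} ⊔
      Ideal.span {x (Fin.last m) ^ (a + 1)} := by
  refine mul_map_mem_of_mem_elemIdeal (inclT m).toRingHom (fun k hk => ?_) (fun k hk => ?_) hj
  · obtain ⟨P, hP, Q, hQ, h⟩ := Submodule.mem_sup.1 (inclT_e_mem m hk)
    obtain ⟨c, rfl⟩ := Ideal.mem_span_singleton'.1 hQ
    show _ * inclT m (e m k) ∈ _
    rw [← h, mul_add]
    refine Submodule.add_mem_sup (Ideal.mem_sup_left (Ideal.mul_mem_left _ _ hP)) ?_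
    exact Ideal.mem_span_singleton'.2 ⟨c, by ring⟩
  · exact Ideal.mem_sup_left (Ideal.mul_mem_left _ _ (inclT_f_mem m hk))

/-- Replace `x_last ^ a` by `± e_a` of the first letters. Either `e_a y_S = 0` for reasons of size,
or `e_a y_S` is a multiple of `f_{|S|}`, which lies in the ideal because `|S| ≥ 1`; this is the
reason for the maximum with `1`. -/
theorem x_last_pow_mul_inclT_yProd_mem {m a : ℕ} {S : Finset (Fin m)}
    (hS : S.card = max 1 (m - a)) : x (Fin.last m) ^ a * inclT m (yProd S) ∈
      elemIdeal (m + 1) ⊔ Ideal.span {y (Fin.last m)} := by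
  refine x_last_pow_mul_mem le_sup_left ?_
  rw [← map_mul]
  rcases Nat.lt_or_ge m (a + S.card) with h | h
  · rw [e_mul_yProd_eq_zero h, map_zero]
    exact Ideal.zero_mem _
  · rw [e_mul_yProd (by omega), ← xProd_compl_mul_f, map_mul]
    exact Ideal.mul_mem_left _ _ (inclT_f_mem m (by omega))

theorem y_last_pow_mul_inclT_xProd_mem {m b : ℕ} {S : Finset (Fin m)}
    (hS : m < b + S.card) : y (Fin.last m) ^ b * inclT m (xProd S) ∈ elemIdeal (m + 1) := by
  refine y_last_pow_mul_mem le_rfl ?_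
  rw [← map_mul, f_mul_xProd_eq_zero hS, map_zero]
  exact Ideal.zero_mem _

/-- The layer between `y_last ^ b` and `y_last ^ (b + 1)` is spanned by a complement in the first
`m` letters. The filtration there is the one by `x`-monomials, since `f_b x_S = 0` for `|S| = m + 1
- b`; hence the exchange of `x` and `y`. -/
theorem exists_y_last_pow_mul_sub_mem {m b : ℕ} (hb : 1 ≤ b) {W : Submodule ℂ (T m)}
    (hW : ∀ Q, ∃ w ∈ W, ∃ j ∈ elemIdeal m, ∃ r ∈ FT m (m + 1 - b), Q = w + j + swapXY m r)
    (P : T (m + 1)) : ∃ w ∈ W, y (Fin.last m) ^ b * P - y (Fin.last m) ^ b * inclT m w ∈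
      elemIdeal (m + 1) ⊔ Ideal.span {y (Fin.last m) ^ (b + 1)} := by
  obtain ⟨Q, B, C, rfl⟩ := exists_eq_inclT_add P
  obtain ⟨w, hw, j, hj, r, hr, rfl⟩ := hW Q
  refine ⟨w, hw, ?_⟩
  have hB : y (Fin.last m) ^ b * (x (Fin.last m) * B) = 0 := by
    obtain ⟨b, rfl⟩ := Nat.exists_eq_add_of_le' hb
    linear_combination y (Fin.last m) ^ b * B * x_mul_y (Fin.last m)
  have hC : y (Fin.last m) ^ b * (y (Fin.last m) * C) ∈
      Ideal.span {y (Fin.last m) ^ (b + 1)} := Ideal.mem_span_singleton'.2 ⟨C, by ring⟩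
  have hr' : y (Fin.last m) ^ b * inclT m (swapXY m r) ∈ elemIdeal (m + 1) := by
    refine mul_map_mem_of_mem_FT ((inclT m).comp (swapXY m)).toRingHom (fun S hS => ?_) hr
    show _ * inclT m (swapXY m (yProd S)) ∈ _
    rw [swapXY_yProd]
    exact y_last_pow_mul_inclT_xProd_mem (by omega)
  have := Ideal.add_mem _ (Ideal.add_mem _ (y_last_pow_mul_inclT_mem hb hj)
    (Ideal.mem_sup_left hr')) (Ideal.mem_sup_right hC)
  convert this using 1
  rw [map_add, map_add, mul_add, mul_add, hB]
  ring

theorem exists_x_last_pow_mul_sub_mem {m a : ℕ} {W : Submodule ℂ (T m)}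
    (hW : ∀ Q, ∃ w ∈ W, ∃ j ∈ elemIdeal m, ∃ r ∈ FT m (max 1 (m - a)), Q = w + j + r)
    (P : T (m + 1)) : ∃ w ∈ W, x (Fin.last m) ^ a * P - x (Fin.last m) ^ a * inclT m w ∈
      elemIdeal (m + 1) ⊔ Ideal.span {y (Fin.last m)} ⊔
        Ideal.span {x (Fin.last m) ^ (a + 1)} := by
  obtain ⟨Q, B, C, rfl⟩ := exists_eq_inclT_add P
  obtain ⟨w, hw, j, hj, r, hr, rfl⟩ := hW Q
  refine ⟨w, hw, ?_⟩
  have hB : x (Fin.last m) ^ a * (x (Fin.last m) * B) ∈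
      Ideal.span {x (Fin.last m) ^ (a + 1)} := Ideal.mem_span_singleton'.2 ⟨B, by ring⟩
  have hC : x (Fin.last m) ^ a * (y (Fin.last m) * C) ∈
      Ideal.span {y (Fin.last m)} :=
    Ideal.mem_span_singleton'.2 ⟨x (Fin.last m) ^ a * C, by ring⟩
  have hr' : x (Fin.last m) ^ a * inclT m r ∈ elemIdeal (m + 1) ⊔ Ideal.span {y (Fin.last m)} :=
    mul_map_mem_of_mem_FT (inclT m).toRingHom
      (fun S hS => x_last_pow_mul_inclT_yProd_mem hS) hr
  have := Ideal.add_mem _ (Ideal.add_mem _ (x_last_pow_mul_inclT_mem (a := a) hj)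
    (Ideal.mem_sup_left (Ideal.add_mem _ hr' (Ideal.mem_sup_right hC)))) (Ideal.mem_sup_right hB)
  convert this using 1
  rw [map_add, map_add]
  ring

theorem sup_span_singleton_le {m : ℕ} {K : Ideal (T (m + 1))} {c : T (m + 1)}
    {W : Submodule ℂ (T m)} (h : ∀ P, ∃ w ∈ W, c * P - c * inclT m w ∈ K)
    {S : Submodule ℂ (T (m + 1))} (hK : ∀ P ∈ K, P ∈ S) (hW : ∀ w ∈ W, c * inclT m w ∈ S)
    {L : Ideal (T (m + 1))} (hL : L ≤ K) : ∀ P ∈ L ⊔ Ideal.span {c}, P ∈ S := by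
  intro P hP
  obtain ⟨Q, hQ, Q', hQ', rfl⟩ := Submodule.mem_sup.1 hP
  obtain ⟨a, rfl⟩ := Ideal.mem_span_singleton'.1 hQ'
  obtain ⟨w, hw, h⟩ := h a
  have := S.add_mem (hK _ (K.add_mem (hL hQ) h)) (hW w hw)
  convert this using 1
  ring

/-- Descending induction on the exponent, first for `y_last` down to `1`, then modulo `y_last` for
`x_last` down to `0`. Both start at exponent `m + 1`, where the power already lies in the ideal. -/
theorem eq_top_of_complements {m : ℕ} {W W' : ℕ → Submodule ℂ (T m)}
    (hW : ∀ b, 1 ≤ b → b ≤ m →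
      ∀ Q, ∃ w ∈ W b, ∃ j ∈ elemIdeal m, ∃ r ∈ FT m (m + 1 - b), Q = w + j + swapXY m r)
    (hW' : ∀ a ≤ m,
      ∀ Q, ∃ w ∈ W' a, ∃ j ∈ elemIdeal m, ∃ r ∈ FT m (max 1 (m - a)), Q = w + j + r)
    {S : Submodule ℂ (T (m + 1))} (hS : ∀ P ∈ elemIdeal (m + 1), P ∈ S)
    (hWS : ∀ b, 1 ≤ b → b ≤ m → ∀ w ∈ W b, y (Fin.last m) ^ b * inclT m w ∈ S)
    (hWS' : ∀ a ≤ m, ∀ w ∈ W' a, x (Fin.last m) ^ a * inclT m w ∈ S) : S = ⊤ := by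
  have hy : ∀ b, 1 ≤ b → b ≤ m + 1 →
      ∀ P ∈ elemIdeal (m + 1) ⊔ Ideal.span {y (Fin.last m) ^ b}, P ∈ S := by
    intro b hb hbm
    induction hbm using Nat.decreasingInduction with
    | self =>
      rwa [sup_eq_left.2]
      rw [Ideal.span_le, Set.singleton_subset_iff]
      exact y_last_pow_mem m
    | of_succ b hbm ih =>
      exact sup_span_singleton_le (exists_y_last_pow_mul_sub_mem hb (hW b hb (by omega)))
        (ih (by omega)) (hWS b hb (by omega)) le_sup_left
  have hx : ∀ a ≤ m + 1, ∀ P ∈ elemIdeal (m + 1) ⊔ Ideal.span {y (Fin.last m)} ⊔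
      Ideal.span {x (Fin.last m) ^ a}, P ∈ S := by
    intro a ham
    induction ham using Nat.decreasingInduction with
    | self =>
      rw [sup_eq_left.2]
      · simpa using hy 1 le_rfl (by omega)
      rw [Ideal.span_le, Set.singleton_subset_iff]
      exact Ideal.mem_sup_left (x_last_pow_mem m)
    | of_succ a ham ih =>
      exact sup_span_singleton_le (exists_x_last_pow_mul_sub_mem (hW' a (by omega)))
        ih (hWS' a (by omega)) le_sup_left
  refine eq_top_iff.2 fun P _ => hx 0 (Nat.zero_le _) P (Ideal.mem_sup_right ?_)
  rw [pow_zero]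
  exact Ideal.mem_span_singleton'.2 ⟨P, mul_one P⟩

/-- Each summand is a layer's dimension bound in units of `m!/2`; the total times `m!` is `(m +
2)!`, twice the bound claimed for `m + 1` letters. -/
theorem sum_complement_bounds (m : ℕ) :
    ∑ b : Fin m, (m - (b : ℕ) + 1) + ∑ a : Fin (m + 1), (max 1 (m - (a : ℕ)) + 1) =
      (m + 1) * (m + 2) := by
  have h1 : ∀ m : ℕ, 2 * ∑ b : Fin m, (m - (b : ℕ) + 1) = m * (m + 3) := by
    intro m
    induction m with
    | zero => simp
    | succ m ih =>
      rw [Fin.sum_univ_succ]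
      simp only [Fin.val_zero, Fin.val_succ, Nat.add_sub_add_right, Nat.sub_zero]
      rw [mul_add, ih]
      ring
  have h2 : ∀ m : ℕ, 2 * ∑ a : Fin (m + 1), (max 1 (m - (a : ℕ)) + 1) = 4 + m * (m + 3) := by
    intro m
    induction m with
    | zero => simp
    | succ m ih =>
      rw [Fin.sum_univ_succ]
      simp only [Fin.val_zero, Fin.val_succ, Nat.add_sub_add_right, Nat.sub_zero]
      rw [mul_add, ih, max_eq_right (by omega)]
      ring
  have := h1 m
  have := h2 m
  nlinarith

/-! ### The dimension bound by induction on the number of letters -/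

theorem dimBound_one : DimBound 1 := by
  have hx0 : (x 0 : T 1) ∈ elemIdeal 1 := by
    have : e 1 1 = x 0 := by simp [e_eq_elemSymm, elemSymm, Finset.powersetCard_one]
    exact this ▸ e_mem le_rfl
  have hy0 : (y 0 : T 1) ∈ elemIdeal 1 := by
    have : f 1 1 = y 0 := by simp [f_eq_elemSymm, elemSymm, Finset.powersetCard_one]
    exact this ▸ f_mem le_rfl
  have hall : ∀ P : T 1, ∃ c : ℂ, P - algebraMap ℂ _ c ∈ elemIdeal 1 := by
    intro P
    induction P using T_induction with
    | hC c => exact ⟨c, by simp⟩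
    | hadd P Q hP hQ =>
      obtain ⟨c, hc⟩ := hP
      obtain ⟨d, hd⟩ := hQ
      refine ⟨c + d, ?_⟩
      convert Ideal.add_mem _ hc hd using 1
      rw [map_add]; ring
    | hmul P Q hP hQ =>
      obtain ⟨c, hc⟩ := hP
      obtain ⟨d, hd⟩ := hQ
      refine ⟨c * d, ?_⟩
      convert Ideal.add_mem _ (Ideal.mul_mem_right Q _ hc)
        (Ideal.mul_mem_left _ (algebraMap ℂ _ c) hd) using 1
      rw [map_mul]; ring
    | hx k => rw [Subsingleton.elim k 0]; exact ⟨0, by simpa using hx0⟩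
    | hy k => rw [Subsingleton.elim k 0]; exact ⟨0, by simpa using hy0⟩
  have hs : Function.Surjective
      ((filtSubmodule 1 1).mkQ ∘ₗ Algebra.linearMap ℂ (T 1)) := by
    intro z
    obtain ⟨P, rfl⟩ := Submodule.mkQ_surjective _ z
    obtain ⟨c, hc⟩ := hall P
    exact ⟨c, ((Submodule.Quotient.eq _).2 (Ideal.mem_sup_left hc)).symm⟩
  have h := finrank_le_of_surjective hs
  rw [Module.finrank_self] at h
  exact ⟨Module.Finite.of_surjective _ hs, by simp [Nat.factorial]; omega⟩

theorem DimBound.succ {m : ℕ} (hm : 1 ≤ m) (h : DimBound m) : DimBound (m + 1) := by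
  choose W hWfd hWd hW using fun b : Fin m => h.exists_complement_swapXY
    (p := m - b) (by omega) (by omega)
  choose W' hWfd' hWd' hW' using fun a : Fin (m + 1) => h.exists_complement
    (p := max 1 (m - a)) (by omega) (by omega)
  let g : ((∀ b, W b) × ∀ a, W' a) →ₗ[ℂ] T (m + 1) :=
    LinearMap.coprod
      (∑ b : Fin m, LinearMap.mulLeft ℂ (y (Fin.last m) ^ ((b : ℕ) + 1)) ∘ₗ
        (inclT m).toLinearMap ∘ₗ (W b).subtype ∘ₗ LinearMap.proj b)
      (∑ a : Fin (m + 1), LinearMap.mulLeft ℂ (x (Fin.last m) ^ (a : ℕ)) ∘ₗ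
        (inclT m).toLinearMap ∘ₗ (W' a).subtype ∘ₗ LinearMap.proj a)
  have hg1 : ∀ (b : Fin m) (w : W b), g (Pi.single b w, 0) =
      y (Fin.last m) ^ ((b : ℕ) + 1) * inclT m w := by
    intro b w
    simp only [g, LinearMap.coprod_apply, map_zero, add_zero, LinearMap.sum_apply]
    rw [Finset.sum_eq_single b]
    · simp
    · intro b' _ hb'; simp [Pi.single_eq_of_ne hb']
    · simp
  have hg2 : ∀ (a : Fin (m + 1)) (w : W' a), g (0, Pi.single a w) =
      x (Fin.last m) ^ (a : ℕ) * inclT m w := by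
    intro a w
    simp only [g, LinearMap.coprod_apply, map_zero, zero_add, LinearMap.sum_apply]
    rw [Finset.sum_eq_single a]
    · simp
    · intro b' _ hb'; simp [Pi.single_eq_of_ne hb']
    · simp
  have htop : LinearMap.range g ⊔ filtSubmodule (m + 1) (m + 1) = ⊤ := by
    refine eq_top_of_complements (m := m)
      -- The `y`-exponents run from `1` to `m`, so index `b - 1` belongs to exponent `b`, with
      -- filtration degree `m - (b - 1) = m + 1 - b`.
      (W := fun b => if hb : b - 1 < m then W ⟨b - 1, hb⟩ else ⊥)
      (W' := fun a => if ha : a < m + 1 then W' ⟨a, ha⟩ else ⊥) ?_ ?_ ?_ ?_ ?_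
    · intro b hb hbm
      have hb' : b - 1 < m := by omega
      have := hW ⟨b - 1, hb'⟩
      rw [dif_pos hb', show m + 1 - b = m - (b - 1) by omega]
      exact this
    · intro a ha
      rw [dif_pos (by omega : a < m + 1)]
      exact hW' ⟨a, by omega⟩
    · exact fun P hP => Submodule.mem_sup_right (Ideal.mem_sup_left hP)
    · intro b hb hbm w hw
      have hb' : b - 1 < m := by omega
      rw [dif_pos hb'] at hw
      have := hg1 ⟨b - 1, hb'⟩ ⟨w, hw⟩
      rw [show ((⟨b - 1, hb'⟩ : Fin m) : ℕ) + 1 = b from Nat.sub_add_cancel hb] at this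
      exact Submodule.mem_sup_left ⟨_, this⟩
    · intro a ha w hw
      rw [dif_pos (by omega : a < m + 1)] at hw
      exact Submodule.mem_sup_left ⟨_, hg2 ⟨a, by omega⟩ ⟨w, hw⟩⟩
  have hs : Function.Surjective ((filtSubmodule (m + 1) (m + 1)).mkQ ∘ₗ g) := by
    intro z
    obtain ⟨P, rfl⟩ := Submodule.mkQ_surjective _ z
    obtain ⟨_, ⟨v, rfl⟩, Q, hQ, rfl⟩ := Submodule.mem_sup.1 (htop ▸ Submodule.mem_top : P ∈ _ ⊔ _)
    refine ⟨v, ?_⟩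
    have hQ0 : (filtSubmodule (m + 1) (m + 1)).mkQ Q = 0 :=
      (Submodule.Quotient.mk_eq_zero _).2 hQ
    rw [map_add, hQ0, add_zero]
    rfl
  refine ⟨Module.Finite.of_surjective _ hs, ?_⟩
  have h1 := finrank_le_of_surjective hs
  rw [Module.finrank_prod, Module.finrank_pi_fintype, Module.finrank_pi_fintype] at h1
  have h2 := Finset.sum_le_sum fun b (_ : b ∈ Finset.univ) => hWd b
  have h3 := Finset.sum_le_sum fun a (_ : a ∈ Finset.univ) => hWd' a
  rw [← Finset.mul_sum, ← Finset.sum_mul] at h2 h3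
  rw [Nat.factorial_succ, Nat.factorial_succ]
  calc _ ≤ 2 * (∑ b, Module.finrank ℂ (W b) + ∑ a, Module.finrank ℂ (W' a)) :=
        Nat.mul_le_mul_left 2 h1
    _ ≤ (m + 1) * (m + 2) * m.factorial := by
        rw [← sum_complement_bounds, add_mul, mul_add]
        exact Nat.add_le_add h2 h3
    _ = _ := by ring

theorem dimBound {n : ℕ} (hn : 1 ≤ n) : DimBound n := by
  induction n, hn using Nat.le_induction with
  | base => exact dimBound_one
  | succ m hm ih => exact ih.succ hm

/-! ### The graded pieces -/

/-- The class map `F^p A^{⊗ n} → gr^p R_n`. -/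
def grLin (n p : ℕ) : (FT n p).restrictScalars ℂ →ₗ[ℂ] gr n p where
  toFun P := grMk P.1 P.2
  map_add' _ _ := rfl
  map_smul' _ _ := rfl

theorem grLin_surjective (n p : ℕ) : Function.Surjective (grLin n p) := by
  intro z
  obtain ⟨⟨z, hz⟩, rfl⟩ := Submodule.Quotient.mk_surjective _ z
  obtain ⟨P, hP, rfl⟩ := (Ideal.mem_map_iff_of_surjective _ Ideal.Quotient.mk_surjective).1
    (show z ∈ (FT n p).map (Ideal.Quotient.mk (J n)) from hz)
  exact ⟨⟨P, hP⟩, rfl⟩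

theorem grMk_eq_zero_iff {n p : ℕ} {P : T n} (hP : P ∈ FT n p) :
    grMk P hP = 0 ↔ P ∈ elemIdeal n ⊔ FT n (p + 1) := by
  rw [grMk, Submodule.Quotient.mk_eq_zero, ← J_eq_elemIdeal]
  show Ideal.Quotient.mk (J n) P ∈ (FT n (p + 1)).map (Ideal.Quotient.mk (J n)) ↔ _
  rw [← Ideal.mem_comap, Ideal.comap_map_of_surjective _ Ideal.Quotient.mk_surjective,
    ← RingHom.ker_eq_comap_bot, Ideal.mk_ker, sup_comm]

theorem grLin_eq_zero_iff {n p : ℕ} {P : (FT n p).restrictScalars ℂ} :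
    grLin n p P = 0 ↔ (P : T n) ∈ elemIdeal n ⊔ FT n (p + 1) := grMk_eq_zero_iff P.2

theorem repgr_grMk {n p : ℕ} (σ : Equiv.Perm (Fin n)) {P : T n} (hP : P ∈ FT n p)
    (hP' : perm n σ P ∈ FT n p) : repgr n p σ (grMk P hP) = grMk (perm n σ P) hP' := rfl

theorem gr_induction {n p : ℕ} {q : gr n p → Prop} (h : ∀ P (hP : P ∈ FT n p), q (grMk P hP))
    (z : gr n p) : q z := by
  obtain ⟨P, rfl⟩ := grLin_surjective n p z
  exact h P.1 P.2

theorem exists_linearMap_gr {n p : ℕ} {V : Type*} [AddCommGroup V] [Module ℂ V] (Ψ : T n →ₗ[ℂ] V)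
    (h : ∀ P ∈ FT n p, P ∈ elemIdeal n ⊔ FT n (p + 1) → Ψ P = 0) :
    ∃ l : gr n p →ₗ[ℂ] V, ∀ P (hP : P ∈ FT n p), l (grMk P hP) = Ψ P := by
  obtain ⟨l, hl⟩ := exists_linearMap_of_ker_le (grLin_surjective n p)
    (h := Ψ.domRestrict ((FT n p).restrictScalars ℂ)) (fun P hP => h P P.2 (grLin_eq_zero_iff.1 hP))
  exact ⟨l, fun P hP => hl ⟨P, hP⟩⟩

/-- The layer is the difference of two quotients: the larger is bounded above through the total
dimension, the smaller below by the accumulated lower bounds, and the two bounds differ by `n!/2`.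
-/
theorem finiteDimensional_gr {n p : ℕ} (hp : 1 ≤ p) (hpn : p < n) :
    FiniteDimensional ℂ (gr n p) ∧ 2 * Module.finrank ℂ (gr n p) ≤ n.factorial := by
  obtain ⟨hfd, hd⟩ := dimBound (show 1 ≤ n by omega)
  have hfd' := finiteDimensional_quotient_filtSubmodule (n := n) (Nat.succ_le_of_lt hpn)
  have h := finrank_quotient_add_le (filtSubmodule_eq_sup n p) (grLin_surjective n p)
    fun P hP => grLin_eq_zero_iff.2 hP
  have h1 := two_mul_finrank_le_of_total (p := p + 1) (by omega) hpn hd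
  have h2 := succ_mul_factorial_le hp hpn.le
    (finiteDimensional_quotient_filtSubmodule (Nat.le_succ p))
  refine ⟨h.1, ?_⟩
  linarith [h.2, add_mul (p + 1) 1 n.factorial]

/-- The equivariant surjection from `gr^i R_n` is bijective, since its source has dimension at most
`n!/2` and its target at least `n!/2`. -/
theorem nonempty_equiv_indSign {n i : ℕ} (hi : 1 ≤ i) (hin : i < n) (hn : 2 ≤ n) :
    Nonempty ((repgr n i).Equiv (indSign hn)) := by
  obtain ⟨Ψ, h0, hs, hΨ⟩ := exists_surjection_indSign hi hin hn
  obtain ⟨l, hl⟩ := exists_linearMap_gr (n := n) (p := i) Ψ fun P hP hP' =>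
    h0 P (FT_inf_sup_le hi hin ⟨hP, hP'⟩)
  have hsurj : Function.Surjective l := fun v => by
    obtain ⟨P, hP, rfl⟩ := hs v
    exact ⟨_, hl P hP⟩
  obtain ⟨hfd, hd⟩ := finiteDimensional_gr hi hin
  have hfd' : FiniteDimensional ℂ (Representation.IndV (inclS2 hn) signRep) :=
    Module.Finite.of_surjective l hsurj
  have h1 := finrank_le_of_surjective hsurj
  have h2 := factorial_le_two_mul_finrank hn
  have hinj : Function.Injective l :=
    (LinearMap.injective_iff_surjective_of_finrank_eq_finrank (by omega)).2 hsurj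
  have heq : ∀ σ, l ∘ₗ repgr n i σ = indSign hn σ ∘ₗ l := by
    refine fun σ => LinearMap.ext fun z => ?_
    induction z using gr_induction with
    | h P hP =>
      have hP' : perm n σ P ∈ FT n i := FT_stable n i σ hP
      rw [LinearMap.comp_apply, LinearMap.comp_apply, repgr_grMk σ hP hP', hl, hl, hΨ]
  exact ⟨Representation.IntertwiningMap.ofBijective ⟨l, heq⟩ ⟨hinj, hsurj⟩⟩

/-! ### The exact sequence -/

theorem gI_succ_le (n i j : ℕ) : gI n i (j + 1) ≤ gI n i j := by
  refine Ideal.span_le.2 ?_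
  rintro _ (((⟨k, hk, h, rfl⟩ | ⟨S, hS, rfl⟩) | ⟨k, hk, -, rfl⟩) | ⟨S, hS, rfl⟩)
  · exact elemIdeal_le_gI n i j (e_mem hk)
  · exact xProd_mem_gI hS.ge
  · exact elemIdeal_le_gI n i j (f_mem hk)
  · exact FT_le_gI n i j (yProd_mem_FT_of_le (by omega))

theorem gI_le_sup (n i j : ℕ) : gI n i j ≤ gI n i (j + 1) ⊔ FT n j := by
  refine Ideal.span_le.2 ?_
  rintro _ (((⟨k, hk, h, rfl⟩ | ⟨S, hS, rfl⟩) | ⟨k, hk, -, rfl⟩) | ⟨S, hS, rfl⟩)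
  · exact Ideal.mem_sup_left (elemIdeal_le_gI n i (j + 1) (e_mem hk))
  · exact Ideal.mem_sup_left (xProd_mem_gI hS.ge)
  · exact Ideal.mem_sup_left (elemIdeal_le_gI n i (j + 1) (f_mem hk))
  · exact Ideal.mem_sup_right (yProd_mem_FT hS)

/-- Exactness in the middle holds because the two ideals differ only by `F^i`: `f_i` lies in both,
and the generators `y_J` with `|J| = i` are the new ones. Injectivity is `FT_inf_gI_le`, together
with `f_i ∈ J_n` for `i ≥ 1`. -/
theorem exists_exact_sequence {n i : ℕ} (hi : 1 ≤ i) (hin : i < n) :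
    ∃ (φ : (repgr n i).IntertwiningMap (repgR n (n - i) (i + 1)))
      (ψ : (repgR n (n - i) (i + 1)).IntertwiningMap (repgR n (n - i) i)),
      (∀ (P : T n) (hP : P ∈ FT n i),
        φ (grMk P hP) = Ideal.Quotient.mk (gI n (n - i) (i + 1)) P) ∧
      (∀ P : T n,
        ψ (Ideal.Quotient.mk (gI n (n - i) (i + 1)) P) = Ideal.Quotient.mk (gI n (n - i) i) P) ∧
      Function.Injective φ ∧ Function.Exact φ ψ ∧ Function.Surjective ψ := by
  obtain ⟨l, hl⟩ := exists_linearMap_gr (n := n) (p := i)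
    (Ideal.Quotient.mkₐ ℂ (gI n (n - i) (i + 1))).toLinearMap fun P _ hP =>
      Ideal.Quotient.eq_zero_iff_mem.2 (sup_le (elemIdeal_le_gI _ _ _) (FT_le_gI _ _ _) hP)
  have hl' : ∀ (P : T n) (hP : P ∈ FT n i),
      l (grMk P hP) = Ideal.Quotient.mk (gI n (n - i) (i + 1)) P := hl
  let q : gR n (n - i) (i + 1) →ₗ[ℂ] gR n (n - i) i :=
    (Ideal.Quotient.factorₐ ℂ (gI_succ_le n (n - i) i)).toLinearMap
  have hq : ∀ P : T n, q (Ideal.Quotient.mk (gI n (n - i) (i + 1)) P) =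
      Ideal.Quotient.mk (gI n (n - i) i) P := fun P => rfl
  have hleq : ∀ σ, l ∘ₗ repgr n i σ = repgR n (n - i) (i + 1) σ ∘ₗ l := by
    refine fun σ => LinearMap.ext fun z => ?_
    induction z using gr_induction with
    | h P hP =>
      have hP' : perm n σ P ∈ FT n i := FT_stable n i σ hP
      rw [LinearMap.comp_apply, LinearMap.comp_apply, repgr_grMk σ hP hP', hl', hl', repgR,
        quotRep_mk]
  have hqeq : ∀ σ, q ∘ₗ repgR n (n - i) (i + 1) σ = repgR n (n - i) i σ ∘ₗ q := by
    refine fun σ => LinearMap.ext fun z => ?_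
    obtain ⟨P, rfl⟩ := Ideal.Quotient.mk_surjective z
    rw [LinearMap.comp_apply, LinearMap.comp_apply, hq, repgR, repgR, quotRep_mk, quotRep_mk, hq]
  refine ⟨⟨l, hleq⟩, ⟨q, hqeq⟩, hl', hq, ?_, ?_, ?_⟩
  · show Function.Injective l
    refine (injective_iff_map_eq_zero l).2 fun z => ?_
    induction z using gr_induction with
    | h P hP =>
      intro h
      rw [hl', Ideal.Quotient.eq_zero_iff_mem] at h
      exact (grMk_eq_zero_iff hP).2 (relIdeal_le_sup hi (FT_inf_gI_le hi hin ⟨hP, h⟩))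
  · show Function.Exact l q
    intro z
    obtain ⟨P, rfl⟩ := Ideal.Quotient.mk_surjective z
    rw [hq, Ideal.Quotient.eq_zero_iff_mem]
    constructor
    · intro hP
      obtain ⟨Q, hQ, Q', hQ', rfl⟩ := Submodule.mem_sup.1 (gI_le_sup _ _ _ hP)
      refine ⟨grMk Q' hQ', ?_⟩
      rw [hl', map_add, Ideal.Quotient.eq_zero_iff_mem.2 hQ, zero_add]
    · rintro ⟨z, hz⟩
      induction z using gr_induction with
      | h Q hQ =>
        rw [hl', Ideal.Quotient.eq] at hz
        have := Ideal.sub_mem _ (FT_le_gI n (n - i) i hQ) (gI_succ_le _ _ _ hz)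
        rwa [sub_sub_cancel] at this
  · show Function.Surjective q
    intro z
    obtain ⟨P, rfl⟩ := Ideal.Quotient.mk_surjective z
    exact ⟨_, hq P⟩

end DoublePoint

end

theorem corollary3 (n i : ℕ) (hi : 1 ≤ i) (hin : i < n) :
    (∃ (φ : (DoublePoint.repgr n i).IntertwiningMap (DoublePoint.repgR n (n - i) (i + 1)))
      (ψ : (DoublePoint.repgR n (n - i) (i + 1)).IntertwiningMap (DoublePoint.repgR n (n - i) i)),
      (∀ (P : DoublePoint.T n) (hP : P ∈ DoublePoint.FT n i),
        φ (DoublePoint.grMk P hP) =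
          Ideal.Quotient.mk (DoublePoint.gI n (n - i) (i + 1)) P) ∧
      (∀ P : DoublePoint.T n,
        ψ (Ideal.Quotient.mk (DoublePoint.gI n (n - i) (i + 1)) P) =
          Ideal.Quotient.mk (DoublePoint.gI n (n - i) i) P) ∧
      Function.Injective φ ∧ Function.Exact φ ψ ∧ Function.Surjective ψ) ∧
    Nonempty ((DoublePoint.repgr n i).Equiv
      (DoublePoint.indSign (show 2 ≤ n by omega))) :=
  ⟨DoublePoint.exists_exact_sequence hi hin, DoublePoint.nonempty_equiv_indSign hi hin _⟩
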